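/- Let $\mathbb D$ be the open unit disk, $\mathbb T=\partial\mathbb D$, $dA$ the normalized area measure on $\mathbb D$, and let $\mu$ be a finite, nonzero, positive Borel measure on $\overline{\mathbb D}$. For $z\in\mathbb D$ put $$U_\mu(z)=\int_{\mathbb D}\log\left|\frac{1-\overline w z}{z-w}\right|^2\frac{d\mu(w)}{1-|w|^2}+\int_{\mathbb T}\frac{1-|z|^2}{|1-\overline w z|^2}\,d\mu(w),\qquad V_\mu(z)=\int_{\overline{\mathbb D}}\frac{1-|z|^2}{|1-\overline w z|^2}\,d\mu(w).$$ Let $D(\mu)$ be the space of holomorphic $f$ on $\mathbb D$ with $\int_{\mathbb D}|f'|^2U_\mu\,dA<\infty$, normed by $\|f\|_{D(\mu)}^2=\|f\|_{H^2}^2+\int_{\mathbb D}|f'|^2U_\mu\,dA$, let $D(\mu)_0=\{f\in D(\mu): f(0)=0\}$, and let $M(D(\mu))=\{\phi\in D(\mu):\ \phi f\in D(\mu)\ \forall f\in D(\mu)\}$. A positive Borel measure $\nu$ on $\mathbb D$ is a $D(\mu)$-Carleson measure if there is a finite constant $C$ with $\int_{\mathbb D}|f|^2\,d\nu\le C\|f\|_{D(\mu)}^2$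 for all $f\in D(\mu)$. For $f\in L^2(\mathbb T)$ let $P(f)$ be its Poisson extension to $\mathbb D$ and, for $\lambda\in\overline{\mathbb D}$, let $$D_\lambda(P(f))=\int_{\mathbb T}\left|\frac{f(w)-P(f)(\lambda)}{w-\lambda}\right|^2\frac{|dw|}{2\pi},$$ where for $\lambda\in\mathbb T$ the number $P(f)(\lambda)$ is the nontangential limit of $P(f)$ at $\lambda$, and $D_\lambda(P(f))=\infty$ if this limit does not exist. The harmonic Dirichlet-type space is $$HD(\mu)=\Big\{f\in L^2(\mathbb T):\ \int_{\overline{\mathbb D}}D_\lambda(P(f))\,d\mu(\lambda)<\infty\Big\},$$ and $M(HD(\mu))=\{\phi\in HD(\mu):\ \phi f\in HD(\mu)\ \forall f\in HD(\mu)\}$. Then: 1. A function $\phi$ on $\mathbb D$ belongs to $M(D(\mu))$ if and only if $\phi\in H^\infty$ and $|\phi'|^2U_\mu\,dA$ is a $D(\mu)$-Carleson measure; equivalently, if and only if $\phi\in H^\infty$ and $|\phi'|^2V_\mu\,dA$ is a $D(\mu)$-Carleson measure. 2. Identifying a function on $\mathbb D$ with its boundary function in $L^2(\mathbb T)$ (the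 $L^2(\mathbb T)$-limit of $w\mapsto f(rw)$ as $r\to1^-$), one has $HD(\mu)=D(\mu)+\overline{D(\mu)_0}$, and $M(D(\mu))\subseteq M(HD(\mu))$. In particular every $\phi\in M(D(\mu))$ has such a boundary function. -/

import Mathlib

open MeasureTheory Filter Topology Metric
open scoped ENNReal NNReal ComplexConjugate

namespace DirichletType

noncomputable section

/-! Functions on the open unit disk `ball 0 1` are functions `ℂ → ℂ`; every notion below depends
only on their restriction to that disk. -/

/-- The space `Hol(𝔻)` of holomorphic functions on the open unit disk. -/
def Hol : Set (ℂ → ℂ) :=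
  {f | DifferentiableOn ℂ f (ball 0 1)}

/-- The space `H^∞` of bounded holomorphic functions on the open unit disk. -/
def Hinf : Set (ℂ → ℂ) :=
  {f | f ∈ Hol ∧ ∃ C : ℝ, ∀ z ∈ ball (0 : ℂ) 1, ‖f z‖ ≤ C}

/-- The normalized area measure `dA` on the unit disk, of total mass one. -/
def areaMeasure : Measure ℂ :=
  ENNReal.ofReal (Real.pi)⁻¹ • (volume : Measure ℂ).restrict (ball 0 1)

/-- The unit circle `𝕋`, parametrized by `x ↦ exp (2 π i x)`. -/
abbrev 𝕋 : Type := UnitAddCircle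

/-- The point `exp (2 π i x)` of the unit circle. -/
def pt (x : 𝕋) : ℂ := (AddCircle.toCircle x : ℂ)

/-- The normalized arc length `|dw| / 2π` on the unit circle. -/
abbrev arc : Measure 𝕋 := AddCircle.haarAddCircle

/-- The kernel `log |(1 - conj w z) / (z - w)|^2` (twice the Green function of the disk),
with value `∞` on the diagonal. It is positive for distinct `z`, `w` in the disk. -/
def logKernel (w z : ℂ) : ℝ≥0∞ :=
  if z = w then ⊤ else ENNReal.ofReal (Real.log (‖(1 - conj w * z) / (z - w)‖ ^ 2))

/-- The kernel `(1 - |z|^2) / |1 - conj w z|^2`. -/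
def szegoKernel (w z : ℂ) : ℝ≥0∞ :=
  ENNReal.ofReal ((1 - ‖z‖ ^ 2) / ‖1 - conj w * z‖ ^ 2)

/-- The superharmonic weight `U_μ` on the disk. -/
def U (μ : Measure ℂ) (z : ℂ) : ℝ≥0∞ :=
  (∫⁻ w in ball 0 1, logKernel w z / ENNReal.ofReal (1 - ‖w‖ ^ 2) ∂μ) +
    ∫⁻ w in sphere 0 1, szegoKernel w z ∂μ

/-- The weight `V_μ` on the disk. -/
def V (μ : Measure ℂ) (z : ℂ) : ℝ≥0∞ :=
  ∫⁻ w in closedBall 0 1, szegoKernel w z ∂μ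

/-- The weighted Dirichlet integral `∫_𝔻 |f'|^2 U_μ dA`. -/
def energy (μ : Measure ℂ) (f : ℂ → ℂ) : ℝ≥0∞ :=
  ∫⁻ z, ‖deriv f z‖ₑ ^ 2 * U μ z ∂areaMeasure

/-- The Dirichlet-type space `D(μ)`. -/
def D (μ : Measure ℂ) : Set (ℂ → ℂ) :=
  {f | f ∈ Hol ∧ energy μ f < ⊤}

/-- The square of the Hardy space norm, `sup_{0 ≤ r < 1} ∫_𝕋 |f (r w)|^2 |dw| / 2π`. -/
def hardyNormSq (f : ℂ → ℂ) : ℝ≥0∞ :=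
  ⨆ r ∈ Set.Ico (0 : ℝ) 1, ∫⁻ x, ‖f (r * pt x)‖ₑ ^ 2 ∂arc

/-- The square of the norm of `D(μ)`. -/
def normSqD (μ : Measure ℂ) (f : ℂ → ℂ) : ℝ≥0∞ :=
  hardyNormSq f + energy μ f

/-- The multiplier algebra `M(D(μ))`. -/
def multD (μ : Measure ℂ) : Set (ℂ → ℂ) :=
  {φ | φ ∈ D μ ∧ ∀ f ∈ D μ, φ * f ∈ D μ}

/-- `ν` is a `D(μ)`-Carleson measure: `∫_𝔻 |f|^2 dν ≤ C ‖f‖^2` on `D(μ)`, for a finite `C`. -/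
def IsCarleson (μ ν : Measure ℂ) : Prop :=
  ∃ C : ℝ≥0, ∀ f ∈ D μ, ∫⁻ z in ball 0 1, ‖f z‖ₑ ^ 2 ∂ν ≤ C * normSqD μ f

/-- The measure `|φ'|^2 W dA` on the disk. -/
def derivMeasure (φ : ℂ → ℂ) (W : ℂ → ℝ≥0∞) : Measure ℂ :=
  areaMeasure.withDensity (fun z => ‖deriv φ z‖ₑ ^ 2 * W z)

/-- The harmonic extension `P(g)` of a function on the circle to the disk (Poisson integral). -/
def poisson (g : 𝕋 → ℂ) (z : ℂ) : ℂ :=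
  ∫ x, (poissonKernel 0 z (pt x) : ℂ) * g x ∂arc

/-- `a` is the nontangential limit of `u` at the point `ζ` of the unit circle: the limit along
every Stolz region with vertex `ζ`. -/
def HasNTLimit (u : ℂ → ℂ) (ζ a : ℂ) : Prop :=
  ∀ κ : ℝ, 1 < κ → Tendsto u (𝓝[{z | ‖z‖ < 1 ∧ ‖z - ζ‖ < κ * (1 - ‖z‖)}] ζ) (𝓝 a)

/-- `a` is the value of `P(g)` at the point `ζ` of the closed disk: the actual value if `ζ` is in
the open disk, and the nontangential limit if `ζ` is on the circle. -/
def HasValue (g : 𝕋 → ℂ) (ζ a : ℂ) : Prop :=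
  (‖ζ‖ < 1 ∧ a = poisson g ζ) ∨ (‖ζ‖ = 1 ∧ HasNTLimit (poisson g) ζ a)

/-- The local Dirichlet integral `D_ζ(P(g)) = ∫_𝕋 |(g w - P(g) ζ) / (w - ζ)|^2 |dw| / 2π` at a point
`ζ` of the closed disk. There is at most one `a` to take the infimum over; if there is none (no
nontangential limit at a point `ζ` of the circle), the infimum is `∞`. -/
def localDirichlet (g : 𝕋 → ℂ) (ζ : ℂ) : ℝ≥0∞ :=
  ⨅ (a : ℂ) (_ : HasValue g ζ a), ∫⁻ x, ‖(g x - a) / (pt x - ζ)‖ₑ ^ 2 ∂arc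

/-- The harmonic Dirichlet-type space `HD(μ)`, as a set of square integrable functions on the
circle (closed under almost everywhere equality). -/
def HD (μ : Measure ℂ) : Set (𝕋 → ℂ) :=
  {g | MemLp g 2 arc ∧ ∫⁻ ζ in closedBall 0 1, localDirichlet g ζ ∂μ < ⊤}

/-- The multiplier algebra `M(HD(μ))`. -/
def multHD (μ : Measure ℂ) : Set (𝕋 → ℂ) :=
  {φ | φ ∈ HD μ ∧ ∀ g ∈ HD μ, φ * g ∈ HD μ}

/-- `g` is (a representative of) the boundary function in `L^2(𝕋)` of the function `f` on the disk:
the limit in `L^2(𝕋)` of the dilations `w ↦ f (r w)` as `r → 1-`. -/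
def IsBoundary (f : ℂ → ℂ) (g : 𝕋 → ℂ) : Prop :=
  MemLp g 2 arc ∧
    Tendsto (fun r : ℝ => eLpNorm (fun x => f (r * pt x) - g x) 2 arc) (𝓝[<] 1) (𝓝 0)

/-- The space `D(μ) + conj D(μ)_0` of functions on the circle, where `D(μ)_0` is the set of those
functions in `D(μ)` that vanish at the origin. -/
def sumSpace (μ : Measure ℂ) : Set (𝕋 → ℂ) :=
  {g | ∃ f₁ ∈ D μ, ∃ f₂ ∈ D μ, f₂ 0 = 0 ∧ ∃ g₁ g₂ : 𝕋 → ℂ,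
    IsBoundary f₁ g₁ ∧ IsBoundary f₂ g₂ ∧ g =ᵐ[arc] fun x => g₁ x + conj (g₂ x)}

end

end DirichletType

namespace DirichletType

/-! The two weights are interchangeable on holomorphic functions. Pointwise `V μ ≤ U μ`, because
`log (1/t) ≥ 1 - t` with `t = |ψ_w(z)|²`, where `ψ_w` is the disk automorphism exchanging `0` and
`w`. The converse fails pointwise at the logarithmic pole, but `∫ |g|² U dA ≤ 2 ∫ |g|² V dA` for
holomorphic `g` (`lintegral_mul_U_le`): an automorphism moves the pole to `0`, where both weights
are radial, monomials are orthogonal, and the moments `1/(n+1)²` and `1/((n+1)(n+2))` differ by a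
factor at most 2.

Multipliers: since `μ ≠ 0`, `V μ` dominates a multiple of `1 - |z|²`, so `D μ` lies in the Hardy
space and is modelled by a closed subspace of `ℓ² × L²(U dA)`. By the closed graph theorem a
multiplier `φ` acts by a bounded operator `T`. Applying `T ^ n` to the constant `1` gives `φ ^ n`,
and boundedness of point evaluations forces `φ` to be bounded. The product rule `(φ f)' = φ' f + φ
f'` then turns "`φ f` has finite energy" into the Carleson condition and back; since `f φ'` is
holomorphic, `U` may be replaced by `V`.

Harmonic space: write `P(g) = F + conj G` with `F`, `G` holomorphic and `G 0 = 0`. For every `ζ` in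
the closed disk the local Dirichlet integral is comparable, with absolute constants, to `∫ (|F'|² +
|G'|²) szegoKernel ζ dA` (`localDirichlet_le`, `localEnergy_le_localDirichlet`). Inside the disk
this is Parseval after composing with `ψ_ζ`. On the circle one approaches `ζ` radially and uses
Fatou's lemma; finiteness for some constant `a` forces `a` to be the nontangential limit.
Integrating in `μ`, Tonelli gives `g ∈ HD μ` iff `g ∈ L²` and `F, G ∈ D μ` (`mem_HD_iff`), which is
the sum decomposition.

Finally, a multiplier of `D μ` must also multiply conjugates. This follows from a pointwise identity
bounding the deviation of `φ conj u` by those of `u` and `φ u` (`exists_deviation_mul_conj_le`),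
both of which have finite integrals. -/

lemma norm_pt (x : 𝕋) : ‖pt x‖ = 1 := Circle.norm_coe _

lemma continuous_pt : Continuous pt :=
  continuous_subtype_val.comp AddCircle.continuous_toCircle

lemma fourier_eq_zpow (n : ℤ) (x : 𝕋) : fourier n x = pt x ^ n := by
  rw [fourier_apply, AddCircle.toCircle_zsmul, Circle.coe_zpow]; rfl

lemma fourier_natCast (n : ℕ) (x : 𝕋) : fourier (n : ℤ) x = pt x ^ n := by
  rw [fourier_eq_zpow, zpow_natCast]

lemma fourier_neg_natCast (n : ℕ) (x : 𝕋) : fourier (-(n : ℤ)) x = conj (pt x) ^ n := by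
  rw [fourier_neg, fourier_natCast, map_pow]

lemma norm_fourier_apply (n : ℤ) (x : 𝕋) : ‖fourier n x‖ = 1 := by
  rw [fourier_eq_zpow, norm_zpow, norm_pt, one_zpow]

lemma smul_pt_mem_ball {r : ℝ} (h0 : 0 ≤ r) (h1 : r < 1) (x : 𝕋) :
    (r : ℂ) * pt x ∈ ball (0 : ℂ) 1 := by
  rw [mem_ball_zero_iff, norm_mul, norm_pt, mul_one, Complex.norm_real, Real.norm_of_nonneg h0]
  exact h1

/-! ### Taylor coefficients -/

/-- The `n`-th Taylor coefficient at the origin. -/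
noncomputable def coef (f : ℂ → ℂ) (n : ℕ) : ℂ := (n.factorial : ℂ)⁻¹ * iteratedDeriv n f 0

lemma hasSum_coef {f : ℂ → ℂ} (hf : f ∈ Hol) {z : ℂ} (hz : z ∈ ball (0 : ℂ) 1) :
    HasSum (fun n => coef f n * z ^ n) (f z) := by
  have := Complex.hasSum_taylorSeries_on_ball (f := f) (c := 0) (r := 1) hf hz
  refine this.congr_fun fun n => ?_
  simp only [coef, sub_zero, smul_eq_mul]
  ring

lemma deriv_mem_Hol {f : ℂ → ℂ} (hf : f ∈ Hol) : deriv f ∈ Hol :=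
  DifferentiableOn.deriv hf isOpen_ball

lemma coef_deriv (f : ℂ → ℂ) (n : ℕ) : coef (deriv f) n = (n + 1) * coef f (n + 1) := by
  have : ((n : ℂ) + 1) ≠ 0 := by exact_mod_cast n.succ_ne_zero
  rw [coef, coef, ← iteratedDeriv_succ', Nat.factorial_succ]
  push_cast
  field_simp

lemma coef_zero (f : ℂ → ℂ) : coef f 0 = f 0 := by simp [coef]

lemma summable_norm_coef {f : ℂ → ℂ} (hf : f ∈ Hol) {r : ℝ} (h0 : 0 ≤ r) (h1 : r < 1) :
    Summable fun n => ‖coef f n‖ * r ^ n := by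
  have := (hasSum_coef hf (z := (r : ℂ)) (by simpa [abs_of_nonneg h0] using h1)).summable.norm
  simpa [abs_of_nonneg h0] using this

lemma differentiableAt_of_mem_Hol {f : ℂ → ℂ} (hf : f ∈ Hol) {z : ℂ} (hz : z ∈ ball (0 : ℂ) 1) :
    DifferentiableAt ℂ f z :=
  DifferentiableOn.differentiableAt hf (isOpen_ball.mem_nhds hz)

lemma continuous_dilation {f : ℂ → ℂ} (hf : f ∈ Hol) {r : ℝ} (h0 : 0 ≤ r) (h1 : r < 1) :
    Continuous fun x : 𝕋 => f (r * pt x) :=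
  ContinuousOn.comp_continuous (DifferentiableOn.continuousOn hf)
    (continuous_const.mul continuous_pt) (smul_pt_mem_ball h0 h1)

/-! ### Fourier coefficients -/

/-- Extension of a sequence by zero to the negative integers. -/
def extZero (c : ℕ → ℂ) : ℤ → ℂ
  | Int.ofNat n => c n
  | Int.negSucc _ => 0

@[simp] lemma extZero_natCast (c : ℕ → ℂ) (n : ℕ) : extZero c n = c n := rfl

@[simp] lemma extZero_negSucc (c : ℕ → ℂ) (n : ℕ) : extZero c (Int.negSucc n) = 0 := rfl

@[simp] lemma extZero_neg_succ (c : ℕ → ℂ) (n : ℕ) : extZero c (-((n : ℤ) + 1)) = 0 := by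
  rw [← Int.negSucc_eq]; rfl

lemma eq_zero_of_notMem_range_natCast {c : ℕ → ℂ} {n : ℤ} (hn : n ∉ Set.range ((↑) : ℕ → ℤ)) :
    extZero c n = 0 := by
  cases n with
  | ofNat n => exact absurd ⟨n, rfl⟩ hn
  | negSucc n => rfl

lemma fourierCoeff_of_hasSum {a : ℤ → ℂ} (ha : Summable fun n => ‖a n‖) {u : 𝕋 → ℂ}
    (hu : ∀ x, HasSum (fun n => a n * fourier n x) (u x)) (n : ℤ) : fourierCoeff u n = a n := by
  have key : HasSum (fun k => ∫ x, fourier (-n) x • (a k * fourier k x) ∂arc)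
      (∫ x, fourier (-n) x • u x ∂arc) := by
    have hnorm : ∀ (k : ℤ) (x : 𝕋), ‖(fourier (-n) x : ℂ) • (a k * fourier k x : ℂ)‖ = ‖a k‖ := by
      intro k x
      rw [norm_smul, norm_mul, norm_fourier_apply, norm_fourier_apply, one_mul, mul_one]
    have := hasSum_integral_of_summable_integral_norm (μ := arc)
      (F := fun k x => fourier (-n) x • (a k * fourier k x : ℂ)) ?_ ?_
    · have h4 : ∀ x : 𝕋, ∑' k, fourier (-n) x • (a k * fourier k x : ℂ) = fourier (-n) x • u x :=
        fun x => ((hu x).const_smul (fourier (-n) x)).tsum_eq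
      simpa only [h4] using this
    · intro k
      refine Continuous.integrable_of_hasCompactSupport (by fun_prop) ?_
      exact HasCompactSupport.of_compactSpace _
    · simpa only [hnorm, integral_const, probReal_univ, one_smul] using ha
  have h2 : ∀ k, ∫ x, fourier (-n) x • (a k * fourier k x) ∂arc = if k = n then a n else 0 := by
    intro k
    have : ∀ x : 𝕋, fourier (-n) x • (a k * fourier k x : ℂ) = a k * (fourier (-n) x • fourier k x) := by
      intro x; simp only [smul_eq_mul]; ring
    simp_rw [this]
    rw [integral_const_mul]
    have h3 := congrFun (fourierCoeff_fourier (T := 1) k) n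
    rw [fourierCoeff] at h3
    rw [h3]
    by_cases h : k = n
    · subst h; simp
    · simp [h, Ne.symm h]
  simp_rw [h2] at key
  exact key.unique (hasSum_ite_eq n (a n))

lemma fourierCoeff_of_hasSum_nat {c : ℕ → ℂ} (hc : Summable fun n => ‖c n‖) {u : 𝕋 → ℂ}
    (hu : ∀ x, HasSum (fun n => c n * pt x ^ n) (u x)) (n : ℤ) : fourierCoeff u n = extZero c n := by
  refine fourierCoeff_of_hasSum ?_ ?_ n
  · refine (Function.Injective.summable_iff (f := fun n : ℤ => ‖extZero c n‖) (g := ((↑) : ℕ → ℤ))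
      Nat.cast_injective ?_).1 ?_
    · intro n hn
      rw [eq_zero_of_notMem_range_natCast hn, norm_zero]
    · simpa only [Function.comp_def, extZero_natCast] using hc
  · intro x
    refine (Function.Injective.hasSum_iff (g := ((↑) : ℕ → ℤ)) Nat.cast_injective ?_).1 ?_
    · intro n hn
      simp [eq_zero_of_notMem_range_natCast hn]
    · simpa [Function.comp_def, fourier_natCast, -fourier_apply] using hu x

lemma fourierCoeff_dilation {f : ℂ → ℂ} (hf : f ∈ Hol) {r : ℝ} (h0 : 0 ≤ r) (h1 : r < 1) (n : ℤ) :
    fourierCoeff (fun x : 𝕋 => f (r * pt x)) n = extZero (fun n => coef f n * r ^ n) n := by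
  refine fourierCoeff_of_hasSum_nat ?_ ?_ n
  · simpa [abs_of_nonneg h0] using summable_norm_coef hf h0 h1
  · intro x
    simpa [mul_pow, mul_assoc] using hasSum_coef hf (smul_pt_mem_ball h0 h1 x)

lemma coef_eq_of_hasSum {f : ℂ → ℂ} {c : ℕ → ℂ}
    (hc : ∀ z ∈ ball (0 : ℂ) 1, HasSum (fun n => c n * z ^ n) (f z)) (n : ℕ) (hf : f ∈ Hol) :
    coef f n = c n := by
  -- Uniqueness of the expansion is read off from Fourier coefficients on one circle; any radius
  -- strictly between 0 and 1 would serve.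
  have h1 := fourierCoeff_dilation hf (r := 1 / 2) (by norm_num) (by norm_num) n
  have h2 := fourierCoeff_of_hasSum_nat (c := fun n => c n * ((1 / 2 : ℝ) : ℂ) ^ n)
    (u := fun x : 𝕋 => f ((1 / 2 : ℝ) * pt x)) ?_ ?_ n
  · rw [h1] at h2
    simpa using h2
  · exact (hc ((1 / 2 : ℝ) : ℂ) (by simp; norm_num)).summable.norm
  · intro x
    simpa [mul_pow, mul_assoc] using
      hc _ (smul_pt_mem_ball (r := 1 / 2) (by norm_num) (by norm_num) x)

lemma memLp_two_iff_lintegral {α : Type*} [MeasurableSpace α] {m : Measure α} {g : α → ℂ}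
    (hg : AEStronglyMeasurable g m) : MemLp g 2 m ↔ ∫⁻ x, ‖g x‖ₑ ^ 2 ∂m < ∞ := by
  rw [MemLp, and_iff_right hg, eLpNorm_lt_top_iff_lintegral_rpow_enorm_lt_top two_ne_zero
    ENNReal.ofNat_ne_top]
  simp

lemma lintegral_sq_eq_tsum_fourierCoeff {g : 𝕋 → ℂ} (hg : MemLp g 2 arc) :
    ∫⁻ x, ‖g x‖ₑ ^ 2 ∂arc = ∑' n : ℤ, ‖fourierCoeff g n‖ₑ ^ 2 := by
  have h1 := hasSum_sq_fourierCoeff (T := 1) (hg.toLp g)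
  have hc : ∀ n, fourierCoeff (hg.toLp g) n = fourierCoeff g n := fun n =>
    congrFun (fourierCoeff_congr_ae hg.coeFn_toLp) n
  simp_rw [hc] at h1
  have h2 : ∫ x, ‖(hg.toLp g) x‖ ^ 2 ∂arc = ∫ x, ‖g x‖ ^ 2 ∂arc :=
    integral_congr_ae (by filter_upwards [hg.coeFn_toLp] with x hx; rw [hx])
  rw [h2] at h1
  have h3 : ENNReal.ofReal (∫ x, ‖g x‖ ^ 2 ∂arc) = ∫⁻ x, ‖g x‖ₑ ^ 2 ∂arc := by
    rw [ofReal_integral_eq_lintegral_ofReal]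
    · simp_rw [ENNReal.ofReal_pow (norm_nonneg _), ofReal_norm]
    · exact (memLp_two_iff_integrable_sq_norm hg.1).1 hg
    · exact Eventually.of_forall fun x => by positivity
  rw [← h3, ← h1.tsum_eq, ENNReal.ofReal_tsum_of_nonneg (fun n => by positivity) h1.summable]
  simp_rw [ENNReal.ofReal_pow (norm_nonneg _), ofReal_norm]

lemma tsum_extZero (c : ℕ → ℂ) : ∑' n : ℤ, ‖extZero c n‖ₑ ^ 2 = ∑' n : ℕ, ‖c n‖ₑ ^ 2 := by
  rw [← Function.Injective.tsum_eq (g := ((↑) : ℕ → ℤ)) Nat.cast_injective]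
  · simp
  · intro n hn
    by_contra h
    exact hn (by simp [eq_zero_of_notMem_range_natCast h])

lemma memLp_of_continuous {g : 𝕋 → ℂ} (hg : Continuous g) (p : ℝ≥0∞) : MemLp g p arc := by
  obtain ⟨C, hC⟩ := isCompact_univ.exists_bound_of_continuousOn hg.continuousOn
  exact MemLp.of_bound hg.aestronglyMeasurable C (Eventually.of_forall fun x => hC x trivial)

lemma enorm_mul_pow_sq (a : ℂ) {r : ℝ} (h0 : 0 ≤ r) (n : ℕ) :
    ‖a * (r : ℂ) ^ n‖ₑ ^ 2 = ‖a‖ₑ ^ 2 * ENNReal.ofReal (r ^ (2 * n)) := by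
  rw [enorm_mul, mul_pow, enorm_pow, ← pow_mul, mul_comm n 2, ENNReal.ofReal_pow h0]
  congr 2
  rw [← ofReal_norm, Complex.norm_real, Real.norm_of_nonneg h0]

lemma lintegral_dilation {f : ℂ → ℂ} (hf : f ∈ Hol) {r : ℝ} (h0 : 0 ≤ r) (h1 : r < 1) :
    ∫⁻ x, ‖f (r * pt x)‖ₑ ^ 2 ∂arc = ∑' n : ℕ, ‖coef f n‖ₑ ^ 2 * ENNReal.ofReal (r ^ (2 * n)) := by
  rw [lintegral_sq_eq_tsum_fourierCoeff (memLp_of_continuous (continuous_dilation hf h0 h1) 2)]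
  simp_rw [fourierCoeff_dilation hf h0 h1]
  rw [tsum_extZero]
  simp_rw [enorm_mul_pow_sq _ h0]

/-- Parseval on each circle of radius `r`. Termwise `r ^ (2 * n) ≤ 1` gives one bound; for the
other, finite partial sums pass to the limit `r → 1`. -/
lemma hardyNormSq_eq {f : ℂ → ℂ} (hf : f ∈ Hol) : hardyNormSq f = ∑' n : ℕ, ‖coef f n‖ₑ ^ 2 := by
  refine le_antisymm (iSup₂_le fun r hr => ?_) ?_
  · rw [lintegral_dilation hf hr.1 hr.2]
    refine ENNReal.tsum_le_tsum fun n => mul_le_of_le_one_right' ?_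
    exact ENNReal.ofReal_le_one.2 (pow_le_one₀ hr.1 hr.2.le)
  · rw [ENNReal.tsum_eq_iSup_sum]
    refine iSup_le fun s => ?_
    have hlim : Tendsto (fun r : ℝ => ∑ n ∈ s, ‖coef f n‖ₑ ^ 2 * ENNReal.ofReal (r ^ (2 * n)))
        (𝓝[<] 1) (𝓝 (∑ n ∈ s, ‖coef f n‖ₑ ^ 2 * ENNReal.ofReal ((1 : ℝ) ^ (2 * n)))) := by
      refine tendsto_finsetSum _ fun n _ => ?_
      refine ENNReal.Tendsto.const_mul ?_ (Or.inr (by simp))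
      refine (ENNReal.continuous_ofReal.tendsto _).comp ?_
      exact ((continuous_pow (2 * n)).tendsto 1).mono_left nhdsWithin_le_nhds
    simp only [one_pow, ENNReal.ofReal_one, mul_one] at hlim
    refine le_of_tendsto hlim ?_
    filter_upwards [Ico_mem_nhdsLT (show (0 : ℝ) < 1 by norm_num)] with r hr
    refine le_trans ?_ (le_iSup₂ (f := fun r (_ : r ∈ Set.Ico (0 : ℝ) 1) =>
      ∫⁻ x, ‖f (r * pt x)‖ₑ ^ 2 ∂arc) r hr)
    rw [lintegral_dilation hf hr.1 hr.2]
    exact ENNReal.sum_le_tsum s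

/-! ### Area integrals in polar coordinates -/

lemma pt_coe (x : ℝ) : pt (x : 𝕋) = Complex.exp (2 * Real.pi * x * Complex.I) := by
  rw [pt, AddCircle.toCircle_apply_mk, Circle.coe_exp]
  push_cast
  ring_nf

lemma arc_eq_volume : (arc : Measure 𝕋) = volume := by
  have := AddCircle.volume_eq_smul_haarAddCircle (T := 1)
  rw [this]; simp

lemma lintegral_arc_eq (u : ℂ → ℝ≥0∞) :
    ∫⁻ θ in Set.Ioo (-Real.pi) Real.pi, u (Complex.exp (θ * Complex.I)) =
      ENNReal.ofReal (2 * Real.pi) * ∫⁻ x, u (pt x) ∂arc := by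
  have hpi := Real.pi_pos
  have himg : (fun x : ℝ => 2 * Real.pi * x) '' Set.Ioo (-(1 / 2)) (1 / 2) =
      Set.Ioo (-Real.pi) Real.pi := by
    rw [Set.image_mul_left_Ioo (by positivity)]
    congr 1 <;> ring
  rw [← himg, lintegral_image_eq_lintegral_abs_deriv_mul (f' := fun _ => 2 * Real.pi)
    measurableSet_Ioo]
  · rw [lintegral_const_mul' _ _ ENNReal.ofReal_ne_top, abs_of_pos (by positivity),
      arc_eq_volume, ← UnitAddCircle.lintegral_preimage (-(1 / 2))]
    congr 1
    rw [show (-(1 / 2) + 1 : ℝ) = 1 / 2 by norm_num]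
    rw [restrict_Ioo_eq_restrict_Ioc]
    refine lintegral_congr fun x => ?_
    rw [pt_coe]
    push_cast
    rfl
  · intro x _
    simpa using ((hasDerivAt_id x).const_mul (2 * Real.pi)).hasDerivWithinAt
  · intro x _ y _ h
    exact mul_left_cancel₀ (by positivity : (2 * Real.pi) ≠ 0) h

/-- Measurability is asked only of the cut-off to the disk, since members of `Hol` are arbitrary
outside it. -/
lemma lintegral_area {u : ℂ → ℝ≥0∞} (hu : Measurable ((ball (0 : ℂ) 1).indicator u)) :
    ∫⁻ z, u z ∂areaMeasure =
      ∫⁻ r in Set.Ioo (0 : ℝ) 1, ENNReal.ofReal (2 * r) * ∫⁻ x, u (r * pt x) ∂arc := by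
  have hpi := Real.pi_pos
  have hmeas : Measurable fun p : ℝ × ℝ => ENNReal.ofReal p.1 •
      (ball (0 : ℂ) 1).indicator u (Complex.polarCoord.symm p) := by
    refine Measurable.smul (f := fun p : ℝ × ℝ => ENNReal.ofReal p.1) (by fun_prop) (hu.comp ?_)
    change Measurable fun p : ℝ × ℝ => Complex.polarCoord.symm p
    simp only [Complex.polarCoord_symm_apply]
    fun_prop
  rw [areaMeasure, lintegral_smul_measure, ← lintegral_indicator measurableSet_ball,
    ← Complex.lintegral_comp_polarCoord_symm, polarCoord_target, Measure.volume_eq_prod,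
    ← Measure.prod_restrict, lintegral_prod _ hmeas.aemeasurable]
  have hinner : ∀ r ∈ Set.Ioi (0 : ℝ), (∫⁻ θ in Set.Ioo (-Real.pi) Real.pi, ENNReal.ofReal r •
      (ball (0 : ℂ) 1).indicator u (Complex.polarCoord.symm (r, θ))) =
      (Set.Ioo (0 : ℝ) 1).indicator (fun r => ENNReal.ofReal Real.pi * (ENNReal.ofReal (2 * r) *
        ∫⁻ x, u (r * pt x) ∂arc)) r := by
    intro r hr
    have hr : 0 < r := hr
    simp only [smul_eq_mul]
    rw [lintegral_const_mul' _ _ ENNReal.ofReal_ne_top]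
    by_cases h1 : r < 1
    · rw [Set.indicator_of_mem (show r ∈ Set.Ioo (0 : ℝ) 1 from ⟨hr, h1⟩)]
      have : ∀ θ : ℝ, (ball (0 : ℂ) 1).indicator u (Complex.polarCoord.symm (r, θ)) =
          u (r * Complex.exp (θ * Complex.I)) := by
        intro θ
        rw [Set.indicator_of_mem]
        · rw [Complex.polarCoord_symm_apply, Complex.exp_mul_I]
          push_cast
          rfl
        · rw [mem_ball_zero_iff, Complex.norm_polarCoord_symm]
          simpa [abs_of_pos hr] using h1
      simp_rw [this]
      rw [lintegral_arc_eq (fun z => u (r * z)), ← mul_assoc, ← mul_assoc,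
        ← ENNReal.ofReal_mul hr.le, ← ENNReal.ofReal_mul hpi.le]
      ring_nf
    · rw [Set.indicator_of_notMem (fun h => h1 h.2)]
      have : ∀ θ : ℝ, (ball (0 : ℂ) 1).indicator u (Complex.polarCoord.symm (r, θ)) = 0 := by
        intro θ
        rw [Set.indicator_of_notMem]
        rw [mem_ball_zero_iff, Complex.norm_polarCoord_symm]
        simpa [abs_of_pos hr] using h1
      simp_rw [this]
      simp
  rw [setLIntegral_congr_fun measurableSet_Ioi hinner, setLIntegral_indicator measurableSet_Ioo,
    Set.inter_eq_left.2 Set.Ioo_subset_Ioi_self, lintegral_const_mul' _ _ ENNReal.ofReal_ne_top,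
    smul_eq_mul, ← mul_assoc, ← ENNReal.ofReal_mul (by positivity), inv_mul_cancel₀ hpi.ne',
    ENNReal.ofReal_one, one_mul]

lemma measurable_indicator_of_mem_Hol {f : ℂ → ℂ} (hf : f ∈ Hol) :
    Measurable ((ball (0 : ℂ) 1).indicator f) := by
  classical
  rw [← Set.piecewise_eq_indicator]
  exact ContinuousOn.measurable_piecewise (DifferentiableOn.continuousOn hf)
    continuousOn_const measurableSet_ball

lemma measurable_indicator_sq_mul {f : ℂ → ℂ} (hf : f ∈ Hol) {W : ℂ → ℝ≥0∞} (hW : Measurable W) :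
    Measurable ((ball (0 : ℂ) 1).indicator fun z => ‖f z‖ₑ ^ 2 * W z) := by
  have : ((ball (0 : ℂ) 1).indicator fun z => ‖f z‖ₑ ^ 2 * W z) =
      fun z => ‖(ball (0 : ℂ) 1).indicator f z‖ₑ ^ 2 * W z := by
    ext z
    by_cases hz : z ∈ ball (0 : ℂ) 1 <;> simp [hz]
  rw [this]
  exact (((measurable_indicator_of_mem_Hol hf).enorm).pow_const 2).mul hW

/-- A radial weight is constant on each circle, so Parseval there diagonalizes the area integral:
only the radial moments of the weight matter. -/
lemma lintegral_area_radial {f : ℂ → ℂ} (hf : f ∈ Hol) {w : ℝ → ℝ≥0∞} (hw : Measurable w) :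
    ∫⁻ z, ‖f z‖ₑ ^ 2 * w ‖z‖ ∂areaMeasure = ∑' n, ‖coef f n‖ₑ ^ 2 *
      ∫⁻ r in Set.Ioo (0 : ℝ) 1, ENNReal.ofReal (2 * r) * (ENNReal.ofReal (r ^ (2 * n)) * w r) := by
  refine (lintegral_area (u := fun z => ‖f z‖ₑ ^ 2 * w ‖z‖)
    (measurable_indicator_sq_mul hf (hw.comp measurable_norm))).trans ?_
  have : ∀ r ∈ Set.Ioo (0 : ℝ) 1, ENNReal.ofReal (2 * r) *
      (∫⁻ x, ‖f (r * pt x)‖ₑ ^ 2 * w ‖r * pt x‖ ∂arc) = ∑' n, ‖coef f n‖ₑ ^ 2 *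
        (ENNReal.ofReal (2 * r) * (ENNReal.ofReal (r ^ (2 * n)) * w r)) := by
    intro r hr
    have hn : ∀ x, ‖(r : ℂ) * pt x‖ = r := fun x => by
      rw [norm_mul, norm_pt, mul_one, Complex.norm_real, Real.norm_of_nonneg hr.1.le]
    simp_rw [hn]
    rw [lintegral_mul_const'', lintegral_dilation hf hr.1.le hr.2, ← ENNReal.tsum_mul_right,
      ← ENNReal.tsum_mul_left]
    · refine tsum_congr fun n => by ring
    · exact ((continuous_dilation hf hr.1.le hr.2).measurable.enorm.pow_const 2).aemeasurable
  rw [setLIntegral_congr_fun measurableSet_Ioo this, lintegral_tsum]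
  · refine tsum_congr fun n => ?_
    rw [lintegral_const_mul' _ _ (by finiteness)]
  · intro n
    refine (Measurable.const_mul ?_ _).aemeasurable
    fun_prop

lemma setLIntegral_Ioo_ofReal {f : ℝ → ℝ} (hf : Continuous f)
    (h0 : ∀ x ∈ Set.Ioo (0 : ℝ) 1, 0 ≤ f x) :
    ∫⁻ r in Set.Ioo (0 : ℝ) 1, ENNReal.ofReal (f r) = ENNReal.ofReal (∫ r in (0 : ℝ)..1, f r) := by
  rw [intervalIntegral.integral_of_le zero_le_one, ← restrict_Ioo_eq_restrict_Ioc,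
    ofReal_integral_eq_lintegral_ofReal]
  · exact (hf.integrableOn_Icc (a := 0) (b := 1)).mono_set Set.Ioo_subset_Icc_self
  · exact (ae_restrict_iff' measurableSet_Ioo).2 (Eventually.of_forall h0)

lemma lintegral_radial_szego (n : ℕ) :
    ∫⁻ r in Set.Ioo (0 : ℝ) 1, ENNReal.ofReal (2 * r) *
      (ENNReal.ofReal (r ^ (2 * n)) * ENNReal.ofReal (1 - r ^ 2)) =
      ENNReal.ofReal (1 / ((n + 1) * (n + 2))) := by
  have : ∀ r ∈ Set.Ioo (0 : ℝ) 1, ENNReal.ofReal (2 * r) *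
      (ENNReal.ofReal (r ^ (2 * n)) * ENNReal.ofReal (1 - r ^ 2)) =
      ENNReal.ofReal (2 * r ^ (2 * n + 1) - 2 * r ^ (2 * n + 3)) := by
    intro r hr
    have := hr.1
    rw [← ENNReal.ofReal_mul (by positivity), ← ENNReal.ofReal_mul (by positivity)]
    congr 1; ring
  rw [setLIntegral_congr_fun measurableSet_Ioo this, setLIntegral_Ioo_ofReal (by fun_prop)]
  · rw [intervalIntegral.integral_sub (Continuous.intervalIntegrable (by fun_prop) _ _)
      (Continuous.intervalIntegrable (by fun_prop) _ _), intervalIntegral.integral_const_mul,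
      intervalIntegral.integral_const_mul, integral_pow, integral_pow]
    congr 1
    push_cast
    field_simp
    norm_num
    ring
  · intro r hr
    have h1 : r ^ (2 * n + 3) ≤ r ^ (2 * n + 1) :=
      pow_le_pow_of_le_one hr.1.le hr.2.le (by omega)
    linarith

lemma lintegral_radial_log (n : ℕ) :
    ∫⁻ r in Set.Ioo (0 : ℝ) 1, ENNReal.ofReal (2 * r) *
      (ENNReal.ofReal (r ^ (2 * n)) * ENNReal.ofReal (Real.log (r⁻¹ ^ 2))) =
      ENNReal.ofReal (1 / (n + 1) ^ 2) := by
  have : ∀ r ∈ Set.Ioo (0 : ℝ) 1, ENNReal.ofReal (2 * r) *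
      (ENNReal.ofReal (r ^ (2 * n)) * ENNReal.ofReal (Real.log (r⁻¹ ^ 2))) =
      ENNReal.ofReal (-4 * (r ^ (2 * n) * (r * Real.log r))) := by
    intro r hr
    have := hr.1
    rw [← ENNReal.ofReal_mul (by positivity), ← ENNReal.ofReal_mul (by positivity), Real.log_pow,
      Real.log_inv]
    congr 1; push_cast; ring
  have hc := Real.continuous_mul_log
  rw [setLIntegral_congr_fun measurableSet_Ioo this, setLIntegral_Ioo_ofReal (by fun_prop)]
  · congr 1
    have hn : ((n : ℝ) + 1) ≠ 0 := by positivity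
    -- The primitive comes from integrating `r ^ (2n+1) log r` by parts. Keeping the factor `r * log
    -- r` together makes it continuous at 0, where both terms vanish; at 1 only the second term
    -- survives.
    rw [intervalIntegral.integral_eq_sub_of_hasDerivAt_of_le (f := fun r : ℝ =>
      -4 * (r ^ (2 * n + 1) * (r * Real.log r) / (2 * n + 2) - r ^ (2 * n + 2) / (2 * n + 2) ^ 2))
      zero_le_one (by fun_prop)]
    · simp
      field_simp
      norm_num
    · intro r hr
      have hr0 := hr.1.ne'
      have h1 := ((hasDerivAt_pow (2 * n + 2) r).mul (Real.hasDerivAt_log hr0)).div_const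
        (2 * (n : ℝ) + 2)
      have h2 := (hasDerivAt_pow (2 * n + 2) r).div_const ((2 * (n : ℝ) + 2) ^ 2)
      have h3 := (h1.sub h2).const_mul (-4)
      refine (h3.congr_deriv ?_).congr_of_eventuallyEq (Eventually.of_forall fun s => ?_)
      · rw [show 2 * n + 2 - 1 = 2 * n + 1 by omega]
        push_cast
        have : (2 * (n : ℝ) + 2) ≠ 0 := by positivity
        field_simp
        ring
      · simp only [Pi.mul_apply, Pi.sub_apply]
        ring
    · exact Continuous.intervalIntegrable (by fun_prop) _ _
  · intro r hr
    have h1 : Real.log r ≤ 0 := Real.log_nonpos hr.1.le hr.2.le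
    have h2 : 0 ≤ r ^ (2 * n) := pow_nonneg hr.1.le _
    have := mul_nonneg h2 (mul_nonneg hr.1.le (neg_nonneg.2 h1))
    nlinarith

lemma lintegral_sq_mul_one_sub {f : ℂ → ℂ} (hf : f ∈ Hol) :
    ∫⁻ z, ‖f z‖ₑ ^ 2 * ENNReal.ofReal (1 - ‖z‖ ^ 2) ∂areaMeasure =
      ∑' n : ℕ, ‖coef f n‖ₑ ^ 2 * ENNReal.ofReal (1 / ((n + 1) * (n + 2))) := by
  rw [lintegral_area_radial hf (w := fun r => ENNReal.ofReal (1 - r ^ 2)) (by fun_prop)]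
  simp_rw [lintegral_radial_szego]

/-- No pointwise inequality is available near the pole at 0. After diagonalization the claim reduces
to the ratio of moments `(n+2)/(n+1) ≤ 2`. -/
lemma lintegral_sq_mul_log_le {f : ℂ → ℂ} (hf : f ∈ Hol) :
    ∫⁻ z, ‖f z‖ₑ ^ 2 * ENNReal.ofReal (Real.log (‖z‖⁻¹ ^ 2)) ∂areaMeasure ≤
      2 * ∫⁻ z, ‖f z‖ₑ ^ 2 * ENNReal.ofReal (1 - ‖z‖ ^ 2) ∂areaMeasure := by
  rw [lintegral_area_radial hf (w := fun r => ENNReal.ofReal (Real.log (r⁻¹ ^ 2))) (by fun_prop),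
    lintegral_sq_mul_one_sub hf, ← ENNReal.tsum_mul_left]
  simp_rw [lintegral_radial_log]
  refine ENNReal.tsum_le_tsum fun n => ?_
  rw [mul_left_comm]
  gcongr
  rw [← ENNReal.ofReal_ofNat 2, ← ENNReal.ofReal_mul zero_le_two]
  refine ENNReal.ofReal_le_ofReal ?_
  rw [mul_one_div, div_le_div_iff₀ (by positivity) (by positivity)]
  nlinarith [(n.cast_nonneg : (0 : ℝ) ≤ n)]

/-! ### Disk automorphisms -/

/-- The involutive automorphism of the disk exchanging `0` and `w`. -/
noncomputable def mobius (w z : ℂ) : ℂ := (w - z) / (1 - conj w * z)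

lemma one_sub_conj_mul_ne_zero {w z : ℂ} (hw : ‖w‖ < 1) (hz : ‖z‖ ≤ 1) : 1 - conj w * z ≠ 0 := by
  intro h
  have h1 : ‖conj w * z‖ = 1 := by rw [← sub_eq_zero.1 h, norm_one]
  rw [norm_mul, Complex.norm_conj] at h1
  nlinarith [norm_nonneg w, norm_nonneg z]

lemma one_sub_conj_mul_ne_zero' {w z : ℂ} (hw : ‖w‖ ≤ 1) (hz : ‖z‖ < 1) : 1 - conj w * z ≠ 0 := by
  intro h
  have h1 : ‖conj w * z‖ = 1 := by rw [← sub_eq_zero.1 h, norm_one]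
  rw [norm_mul, Complex.norm_conj] at h1
  nlinarith [norm_nonneg w, norm_nonneg z]

lemma norm_one_sub_conj_mul_sq (w z : ℂ) :
    ‖1 - conj w * z‖ ^ 2 - ‖w - z‖ ^ 2 = (1 - ‖w‖ ^ 2) * (1 - ‖z‖ ^ 2) := by
  simp only [← Complex.normSq_eq_norm_sq, Complex.normSq_apply, Complex.sub_re, Complex.sub_im,
    Complex.mul_re, Complex.mul_im, Complex.conj_re, Complex.conj_im, Complex.one_re,
    Complex.one_im]
  ring

lemma one_sub_norm_mobius_sq {w z : ℂ} (h : 1 - conj w * z ≠ 0) :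
    1 - ‖mobius w z‖ ^ 2 = (1 - ‖w‖ ^ 2) * ((1 - ‖z‖ ^ 2) / ‖1 - conj w * z‖ ^ 2) := by
  have h' : ‖1 - conj w * z‖ ≠ 0 := norm_ne_zero_iff.2 h
  rw [mobius, norm_div, ← mul_div_assoc, ← norm_one_sub_conj_mul_sq, div_pow, sub_div,
    div_self (pow_ne_zero 2 h')]

lemma norm_mobius_lt_one {w z : ℂ} (hw : ‖w‖ < 1) (hz : ‖z‖ < 1) : ‖mobius w z‖ < 1 := by
  have h := one_sub_norm_mobius_sq (one_sub_conj_mul_ne_zero hw hz.le)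
  have h1 : 0 < ‖1 - conj w * z‖ := norm_pos_iff.2 (one_sub_conj_mul_ne_zero hw hz.le)
  have h2 : 0 < 1 - ‖w‖ ^ 2 := by nlinarith [norm_nonneg w]
  have h3 : 0 < 1 - ‖z‖ ^ 2 := by nlinarith [norm_nonneg z]
  have : 0 < 1 - ‖mobius w z‖ ^ 2 := by rw [h]; positivity
  nlinarith [norm_nonneg (mobius w z)]

lemma one_sub_conj_mul_self_ne_zero {w : ℂ} (hw : ‖w‖ < 1) : 1 - conj w * w ≠ 0 :=
  one_sub_conj_mul_ne_zero hw hw.le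

lemma one_sub_conj_mul_mobius {w z : ℂ} (h : 1 - conj w * z ≠ 0) :
    1 - conj w * mobius w z = (1 - conj w * w) / (1 - conj w * z) := by
  rw [mobius]; field_simp; ring

lemma sub_mobius {w z : ℂ} (h : 1 - conj w * z ≠ 0) :
    w - mobius w z = z * (1 - conj w * w) / (1 - conj w * z) := by
  rw [mobius, sub_div' h]; ring

lemma mobius_mobius {w z : ℂ} (hw : ‖w‖ < 1) (hz : ‖z‖ ≤ 1) : mobius w (mobius w z) = z := by
  have h := one_sub_conj_mul_ne_zero hw hz
  have h' := one_sub_conj_mul_self_ne_zero hw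
  rw [mobius, one_sub_conj_mul_mobius h, sub_mobius h, div_div_div_cancel_right₀ h,
    mul_div_cancel_right₀ _ h']

lemma hasDerivAt_mobius {w z : ℂ} (h : 1 - conj w * z ≠ 0) :
    HasDerivAt (mobius w) (-(1 - conj w * w) / (1 - conj w * z) ^ 2) z := by
  have h1 : HasDerivAt (fun z => w - z) (-1) z := by
    simpa using (hasDerivAt_id z).const_sub w
  have h2 : HasDerivAt (fun z => 1 - conj w * z) (-conj w) z := by
    simpa using ((hasDerivAt_id z).const_mul (conj w)).const_sub 1
  refine (h1.div h2 h).congr_deriv ?_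
  congr 1
  ring

/-- The derivative of `mobius w`. -/
noncomputable def mobiusDeriv (w z : ℂ) : ℂ := -(1 - conj w * w) / (1 - conj w * z) ^ 2

lemma det_restrictScalars_toSpanSingleton (c : ℂ) :
    ((ContinuousLinearMap.toSpanSingleton ℂ c).restrictScalars ℝ : ℂ →L[ℝ] ℂ).det = ‖c‖ ^ 2 := by
  simp [ContinuousLinearMap.det, LinearMap.det_restrictScalars, Algebra.norm_complex_apply,
    Complex.normSq_eq_norm_sq]

lemma image_mobius_ball {w : ℂ} (hw : ‖w‖ < 1) : mobius w '' ball 0 1 = ball 0 1 := by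
  refine Set.Subset.antisymm ?_ fun z hz => ?_
  · rintro _ ⟨z, hz, rfl⟩
    rw [mem_ball_zero_iff] at hz ⊢
    exact norm_mobius_lt_one hw hz
  · rw [mem_ball_zero_iff] at hz
    exact ⟨mobius w z, by simpa using norm_mobius_lt_one hw hz, mobius_mobius hw hz.le⟩

/-- The real Jacobian of a holomorphic map is the squared modulus of its derivative, and `mobius w`
is an involution of the disk, hence a bijection. -/
lemma lintegral_comp_mobius {w : ℂ} (hw : ‖w‖ < 1) (u : ℂ → ℝ≥0∞) :
    ∫⁻ z, ‖mobiusDeriv w z‖ₑ ^ 2 * u (mobius w z) ∂areaMeasure = ∫⁻ z, u z ∂areaMeasure := by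
  rw [areaMeasure, lintegral_smul_measure, lintegral_smul_measure]
  congr 1
  conv_rhs => rw [← image_mobius_ball hw]
  rw [lintegral_image_eq_lintegral_abs_det_fderiv_mul volume measurableSet_ball
    (f' := fun z => (ContinuousLinearMap.toSpanSingleton ℂ (mobiusDeriv w z)).restrictScalars ℝ)]
  · refine lintegral_congr fun z => ?_
    rw [det_restrictScalars_toSpanSingleton, abs_of_nonneg (by positivity),
      ENNReal.ofReal_pow (norm_nonneg _), ofReal_norm]
  · intro z hz
    rw [mem_ball_zero_iff] at hz
    exact ((hasDerivAt_mobius (one_sub_conj_mul_ne_zero hw hz.le)).hasFDerivAt.restrictScalars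
      ℝ).hasFDerivWithinAt
  · intro x hx y hy h
    rw [mem_ball_zero_iff] at hx hy
    rw [← mobius_mobius hw hx.le, h, mobius_mobius hw hy.le]

lemma comp_mobius_mem_Hol {f : ℂ → ℂ} (hf : f ∈ Hol) {w : ℂ} (hw : ‖w‖ < 1) :
    (fun z => f (mobius w z)) ∈ Hol := by
  refine DifferentiableOn.comp (t := ball 0 1) hf (fun z hz => ?_) fun z hz => ?_
  · rw [mem_ball_zero_iff] at hz
    exact (hasDerivAt_mobius
      (one_sub_conj_mul_ne_zero hw hz.le)).differentiableAt.differentiableWithinAt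
  · rw [mem_ball_zero_iff] at hz ⊢
    exact norm_mobius_lt_one hw hz

lemma mobiusDeriv_mem_Hol {w : ℂ} (hw : ‖w‖ < 1) : mobiusDeriv w ∈ Hol := by
  refine DifferentiableOn.div (by fun_prop) (by fun_prop) fun z hz => pow_ne_zero 2 ?_
  rw [mem_ball_zero_iff] at hz
  exact one_sub_conj_mul_ne_zero hw hz.le

lemma ae_mem_ball : ∀ᵐ z ∂areaMeasure, z ∈ ball (0 : ℂ) 1 := by
  rw [areaMeasure]
  exact Measure.ae_smul_measure (ae_restrict_mem measurableSet_ball) _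

instance : IsFiniteMeasure areaMeasure := by
  rw [areaMeasure]
  have : IsFiniteMeasure ((volume : Measure ℂ).restrict (ball 0 1)) :=
    ⟨by rw [Measure.restrict_apply_univ]; exact measure_ball_lt_top⟩
  exact Measure.smul_finite _ ENNReal.ofReal_ne_top

lemma one_sub_norm_sq_pos {w : ℂ} (hw : ‖w‖ < 1) : 0 < 1 - ‖w‖ ^ 2 := by
  nlinarith [norm_nonneg w]

lemma ofReal_one_sub_norm_sq_ne_zero {w : ℂ} (hw : ‖w‖ < 1) : ENNReal.ofReal (1 - ‖w‖ ^ 2) ≠ 0 := by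
  simpa using one_sub_norm_sq_pos hw

lemma ofReal_one_sub_norm_mobius_sq {w z : ℂ} (hw : ‖w‖ < 1) (hz : ‖z‖ < 1) :
    ENNReal.ofReal (1 - ‖mobius w z‖ ^ 2) =
      ENNReal.ofReal (1 - ‖w‖ ^ 2) * szegoKernel w z := by
  rw [one_sub_norm_mobius_sq (one_sub_conj_mul_ne_zero hw hz.le), szegoKernel,
    ENNReal.ofReal_mul (one_sub_norm_sq_pos hw).le]

/-- Since `1 - |ψ_w(z)|² = (1 - |w|²) szegoKernel w z`, this reduces statements about the kernel
based at `w` to the radial weight `1 - |z|²`. -/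
lemma lintegral_comp_mobius_mul_one_sub {g : ℂ → ℂ} {w : ℂ} (hw : ‖w‖ < 1) :
    ∫⁻ z, ‖g (mobius w z) * mobiusDeriv w z‖ₑ ^ 2 * ENNReal.ofReal (1 - ‖z‖ ^ 2) ∂areaMeasure =
      ENNReal.ofReal (1 - ‖w‖ ^ 2) * ∫⁻ z, ‖g z‖ₑ ^ 2 * szegoKernel w z ∂areaMeasure := by
  rw [← lintegral_const_mul' _ _ ENNReal.ofReal_ne_top,
    ← lintegral_comp_mobius hw fun z => ENNReal.ofReal (1 - ‖w‖ ^ 2) * (‖g z‖ₑ ^ 2 * szegoKernel w z)]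
  refine lintegral_congr_ae ?_
  filter_upwards [ae_mem_ball] with z hz
  rw [mem_ball_zero_iff] at hz
  have h := ofReal_one_sub_norm_mobius_sq hw (norm_mobius_lt_one hw hz)
  rw [mobius_mobius hw hz.le] at h
  rw [h, enorm_mul]
  ring

lemma logKernel_mobius {w z : ℂ} (hw : ‖w‖ < 1) (hz : ‖z‖ < 1) (h0 : z ≠ 0) :
    logKernel w (mobius w z) = ENNReal.ofReal (Real.log (‖z‖⁻¹ ^ 2)) := by
  have h := one_sub_conj_mul_ne_zero hw hz.le
  have h' := one_sub_conj_mul_self_ne_zero hw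
  have h2 : mobius w z - w = -(z * (1 - conj w * w) / (1 - conj w * z)) := by
    rw [← sub_mobius h]; ring
  have hne : mobius w z ≠ w := by
    rw [← sub_ne_zero, h2]
    exact neg_ne_zero.2 (div_ne_zero (mul_ne_zero h0 h') h)
  rw [logKernel, if_neg hne, h2, one_sub_conj_mul_mobius h, ← norm_inv]
  congr 3
  rw [← norm_neg]
  congr 1
  field_simp

/-- Composition with `mobius w` carries the pole from `w` to 0, and the kernel `szegoKernel w` to
the weight `1 - |z|²`, so the radial estimate applies to `(g ∘ ψ_w) ψ_w'`. -/
lemma lintegral_logKernel_le {g : ℂ → ℂ} (hg : g ∈ Hol) {w : ℂ} (hw : ‖w‖ < 1) :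
    ∫⁻ z, ‖g z‖ₑ ^ 2 * (logKernel w z / ENNReal.ofReal (1 - ‖w‖ ^ 2)) ∂areaMeasure ≤
      2 * ∫⁻ z, ‖g z‖ₑ ^ 2 * szegoKernel w z ∂areaMeasure := by
  have hc := ofReal_one_sub_norm_sq_ne_zero hw
  have hF : (fun z => g (mobius w z) * mobiusDeriv w z) ∈ Hol :=
    DifferentiableOn.mul (comp_mobius_mem_Hol hg hw) (mobiusDeriv_mem_Hol hw)
  -- The point 0 is discarded because there `logKernel` is `∞` by definition, whereas the real
  -- logarithm takes the default value 0.
  have h0 : ∀ᵐ z ∂areaMeasure, z ≠ 0 := by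
    rw [areaMeasure]
    refine Measure.ae_smul_measure (ae_restrict_of_ae ?_) _
    exact (Set.countable_singleton (0 : ℂ)).ae_notMem volume
  have h1 : ∫⁻ z, ‖g z‖ₑ ^ 2 * logKernel w z ∂areaMeasure =
      ∫⁻ z, ‖g (mobius w z) * mobiusDeriv w z‖ₑ ^ 2 *
        ENNReal.ofReal (Real.log (‖z‖⁻¹ ^ 2)) ∂areaMeasure := by
    rw [← lintegral_comp_mobius hw]
    refine lintegral_congr_ae ?_
    filter_upwards [ae_mem_ball, h0] with z hz h0
    rw [mem_ball_zero_iff] at hz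
    rw [logKernel_mobius hw hz h0, enorm_mul]
    ring
  have h2 := lintegral_sq_mul_log_le hF
  rw [← h1, lintegral_comp_mobius_mul_one_sub hw] at h2
  simp_rw [div_eq_mul_inv, ← mul_assoc]
  rw [lintegral_mul_const' _ _ (ENNReal.inv_ne_top.2 hc), ← div_eq_mul_inv]
  refine ENNReal.div_le_of_le_mul ?_
  rwa [mul_left_comm, mul_comm (ENNReal.ofReal _)] at h2

/-- The inequality `1 - t ≤ log (1/t)` at `t = |ψ_w(z)|²`. -/
lemma szegoKernel_le_logKernel {w z : ℂ} (hw : ‖w‖ < 1) (hz : ‖z‖ < 1) :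
    szegoKernel w z ≤ logKernel w z / ENNReal.ofReal (1 - ‖w‖ ^ 2) := by
  have hc := ofReal_one_sub_norm_sq_ne_zero hw
  rw [ENNReal.le_div_iff_mul_le (Or.inl hc) (Or.inl ENNReal.ofReal_ne_top), mul_comm,
    ← ofReal_one_sub_norm_mobius_sq hw hz, logKernel]
  split_ifs with h
  · exact le_top
  · refine ENNReal.ofReal_le_ofReal ?_
    have hd := one_sub_conj_mul_ne_zero hw hz.le
    have hp : 0 < ‖mobius w z‖ ^ 2 := by
      have : mobius w z ≠ 0 := div_ne_zero (sub_ne_zero.2 (Ne.symm h)) hd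
      positivity
    have he : ‖(1 - conj w * z) / (z - w)‖ ^ 2 = (‖mobius w z‖ ^ 2)⁻¹ := by
      rw [← inv_pow, ← norm_inv, mobius, inv_div, norm_div, norm_div, norm_sub_rev z w]
    rw [he, Real.log_inv]
    linarith [Real.log_le_sub_one_of_pos hp]

/-! ### Comparison of the two weights -/

lemma measurable_szegoKernel : Measurable fun p : ℂ × ℂ => szegoKernel p.1 p.2 := by
  unfold szegoKernel
  refine ENNReal.measurable_ofReal.comp (Measurable.div (by fun_prop) ?_)
  have : Continuous fun p : ℂ × ℂ => ‖1 - conj p.1 * p.2‖ ^ 2 := by fun_prop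
  exact this.measurable

lemma measurable_logKernel : Measurable fun p : ℂ × ℂ => logKernel p.1 p.2 := by
  unfold logKernel
  refine Measurable.ite (measurableSet_eq_fun measurable_snd measurable_fst) measurable_const ?_
  have h1 : Measurable fun p : ℂ × ℂ => 1 - conj p.1 * p.2 := by
    have : Continuous fun p : ℂ × ℂ => 1 - conj p.1 * p.2 := by fun_prop
    exact this.measurable
  exact ENNReal.measurable_ofReal.comp (Real.measurable_log.comp
    (((h1.div (measurable_snd.sub measurable_fst)).norm).pow_const 2))

lemma measurable_logKernel_div :
    Measurable fun p : ℂ × ℂ => logKernel p.1 p.2 / ENNReal.ofReal (1 - ‖p.1‖ ^ 2) :=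
  measurable_logKernel.div (ENNReal.measurable_ofReal.comp (by fun_prop))

lemma lintegral_mul_lintegral_swap {g : ℂ → ℂ} (hg : g ∈ Hol) {K : ℂ → ℂ → ℝ≥0∞}
    (hK : Measurable fun p : ℂ × ℂ => K p.1 p.2) (ν : Measure ℂ) [SFinite ν] :
    ∫⁻ z, ‖g z‖ₑ ^ 2 * ∫⁻ w, K w z ∂ν ∂areaMeasure =
      ∫⁻ w, ∫⁻ z, ‖g z‖ₑ ^ 2 * K w z ∂areaMeasure ∂ν := by
  -- Tonelli needs a globally measurable integrand, so `g` is replaced by its cut-off to the disk,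
  -- which `areaMeasure` cannot distinguish from it.
  have hm := measurable_indicator_of_mem_Hol hg
  have hind : ∀ᵐ z ∂areaMeasure, g z = (ball (0 : ℂ) 1).indicator g z := by
    filter_upwards [ae_mem_ball] with z hz
    rw [Set.indicator_of_mem hz]
  have h1 : ∀ z, ‖(ball (0 : ℂ) 1).indicator g z‖ₑ ^ 2 * ∫⁻ w, K w z ∂ν =
      ∫⁻ w, ‖(ball (0 : ℂ) 1).indicator g z‖ₑ ^ 2 * K w z ∂ν := fun z =>
    (lintegral_const_mul' _ _ (by finiteness)).symm
  calc _ = ∫⁻ z, ‖(ball (0 : ℂ) 1).indicator g z‖ₑ ^ 2 * ∫⁻ w, K w z ∂ν ∂areaMeasure :=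
        lintegral_congr_ae (by filter_upwards [hind] with z hz; rw [← hz])
    _ = ∫⁻ w, ∫⁻ z, ‖(ball (0 : ℂ) 1).indicator g z‖ₑ ^ 2 * K w z ∂areaMeasure ∂ν := by
        simp_rw [h1]
        refine lintegral_lintegral_swap (Measurable.aemeasurable ?_)
        exact ((hm.comp measurable_fst).enorm.pow_const 2).mul (hK.comp measurable_swap)
    _ = _ := lintegral_congr fun w =>
        lintegral_congr_ae (by filter_upwards [hind] with z hz; rw [← hz])

lemma measurable_lintegral_kernel {K : ℂ → ℂ → ℝ≥0∞}
    (hK : Measurable fun p : ℂ × ℂ => K p.1 p.2) (ν : Measure ℂ) [SFinite ν] :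
    Measurable fun z => ∫⁻ w, K w z ∂ν :=
  Measurable.lintegral_prod_right' (f := fun p : ℂ × ℂ => K p.2 p.1) (hK.comp measurable_swap)

lemma measurable_U (μ : Measure ℂ) [IsFiniteMeasure μ] : Measurable (U μ) :=
  (measurable_lintegral_kernel measurable_logKernel_div _).add
    (measurable_lintegral_kernel measurable_szegoKernel _)

lemma measurable_V (μ : Measure ℂ) [IsFiniteMeasure μ] : Measurable (V μ) := measurable_lintegral_kernel measurable_szegoKernel _

lemma V_eq_add (μ : Measure ℂ) (z : ℂ) : V μ z = (∫⁻ w in ball 0 1, szegoKernel w z ∂μ) +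
    ∫⁻ w in sphere 0 1, szegoKernel w z ∂μ := by
  rw [V, ← ball_union_sphere, lintegral_union isClosed_sphere.measurableSet]
  exact Set.disjoint_left.2 fun w h1 h2 => by
    rw [mem_ball] at h1; rw [mem_sphere] at h2; linarith

lemma V_le_U (μ : Measure ℂ) {z : ℂ} (hz : z ∈ ball (0 : ℂ) 1) : V μ z ≤ U μ z := by
  rw [V_eq_add, U]
  gcongr ?_ + _
  refine setLIntegral_mono' measurableSet_ball fun w hw => ?_
  exact szegoKernel_le_logKernel (by simpa using hw) (by simpa using hz)

lemma lintegral_mul_U_le (μ : Measure ℂ) [IsFiniteMeasure μ] {g : ℂ → ℂ} (hg : g ∈ Hol) :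
    ∫⁻ z, ‖g z‖ₑ ^ 2 * U μ z ∂areaMeasure ≤ 2 * ∫⁻ z, ‖g z‖ₑ ^ 2 * V μ z ∂areaMeasure := by
  have hg' : ∀ {W : ℂ → ℝ≥0∞}, Measurable W →
      AEMeasurable (fun z => ‖g z‖ₑ ^ 2 * W z) areaMeasure := by
    intro W hW
    refine (measurable_indicator_sq_mul hg hW).aemeasurable.congr ?_
    filter_upwards [ae_mem_ball] with z hz
    rw [Set.indicator_of_mem hz]
  simp_rw [V_eq_add, U, mul_add]
  rw [lintegral_add_right' _ (hg' (measurable_lintegral_kernel measurable_szegoKernel _)),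
    lintegral_add_right' _ (hg' (measurable_lintegral_kernel measurable_szegoKernel _)),
    lintegral_mul_lintegral_swap hg measurable_logKernel_div,
    lintegral_mul_lintegral_swap hg measurable_szegoKernel,
    lintegral_mul_lintegral_swap hg measurable_szegoKernel, mul_add]
  refine add_le_add ?_ (le_mul_of_one_le_left' one_le_two)
  rw [← lintegral_const_mul' _ _ ENNReal.ofNat_ne_top]
  -- Only the part of `μ` inside the disk costs the factor 2; on the circle the two kernels
  -- coincide.
  refine setLIntegral_mono' measurableSet_ball fun w hw => ?_
  exact lintegral_logKernel_le hg (by simpa using hw)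

/-! ### Power series with bounded coefficients -/

/-- The sum of a power series. -/
noncomputable def powerSeries (c : ℕ → ℂ) (z : ℂ) : ℂ := ∑' n, c n * z ^ n

lemma summable_powerSeries {c : ℕ → ℂ} {C : ℝ} (hc : ∀ n, ‖c n‖ ≤ C) {r : ℝ} (h0 : 0 ≤ r)
    (h1 : r < 1) : Summable fun n => ‖c n‖ * r ^ n :=
  Summable.of_nonneg_of_le (fun n => by positivity)
    (fun n => mul_le_mul_of_nonneg_right (hc n) (by positivity))
    ((summable_geometric_of_lt_one h0 h1).mul_left C)

lemma hasSum_powerSeries {c : ℕ → ℂ} {C : ℝ} (hc : ∀ n, ‖c n‖ ≤ C) {z : ℂ}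
    (hz : z ∈ ball (0 : ℂ) 1) : HasSum (fun n => c n * z ^ n) (powerSeries c z) := by
  refine Summable.hasSum (Summable.of_norm ?_)
  simpa only [norm_mul, norm_pow] using
    summable_powerSeries hc (norm_nonneg z) (by simpa using hz)

lemma norm_powerSeries_le {c : ℕ → ℂ} {C : ℝ} (hc : ∀ n, ‖c n‖ ≤ C) {z : ℂ}
    (hz : z ∈ ball (0 : ℂ) 1) : ‖powerSeries c z‖ ≤ C * (1 - ‖z‖)⁻¹ := by
  rw [mem_ball_zero_iff] at hz
  refine tsum_of_norm_bounded ((hasSum_geometric_of_lt_one (norm_nonneg z) hz).mul_left C)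
    fun n => ?_
  rw [norm_mul, norm_pow]
  exact mul_le_mul_of_nonneg_right (hc n) (by positivity)

lemma powerSeries_mem_Hol {c : ℕ → ℂ} {C : ℝ} (hc : ∀ n, ‖c n‖ ≤ C) : powerSeries c ∈ Hol := by
  intro z hz
  obtain ⟨r, hzr, hr1⟩ := exists_between (mem_ball_zero_iff.1 hz)
  have h := Complex.differentiableOn_tsum_of_summable_norm (F := fun n z => c n * z ^ n)
    (summable_powerSeries hc ((norm_nonneg z).trans hzr.le) hr1) (fun n => by fun_prop)
    (isOpen_ball (x := (0 : ℂ)) (ε := r)) fun n w hw => by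
      rw [norm_mul, norm_pow]
      gcongr
      exact (mem_ball_zero_iff.1 hw).le
  exact (h.differentiableAt (isOpen_ball.mem_nhds (by simpa using hzr))).differentiableWithinAt

lemma coef_powerSeries {c : ℕ → ℂ} {C : ℝ} (hc : ∀ n, ‖c n‖ ≤ C) (n : ℕ) :
    coef (powerSeries c) n = c n :=
  coef_eq_of_hasSum (fun _ h => hasSum_powerSeries hc h) n (powerSeries_mem_Hol hc)

lemma deriv_eq_of_eqOn_ball {f g : ℂ → ℂ} (h : Set.EqOn f g (ball 0 1)) :
    Set.EqOn (deriv f) (deriv g) (ball 0 1) := fun _ hz =>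
  (h.eventuallyEq_of_mem (isOpen_ball.mem_nhds hz)).deriv_eq

lemma mem_Hol_congr {f g : ℂ → ℂ} (h : Set.EqOn f g (ball 0 1)) (hf : f ∈ Hol) : g ∈ Hol :=
  DifferentiableOn.congr hf fun _ hz => (h hz).symm

lemma energy_congr {f g : ℂ → ℂ} (μ : Measure ℂ) (h : Set.EqOn f g (ball 0 1)) :
    energy μ f = energy μ g := by
  refine lintegral_congr_ae ?_
  filter_upwards [ae_mem_ball] with z hz
  rw [deriv_eq_of_eqOn_ball h hz]

lemma mem_D_congr {f g : ℂ → ℂ} {μ : Measure ℂ} (h : Set.EqOn f g (ball 0 1)) (hf : f ∈ D μ) :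
    g ∈ D μ :=
  ⟨mem_Hol_congr h hf.1, by rw [← energy_congr μ h]; exact hf.2⟩

lemma hardyNormSq_congr {f g : ℂ → ℂ} (h : Set.EqOn f g (ball 0 1)) :
    hardyNormSq f = hardyNormSq g := by
  refine iSup_congr fun r => iSup_congr fun hr => lintegral_congr fun x => ?_
  rw [h (smul_pt_mem_ball hr.1 hr.2 x)]

lemma norm_deriv_powerSeries_le {c : ℕ → ℂ} {C : ℝ} (hc : ∀ n, ‖c n‖ ≤ C) {z : ℂ}
    (hz : z ∈ ball (0 : ℂ) 1) :
    ‖deriv (powerSeries c) z‖ ≤ C * (((1 - ‖z‖) / 2)⁻¹ * ((1 - ‖z‖) / 2)⁻¹) := by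
  rw [mem_ball_zero_iff] at hz
  have hC : 0 ≤ C := (norm_nonneg _).trans (hc 0)
  -- Cauchy's estimate is applied on the circle about `z` whose radius is half the distance to the
  -- boundary.
  have hr : 0 < (1 - ‖z‖) / 2 := by linarith
  have hsub : ∀ w ∈ closedBall z ((1 - ‖z‖) / 2), ‖w‖ ≤ 1 - (1 - ‖z‖) / 2 := by
    intro w hw
    rw [mem_closedBall, dist_eq_norm] at hw
    have := norm_add_le (w - z) z
    rw [sub_add_cancel] at this
    linarith
  have h := Complex.norm_deriv_le_of_forall_mem_sphere_norm_le (f := powerSeries c) (c := z) hr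
    (C := C * ((1 - ‖z‖) / 2)⁻¹) ?_ ?_
  · rw [← mul_assoc]; exact h
  · refine DifferentiableOn.diffContOnCl_ball (U := ball 0 1) (powerSeries_mem_Hol hc) fun w hw => ?_
    rw [mem_ball_zero_iff]
    linarith [hsub w hw]
  · intro w hw
    have h1 := hsub w (sphere_subset_closedBall hw)
    refine (norm_powerSeries_le hc (by rw [mem_ball_zero_iff]; linarith)).trans ?_
    gcongr
    linarith

/-! ### The space as a subset of the Hardy space -/

/-- The denominator `|1 - conj w z|` is at most 2. -/
lemma le_szegoKernel {w z : ℂ} (hw : ‖w‖ ≤ 1) (hz : ‖z‖ < 1) :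
    ENNReal.ofReal ((1 - ‖z‖ ^ 2) / 4) ≤ szegoKernel w z := by
  refine ENNReal.ofReal_le_ofReal ?_
  have h1 : ‖1 - conj w * z‖ ≤ 2 := by
    refine (norm_sub_le _ _).trans ?_
    rw [norm_one, norm_mul, Complex.norm_conj]
    nlinarith [norm_nonneg w, norm_nonneg z]
  have h2 : 0 < ‖1 - conj w * z‖ := norm_pos_iff.2 (one_sub_conj_mul_ne_zero' hw hz)
  have h3 := one_sub_norm_sq_pos hz
  gcongr
  nlinarith

lemma le_V (μ : Measure ℂ) {z : ℂ} (hz : ‖z‖ < 1) :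
    ENNReal.ofReal ((1 - ‖z‖ ^ 2) / 4) * μ (closedBall 0 1) ≤ V μ z := by
  rw [V, ← setLIntegral_const]
  exact setLIntegral_mono' measurableSet_closedBall fun w hw =>
    le_szegoKernel (by simpa using hw) hz

/-- The factor `(n+1)²` from differentiation meets the moment `1/((n+1)(n+2))`. The resulting weight
`(n+1)/(n+2)` lies between 1/2 and 1, so the weight `1 - |z|²` recovers the Hardy norm modulo
constants up to a factor 2. -/
lemma lintegral_deriv_sq {f : ℂ → ℂ} (hf : f ∈ Hol) :
    ∫⁻ z, ‖deriv f z‖ₑ ^ 2 * ENNReal.ofReal (1 - ‖z‖ ^ 2) ∂areaMeasure =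
      ∑' n : ℕ, ‖coef f (n + 1)‖ₑ ^ 2 * ENNReal.ofReal ((n + 1) / (n + 2)) := by
  rw [lintegral_sq_mul_one_sub (deriv_mem_Hol hf)]
  refine tsum_congr fun n => ?_
  have hn : ‖(n : ℂ) + 1‖ₑ ^ 2 = ENNReal.ofReal ((n + 1) ^ 2) := by
    rw [ENNReal.ofReal_pow (by positivity), ← ofReal_norm]
    congr 2
    exact_mod_cast Complex.norm_natCast (n + 1)
  rw [coef_deriv, enorm_mul, mul_pow, hn, mul_right_comm, mul_comm, ← ENNReal.ofReal_mul (by positivity)]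
  congr 2
  field_simp

/-- As `μ` has positive mass on the closed disk, `U μ ≥ V μ` dominates a positive multiple of `1 -
|z|²`; finite energy therefore makes the Taylor coefficients square summable. This places `D μ`
inside the Hardy space. -/
lemma hardyNormSq_lt_top {μ : Measure ℂ} (hμ : μ (closedBall 0 1)ᶜ = 0) (hμ0 : μ ≠ 0)
    {f : ℂ → ℂ} (hf : f ∈ D μ) : hardyNormSq f < ∞ := by
  have hm : μ (closedBall 0 1) ≠ 0 := fun h => hμ0 (by
    rw [← Measure.measure_univ_eq_zero, ← Set.union_compl_self (closedBall (0 : ℂ) 1)]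
    exact measure_union_null h hμ)
  have h1 : (∫⁻ z, ‖deriv f z‖ₑ ^ 2 * ENNReal.ofReal (1 - ‖z‖ ^ 2) ∂areaMeasure) *
      (ENNReal.ofReal (1 / 4) * μ (closedBall 0 1)) ≤ energy μ f := by
    refine (lintegral_mul_const_le _ _).trans (lintegral_mono_ae ?_)
    filter_upwards [ae_mem_ball] with z hz
    rw [mul_assoc]
    gcongr
    rw [← mul_assoc, ← ENNReal.ofReal_mul (one_sub_norm_sq_pos (by simpa using hz)).le,
      mul_one_div]
    exact (le_V μ (by simpa using hz)).trans (V_le_U μ hz)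
  have h2 : ∫⁻ z, ‖deriv f z‖ₑ ^ 2 * ENNReal.ofReal (1 - ‖z‖ ^ 2) ∂areaMeasure ≠ ∞ := by
    intro h
    rw [h, ENNReal.top_mul (mul_ne_zero (by norm_num) hm)] at h1
    exact hf.2.not_ge h1
  rw [lintegral_deriv_sq hf.1] at h2
  rw [hardyNormSq_eq hf.1, tsum_eq_zero_add' ENNReal.summable]
  refine ENNReal.add_lt_top.2 ⟨by finiteness, ?_⟩
  refine lt_of_le_of_lt ?_ (ENNReal.mul_lt_top (ENNReal.ofNat_lt_top (n := 2)) h2.lt_top)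
  rw [← ENNReal.tsum_mul_left]
  refine ENNReal.tsum_le_tsum fun n => ?_
  rw [mul_left_comm]
  refine le_mul_of_one_le_right' ?_
  rw [← ENNReal.ofReal_ofNat 2, ← ENNReal.ofReal_mul zero_le_two, ENNReal.one_le_ofReal,
    ← mul_div_assoc, le_div_iff₀ (by positivity)]
  linarith [(n.cast_nonneg : (0 : ℝ) ≤ n)]

/-! ### A Banach space model of the space -/

/-- The measure `U_μ dA`. -/
noncomputable abbrev weightedMeasure (μ : Measure ℂ) : Measure ℂ := areaMeasure.withDensity (U μ)

lemma energy_eq_lintegral (μ : Measure ℂ) [IsFiniteMeasure μ] (f : ℂ → ℂ) :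
    energy μ f = ∫⁻ z, ‖deriv f z‖ₑ ^ 2 ∂weightedMeasure μ := by
  rw [lintegral_withDensity_eq_lintegral_mul _ (measurable_U μ)
    ((measurable_deriv f).enorm.pow_const 2)]
  simp only [energy, Pi.mul_apply, mul_comm]

/-- The Hilbert space of square summable sequences. -/
abbrev Ell2 : Type := lp (fun _ : ℕ => ℂ) 2

lemma Ell2.norm_le (a : Ell2) (n : ℕ) : ‖a n‖ ≤ ‖a‖ := lp.norm_apply_le_norm two_ne_zero a n

lemma Ell2.powerSeries_add (a b : Ell2) :
    Set.EqOn (powerSeries (a + b : Ell2)) (powerSeries a + powerSeries b) (ball 0 1) := by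
  intro z hz
  have := (hasSum_powerSeries a.norm_le hz).add (hasSum_powerSeries b.norm_le hz)
  refine HasSum.unique (hasSum_powerSeries (a + b).norm_le hz) ?_
  change HasSum _ (powerSeries a z + powerSeries b z)
  simpa [add_mul] using this

lemma Ell2.powerSeries_smul (k : ℂ) (a : Ell2) :
    Set.EqOn (powerSeries (k • a : Ell2)) (k • powerSeries a) (ball 0 1) := by
  intro z hz
  have := (hasSum_powerSeries a.norm_le hz).mul_left k
  refine HasSum.unique (hasSum_powerSeries (k • a).norm_le hz) ?_
  change HasSum _ (k * powerSeries a z)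
  simpa [mul_assoc] using this

lemma Ell2.enorm_sq (a : Ell2) : ‖a‖ₑ ^ 2 = ∑' n, ‖a n‖ₑ ^ 2 := by
  have h := lp.hasSum_norm (p := 2) (by norm_num) a
  simp only [ENNReal.toReal_ofNat, Real.rpow_ofNat] at h
  rw [← ofReal_norm, ← ENNReal.ofReal_pow (norm_nonneg _), ← h.tsum_eq,
    ENNReal.ofReal_tsum_of_nonneg (fun n => by positivity) h.summable]
  simp_rw [ENNReal.ofReal_pow (norm_nonneg _), ofReal_norm]

lemma memℓp_two_of_tsum_lt_top {c : ℕ → ℂ} (h : ∑' n, ‖c n‖ₑ ^ 2 < ∞) : Memℓp c 2 := by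
  refine memℓp_gen ?_
  simp only [ENNReal.toReal_ofNat, Real.rpow_ofNat]
  have := ENNReal.summable_toReal h.ne
  simpa using this

lemma Lp_enorm_sq {α : Type*} [MeasurableSpace α] {m : Measure α} (F : Lp ℂ 2 m) :
    ‖F‖ₑ ^ 2 = ∫⁻ x, ‖F x‖ₑ ^ 2 ∂m := by
  rw [Lp.enorm_def, eLpNorm_eq_lintegral_rpow_enorm_toReal two_ne_zero ENNReal.ofNat_ne_top]
  simp only [ENNReal.toReal_ofNat, ENNReal.rpow_ofNat]
  rw [← ENNReal.rpow_natCast, ← ENNReal.rpow_mul]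
  simp

lemma ae_weighted_of_forall_ball {μ : Measure ℂ} {p : ℂ → Prop} (h : ∀ z ∈ ball (0 : ℂ) 1, p z) :
    ∀ᵐ z ∂weightedMeasure μ, p z := by
  refine (withDensity_absolutelyContinuous _ _).ae_le ?_
  filter_upwards [ae_mem_ball] with z hz using h z hz

/-- The pairs of the Taylor coefficients and the derivative of a function in `D μ`. -/
noncomputable def modelSpace (μ : Measure ℂ) : Submodule ℂ (Ell2 × Lp ℂ 2 (weightedMeasure μ)) where
  carrier := {p | p.2 =ᵐ[weightedMeasure μ] deriv (powerSeries p.1)}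
  zero_mem' := by
    have h0 : powerSeries ((0 : Ell2) : ℕ → ℂ) = fun _ => 0 := by
      ext z; simp [powerSeries]
    change ⇑(0 : Lp ℂ 2 (weightedMeasure μ)) =ᵐ[_] deriv (powerSeries ((0 : Ell2) : ℕ → ℂ))
    rw [h0, deriv_const']
    exact Lp.coeFn_zero _ _ _
  add_mem' := by
    intro p q hp hq
    filter_upwards [hp, hq, Lp.coeFn_add p.2 q.2, ae_weighted_of_forall_ball (μ := μ) fun z hz => hz]
      with z h1 h2 h3 hz
    rw [Prod.snd_add, h3, Prod.fst_add, deriv_eq_of_eqOn_ball (Ell2.powerSeries_add p.1 q.1) hz,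
      Pi.add_apply, h1, h2, deriv_add]
    · exact differentiableAt_of_mem_Hol (powerSeries_mem_Hol p.1.norm_le) hz
    · exact differentiableAt_of_mem_Hol (powerSeries_mem_Hol q.1.norm_le) hz
  smul_mem' := by
    intro k p hp
    filter_upwards [hp, Lp.coeFn_smul k p.2, ae_weighted_of_forall_ball (μ := μ) fun z hz => hz]
      with z h1 h3 hz
    rw [Prod.smul_snd, h3, Prod.smul_fst, deriv_eq_of_eqOn_ball (Ell2.powerSeries_smul k p.1) hz,
      Pi.smul_apply, h1, deriv_const_smul_field]

lemma Ell2.tendsto_powerSeries {a : ℕ → Ell2} {b : Ell2} (h : Tendsto a atTop (𝓝 b)) {z : ℂ}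
    (hz : z ∈ ball (0 : ℂ) 1) :
    Tendsto (fun k => powerSeries (a k) z) atTop (𝓝 (powerSeries b z)) := by
  rw [tendsto_iff_norm_sub_tendsto_zero] at h ⊢
  refine squeeze_zero (fun k => norm_nonneg _) (fun k => ?_) (by simpa using h.mul_const (1 - ‖z‖)⁻¹)
  have h1 := Ell2.powerSeries_add (a k - b) b hz
  rw [sub_add_cancel, Pi.add_apply] at h1
  rw [h1, add_sub_cancel_right]
  exact norm_powerSeries_le (a k - b).norm_le hz

lemma Ell2.tendsto_deriv_powerSeries {a : ℕ → Ell2} {b : Ell2} (h : Tendsto a atTop (𝓝 b)) {z : ℂ}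
    (hz : z ∈ ball (0 : ℂ) 1) :
    Tendsto (fun k => deriv (powerSeries (a k)) z) atTop (𝓝 (deriv (powerSeries b) z)) := by
  rw [tendsto_iff_norm_sub_tendsto_zero] at h ⊢
  refine squeeze_zero (fun k => norm_nonneg _) (fun k => ?_)
    (by simpa only [zero_mul] using h.mul_const (((1 - ‖z‖) / 2)⁻¹ * ((1 - ‖z‖) / 2)⁻¹))
  have h1 := deriv_eq_of_eqOn_ball (Ell2.powerSeries_add (a k - b) b) hz
  rw [sub_add_cancel, deriv_add
    (differentiableAt_of_mem_Hol (powerSeries_mem_Hol (a k - b).norm_le) hz)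
    (differentiableAt_of_mem_Hol (powerSeries_mem_Hol b.norm_le) hz)] at h1
  rw [h1, add_sub_cancel_right]
  exact norm_deriv_powerSeries_le (a k - b).norm_le hz

/-- Convergence in `L²` yields almost everywhere convergence of a subsequence, while convergence of
the coefficients in `ℓ²` yields pointwise convergence of the derivatives in the disk. The two limits
must agree. -/
lemma isClosed_modelSpace (μ : Measure ℂ) : IsClosed (modelSpace μ : Set (Ell2 × Lp ℂ 2 (weightedMeasure μ))) := by
  refine IsSeqClosed.isClosed fun x p hx hp => ?_
  have h1 : Tendsto (fun k => (x k).1) atTop (𝓝 p.1) := (continuous_fst.tendsto _).comp hp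
  have h2 : Tendsto (fun k => (x k).2) atTop (𝓝 p.2) := (continuous_snd.tendsto _).comp hp
  obtain ⟨ns, hns, hae⟩ := (tendstoInMeasure_of_tendsto_Lp h2).exists_seq_tendsto_ae
  have h3 : ∀ᵐ z ∂weightedMeasure μ, ∀ k, (x k).2 z = deriv (powerSeries (x k).1) z :=
    ae_all_iff.2 fun k => hx k
  change p.2 =ᵐ[_] _
  filter_upwards [hae, h3, ae_weighted_of_forall_ball (μ := μ) fun z hz => hz] with z hz1 hz2 hz
  refine tendsto_nhds_unique hz1 ?_
  simp_rw [hz2]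
  exact (Ell2.tendsto_deriv_powerSeries h1 hz).comp hns.tendsto_atTop

instance (μ : Measure ℂ) : CompleteSpace (modelSpace μ) :=
  (isClosed_modelSpace μ).completeSpace_coe

/-- The function in `D μ` represented by an element of the model space. -/
noncomputable def toHol {μ : Measure ℂ} (x : modelSpace μ) : ℂ → ℂ := powerSeries x.1.1

lemma toHol_mem_Hol {μ : Measure ℂ} (x : modelSpace μ) : (toHol x) ∈ Hol :=
  powerSeries_mem_Hol x.1.1.norm_le

lemma modelSpace_enorm_snd {μ : Measure ℂ} [IsFiniteMeasure μ] (x : modelSpace μ) :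
    ‖x.1.2‖ₑ ^ 2 = energy μ (toHol x) := by
  rw [Lp_enorm_sq, energy_eq_lintegral]
  refine lintegral_congr_ae ?_
  filter_upwards [x.2] with z hz
  rw [hz]; rfl

lemma modelSpace_enorm_fst {μ : Measure ℂ} (x : modelSpace μ) :
    ‖x.1.1‖ₑ ^ 2 = hardyNormSq (toHol x) := by
  rw [Ell2.enorm_sq, hardyNormSq_eq (toHol_mem_Hol x)]
  simp_rw [toHol, coef_powerSeries x.1.1.norm_le]

lemma toHol_mem_D {μ : Measure ℂ} [IsFiniteMeasure μ] (x : modelSpace μ) :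
    (toHol x) ∈ D μ :=
  ⟨(toHol_mem_Hol x), by rw [← modelSpace_enorm_snd x]; finiteness⟩

lemma modelSpace_ext_toHol {μ : Measure ℂ} {x y : modelSpace μ}
    (h : Set.EqOn (toHol x) (toHol y) (ball 0 1)) : x = y := by
  refine Subtype.ext (Prod.ext ?_ ?_)
  · ext n
    have h1 := coef_powerSeries x.1.1.norm_le n
    rw [← h1]
    exact coef_eq_of_hasSum (fun z hz => by
      have := hasSum_powerSeries y.1.1.norm_le hz
      rwa [← show (toHol x) z = powerSeries y.1.1 z from h hz] at this) n (toHol_mem_Hol x)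
  · refine Lp.ext ?_
    filter_upwards [x.2, y.2, ae_weighted_of_forall_ball (μ := μ) fun z hz => hz] with z h1 h2 hz
    rw [h1, h2]
    exact deriv_eq_of_eqOn_ball h hz

/-- Surjectivity of the model. Agreement can hold only on the disk, since `f` is unconstrained
elsewhere. -/
lemma modelSpace_exists_toHol_eq {μ : Measure ℂ} [IsFiniteMeasure μ]
    (hμ : μ (closedBall 0 1)ᶜ = 0) (hμ0 : μ ≠ 0) {f : ℂ → ℂ} (hf : f ∈ D μ) :
    ∃ x : modelSpace μ, Set.EqOn (toHol x) f (ball 0 1) := by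
  have h1 := hardyNormSq_lt_top hμ hμ0 hf
  rw [hardyNormSq_eq hf.1] at h1
  have h2 : MemLp (deriv f) 2 (weightedMeasure μ) :=
    (memLp_two_iff_lintegral (measurable_deriv f).aestronglyMeasurable).2
      (by rw [← energy_eq_lintegral]; exact hf.2)
  have h3 : Set.EqOn (powerSeries (coef f)) f (ball 0 1) := fun z hz => (hasSum_coef hf.1 hz).tsum_eq
  refine ⟨⟨(⟨coef f, memℓp_two_of_tsum_lt_top h1⟩, h2.toLp _), ?_⟩, h3⟩
  change ⇑(h2.toLp _) =ᵐ[_] deriv (powerSeries (coef f))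
  filter_upwards [h2.coeFn_toLp, ae_weighted_of_forall_ball (μ := μ) fun z hz => hz] with z h4 hz
  rw [h4, deriv_eq_of_eqOn_ball h3 hz]

lemma toHol_add {μ : Measure ℂ} (x y : modelSpace μ) :
    Set.EqOn (toHol (x + y)) ((toHol x) + (toHol y)) (ball 0 1) := Ell2.powerSeries_add x.1.1 y.1.1

lemma toHol_smul {μ : Measure ℂ} (k : ℂ) (x : modelSpace μ) :
    Set.EqOn (toHol (k • x)) (k • (toHol x)) (ball 0 1) := Ell2.powerSeries_smul k x.1.1

lemma modelSpace_tendsto_toHol {μ : Measure ℂ} {x : ℕ → modelSpace μ} {y : modelSpace μ}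
    (h : Tendsto x atTop (𝓝 y)) {z : ℂ} (hz : z ∈ ball (0 : ℂ) 1) :
    Tendsto (fun k => (toHol (x k)) z) atTop (𝓝 ((toHol y) z)) :=
  Ell2.tendsto_powerSeries
    (((continuous_fst.comp continuous_subtype_val).tendsto y).comp h) hz

/-- Closed graph theorem for multipliers of `D μ`. -/
lemma exists_multiplication {μ : Measure ℂ} [IsFiniteMeasure μ]
    (hμ : μ (closedBall 0 1)ᶜ = 0) (hμ0 : μ ≠ 0) {φ : ℂ → ℂ} (hφ : φ ∈ multD μ) :
    ∃ T : modelSpace μ →L[ℂ] modelSpace μ, ∀ x, Set.EqOn (toHol (T x)) (φ * (toHol x)) (ball 0 1) := by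
  choose T hT using fun x : modelSpace μ =>
    modelSpace_exists_toHol_eq hμ hμ0 (hφ.2 (toHol x) (toHol_mem_D x))
  let L : modelSpace μ →ₗ[ℂ] modelSpace μ :=
    { toFun := T
      map_add' := fun x y => modelSpace_ext_toHol fun z hz => by
        rw [hT _ hz, toHol_add _ _ hz, Pi.add_apply, hT _ hz, hT _ hz, Pi.mul_apply,
          Pi.mul_apply, Pi.mul_apply, toHol_add _ _ hz, Pi.add_apply, mul_add]
      map_smul' := fun k x => modelSpace_ext_toHol fun z hz => by
        rw [hT _ hz, RingHom.id_apply, toHol_smul _ _ hz, Pi.smul_apply, hT _ hz,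
          Pi.mul_apply, Pi.mul_apply, toHol_smul _ _ hz, Pi.smul_apply, smul_eq_mul,
          smul_eq_mul, mul_left_comm] }
  -- The graph is closed because point evaluations are continuous: if `u k → x` and `L (u k) → y`,
  -- then at each `z` the values converge both to `y z` and to `φ z * x z`.
  refine ⟨ContinuousLinearMap.ofSeqClosedGraph (g := L) fun u x y hu hy => ?_, hT⟩
  refine modelSpace_ext_toHol fun z hz => ?_
  refine tendsto_nhds_unique (modelSpace_tendsto_toHol hy hz) ?_
  have h1 := (modelSpace_tendsto_toHol hu hz).const_mul (φ z)
  rw [show (toHol (L x)) z = φ z * (toHol x) z from hT x hz]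
  refine h1.congr fun k => ?_
  exact (hT (u k) hz).symm

/-! ### Multipliers and Carleson measures -/

lemma enorm_add_sq_le (a b : ℂ) : ‖a + b‖ₑ ^ 2 ≤ 2 * ‖a‖ₑ ^ 2 + 2 * ‖b‖ₑ ^ 2 := by
  have h1 : ‖a + b‖₊ ^ 2 ≤ 2 * ‖a‖₊ ^ 2 + 2 * ‖b‖₊ ^ 2 := by
    rw [← mul_add]
    exact (pow_le_pow_left₀ (zero_le) (nnnorm_add_le a b) 2).trans add_sq_le
  simp only [enorm_eq_nnnorm]
  exact_mod_cast h1

lemma enorm_sub_sq_le (a b : ℂ) : ‖a - b‖ₑ ^ 2 ≤ 2 * ‖a‖ₑ ^ 2 + 2 * ‖b‖ₑ ^ 2 := by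
  simpa [sub_eq_add_neg] using enorm_add_sq_le a (-b)

lemma const_mem_D (μ : Measure ℂ) (c : ℂ) : (fun _ => c) ∈ D μ :=
  ⟨differentiableOn_const c, by simp [energy]⟩

lemma norm_toHol_le {μ : Measure ℂ} (x : modelSpace μ) {z : ℂ} (hz : z ∈ ball (0 : ℂ) 1) :
    ‖toHol x z‖ ≤ ‖x‖ * (1 - ‖z‖)⁻¹ := by
  refine (norm_powerSeries_le x.1.1.norm_le hz).trans ?_
  have : 0 < 1 - ‖z‖ := by rw [mem_ball_zero_iff] at hz; linarith
  gcongr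
  exact norm_fst_le x.1

lemma le_of_forall_pow_le {a K C : ℝ} (hC : 0 < C) (h : ∀ n : ℕ, a ^ n ≤ K * C ^ n) : a ≤ C := by
  by_contra! hlt
  obtain ⟨n, hn⟩ := pow_unbounded_of_one_lt K ((one_lt_div hC).2 hlt)
  rw [div_pow, lt_div_iff₀ (by positivity)] at hn
  exact absurd (h n) hn.not_ge

/-- Iterating the bounded operator on the constant `1` gives `|φ z| ^ n ≤ K_z (‖T‖ + 1) ^ n` with
`K_z` independent of `n`; taking `n` large removes `K_z`. -/
lemma mem_Hinf_of_mem_multD {μ : Measure ℂ} [IsFiniteMeasure μ]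
    (hμ : μ (closedBall 0 1)ᶜ = 0) (hμ0 : μ ≠ 0) {φ : ℂ → ℂ} (hφ : φ ∈ multD μ) : φ ∈ Hinf := by
  obtain ⟨T, hT⟩ := exists_multiplication hμ hμ0 hφ
  obtain ⟨e, he⟩ := modelSpace_exists_toHol_eq hμ hμ0 (const_mem_D μ 1)
  have hpow : ∀ n : ℕ, ∀ z ∈ ball (0 : ℂ) 1, toHol ((T ^ n) e) z = φ z ^ n := by
    intro n z hz
    induction n with
    | zero => simpa using he hz
    | succ n ih =>
      rw [pow_succ', mul_apply_eq_comp, hT _ hz, Pi.mul_apply, ih, pow_succ']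
  -- The added 1 only keeps the base positive.
  refine ⟨hφ.1.1, ‖T‖ + 1, fun z hz => ?_⟩
  refine le_of_forall_pow_le (K := ‖e‖ * (1 - ‖z‖)⁻¹) (by positivity) fun n => ?_
  have h0 : 0 ≤ (1 - ‖z‖)⁻¹ := by
    rw [mem_ball_zero_iff] at hz
    exact inv_nonneg.2 (by linarith)
  have h1 : ‖(T ^ n) e‖ ≤ (‖T‖ + 1) ^ n * ‖e‖ := by
    induction n with
    | zero => simp
    | succ n ih =>
      rw [pow_succ', mul_apply_eq_comp]
      refine (T.le_opNorm _).trans ?_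
      calc _ ≤ (‖T‖ + 1) * ((‖T‖ + 1) ^ n * ‖e‖) := by gcongr; linarith
        _ = _ := by ring
  rw [← norm_pow, ← hpow n z hz]
  refine (norm_toHol_le _ hz).trans ?_
  calc _ ≤ (‖T‖ + 1) ^ n * ‖e‖ * (1 - ‖z‖)⁻¹ := by gcongr
    _ = _ := by ring

lemma lintegral_derivMeasure {f : ℂ → ℂ} (hf : f ∈ Hol) (φ : ℂ → ℂ) {W : ℂ → ℝ≥0∞}
    (hW : Measurable W) :
    ∫⁻ z in ball 0 1, ‖f z‖ₑ ^ 2 ∂derivMeasure φ W =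
      ∫⁻ z, ‖f z * deriv φ z‖ₑ ^ 2 * W z ∂areaMeasure := by
  have hm : Measurable ((ball (0 : ℂ) 1).indicator fun z => ‖f z‖ₑ ^ 2) := by
    simpa using measurable_indicator_sq_mul hf (measurable_const (a := (1 : ℝ≥0∞)))
  rw [← lintegral_indicator measurableSet_ball, derivMeasure,
    lintegral_withDensity_eq_lintegral_mul _ (g := (ball (0 : ℂ) 1).indicator fun z => ‖f z‖ₑ ^ 2)
      (f := fun z => ‖deriv φ z‖ₑ ^ 2 * W z) (((measurable_deriv φ).enorm.pow_const 2).mul hW) hm]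
  refine lintegral_congr_ae ?_
  filter_upwards [ae_mem_ball] with z hz
  rw [Pi.mul_apply, Set.indicator_of_mem hz, enorm_mul]
  ring

lemma deriv_mul_of_mem_ball {f φ : ℂ → ℂ} (hf : f ∈ Hol) (hφ : φ ∈ Hol) {z : ℂ}
    (hz : z ∈ ball (0 : ℂ) 1) : deriv (φ * f) z = deriv φ z * f z + φ z * deriv f z :=
  deriv_mul (differentiableAt_of_mem_Hol hφ hz) (differentiableAt_of_mem_Hol hf hz)

lemma enorm_le_of_norm_le {a : ℂ} {C : ℝ} (h : ‖a‖ ≤ C) : ‖a‖ₑ ≤ ENNReal.ofReal C := by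
  rw [← ofReal_norm]
  exact ENNReal.ofReal_le_ofReal h

/-- The product rule in the form `f φ' = (φ f)' - φ f'`. -/
lemma lintegral_mul_deriv_le {μ : Measure ℂ} [IsFiniteMeasure μ] {f φ : ℂ → ℂ} (hf : f ∈ Hol)
    (hφ : φ ∈ Hol) {C : ℝ} (hC : ∀ z ∈ ball (0 : ℂ) 1, ‖φ z‖ ≤ C) :
    ∫⁻ z, ‖f z * deriv φ z‖ₑ ^ 2 * U μ z ∂areaMeasure ≤
      2 * energy μ (φ * f) + 2 * ENNReal.ofReal C ^ 2 * energy μ f := by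
  have hU := measurable_U μ
  rw [energy, energy, ← lintegral_const_mul' _ _ ENNReal.ofNat_ne_top,
    ← lintegral_const_mul' _ _ (by finiteness), ← lintegral_add_right]
  · refine lintegral_mono_ae ?_
    filter_upwards [ae_mem_ball] with z hz
    have h1 : f z * deriv φ z = deriv (φ * f) z - φ z * deriv f z := by
      rw [deriv_mul_of_mem_ball hf hφ hz]; ring
    calc _ ≤ (2 * ‖deriv (φ * f) z‖ₑ ^ 2 + 2 * (ENNReal.ofReal C ^ 2 * ‖deriv f z‖ₑ ^ 2)) * U μ z := by
          rw [h1]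
          refine mul_le_mul_left (a := U μ z) ((enorm_sub_sq_le _ _).trans ?_)
          rw [enorm_mul (φ z), mul_pow]
          gcongr
          exact enorm_le_of_norm_le (hC z hz)
      _ = _ := by ring
  · exact (((measurable_deriv f).enorm.pow_const 2).mul hU).const_mul _

lemma energy_mul_le {μ : Measure ℂ} [IsFiniteMeasure μ] {f φ : ℂ → ℂ} (hf : f ∈ Hol)
    (hφ : φ ∈ Hol) {C : ℝ} (hC : ∀ z ∈ ball (0 : ℂ) 1, ‖φ z‖ ≤ C) :
    energy μ (φ * f) ≤ 2 * (∫⁻ z, ‖f z * deriv φ z‖ₑ ^ 2 * U μ z ∂areaMeasure) +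
      2 * ENNReal.ofReal C ^ 2 * energy μ f := by
  have hU := measurable_U μ
  rw [energy, energy, ← lintegral_const_mul' _ _ ENNReal.ofNat_ne_top,
    ← lintegral_const_mul' _ _ (by finiteness), ← lintegral_add_right]
  · refine lintegral_mono_ae ?_
    filter_upwards [ae_mem_ball] with z hz
    have h1 : deriv (φ * f) z = f z * deriv φ z + φ z * deriv f z := by
      rw [deriv_mul_of_mem_ball hf hφ hz]; ring
    calc _ ≤ (2 * ‖f z * deriv φ z‖ₑ ^ 2 + 2 * (ENNReal.ofReal C ^ 2 * ‖deriv f z‖ₑ ^ 2)) * U μ z := by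
          rw [h1]
          refine mul_le_mul_left (a := U μ z) ((enorm_add_sq_le _ _).trans ?_)
          rw [enorm_mul (φ z), mul_pow]
          gcongr
          exact enorm_le_of_norm_le (hC z hz)
      _ = _ := by ring
  · exact (((measurable_deriv f).enorm.pow_const 2).mul hU).const_mul _

lemma normSqD_lt_top {μ : Measure ℂ} (hμ : μ (closedBall 0 1)ᶜ = 0) (hμ0 : μ ≠ 0)
    {f : ℂ → ℂ} (hf : f ∈ D μ) : normSqD μ f < ∞ :=
  ENNReal.add_lt_top.2 ⟨hardyNormSq_lt_top hμ hμ0 hf, hf.2⟩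

lemma exists_energy_mul_le {μ : Measure ℂ} [IsFiniteMeasure μ]
    (hμ : μ (closedBall 0 1)ᶜ = 0) (hμ0 : μ ≠ 0) {φ : ℂ → ℂ} (hφ : φ ∈ multD μ) :
    ∃ C : ℝ≥0, ∀ f ∈ D μ, energy μ (φ * f) ≤ C * normSqD μ f := by
  obtain ⟨T, hT⟩ := exists_multiplication hμ hμ0 hφ
  refine ⟨‖T‖₊ ^ 2, fun f hf => ?_⟩
  obtain ⟨x, hx⟩ := modelSpace_exists_toHol_eq hμ hμ0 hf
  have h1 : Set.EqOn (toHol (T x)) (φ * f) (ball 0 1) := fun z hz => by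
    rw [hT x hz, Pi.mul_apply, Pi.mul_apply, hx hz]
  have h2 : ‖(T x).1.2‖ₑ ≤ ‖T‖₊ * ‖x‖ₑ := by
    have h3 : ‖(T x).1.2‖₊ ≤ ‖T‖₊ * ‖x‖₊ := (norm_snd_le (T x).1).trans (T.le_opNorm x)
    simp only [enorm_eq_nnnorm]
    exact_mod_cast h3
  have h4 : ‖x‖ₑ ^ 2 ≤ normSqD μ f := by
    rw [normSqD, ← hardyNormSq_congr hx, ← energy_congr μ hx, ← modelSpace_enorm_fst,
      ← modelSpace_enorm_snd]
    -- The product carries the maximum norm, whose square is at most the sum of squares defining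
    -- `normSqD`.
    have h5 : ‖x‖ₑ = max ‖x.1.1‖ₑ ‖x.1.2‖ₑ := by
      have : ‖x‖₊ = max ‖x.1.1‖₊ ‖x.1.2‖₊ := rfl
      simp only [enorm_eq_nnnorm, this, ENNReal.coe_max]
    rw [h5]
    rcases max_choice ‖x.1.1‖ₑ ‖x.1.2‖ₑ with h | h <;> rw [h]
    · exact le_self_add
    · exact le_add_self
  rw [← energy_congr μ h1, ← modelSpace_enorm_snd]
  calc _ ≤ (‖T‖₊ * ‖x‖ₑ) ^ 2 := by gcongr
    _ ≤ _ := by rw [mul_pow, ENNReal.coe_pow]; gcongr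

lemma isCarleson_U_of_mem_multD {μ : Measure ℂ} [IsFiniteMeasure μ]
    (hμ : μ (closedBall 0 1)ᶜ = 0) (hμ0 : μ ≠ 0) {φ : ℂ → ℂ} (hφ : φ ∈ multD μ) :
    IsCarleson μ (derivMeasure φ (U μ)) := by
  obtain ⟨C, hC⟩ := exists_energy_mul_le hμ hμ0 hφ
  obtain ⟨B, hB⟩ := (mem_Hinf_of_mem_multD hμ hμ0 hφ).2
  refine ⟨2 * C + 2 * B.toNNReal ^ 2, fun f hf => ?_⟩
  rw [lintegral_derivMeasure hf.1 φ (measurable_U μ)]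
  refine (lintegral_mul_deriv_le hf.1 hφ.1.1 hB).trans ?_
  push_cast
  rw [add_mul, mul_assoc 2 (C : ℝ≥0∞)]
  gcongr
  · exact hC f hf
  · exact le_rfl
  · exact le_add_self

lemma mem_multD_of_isCarleson {μ : Measure ℂ} [IsFiniteMeasure μ]
    (hμ : μ (closedBall 0 1)ᶜ = 0) (hμ0 : μ ≠ 0) {φ : ℂ → ℂ} (hφ : φ ∈ Hinf)
    (h : IsCarleson μ (derivMeasure φ (U μ))) : φ ∈ multD μ := by
  obtain ⟨C, hC⟩ := h
  obtain ⟨B, hB⟩ := hφ.2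
  have key : ∀ f ∈ D μ, φ * f ∈ D μ := by
    intro f hf
    refine ⟨DifferentiableOn.mul hφ.1 hf.1, (energy_mul_le hf.1 hφ.1 hB).trans_lt ?_⟩
    have h1 := hC f hf
    rw [lintegral_derivMeasure hf.1 φ (measurable_U μ)] at h1
    have h2 := (h1.trans_lt (ENNReal.mul_lt_top ENNReal.coe_lt_top (normSqD_lt_top hμ hμ0 hf)))
    have h3 := hf.2
    finiteness
  refine ⟨?_, key⟩
  have := key _ (const_mem_D μ 1)
  rwa [show (φ * fun _ => (1 : ℂ)) = φ from mul_one φ] at this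

/-- The inequality `U ≤ 2 V` holds only after integration against the square of a holomorphic
function; `f φ'` is one. -/
lemma isCarleson_U_iff_V {μ : Measure ℂ} [IsFiniteMeasure μ] {φ : ℂ → ℂ} (hφ : φ ∈ Hol) :
    IsCarleson μ (derivMeasure φ (U μ)) ↔ IsCarleson μ (derivMeasure φ (V μ)) := by
  constructor
  · rintro ⟨C, hC⟩
    refine ⟨C, fun f hf => le_trans ?_ (hC f hf)⟩
    rw [lintegral_derivMeasure hf.1 φ (measurable_U μ),
      lintegral_derivMeasure hf.1 φ (measurable_V μ)]
    refine lintegral_mono_ae ?_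
    filter_upwards [ae_mem_ball] with z hz
    gcongr
    exact V_le_U μ hz
  · rintro ⟨C, hC⟩
    refine ⟨2 * C, fun f hf => ?_⟩
    have := hC f hf
    rw [lintegral_derivMeasure hf.1 φ (measurable_V μ)] at this
    rw [lintegral_derivMeasure hf.1 φ (measurable_U μ)]
    refine (lintegral_mul_U_le μ (g := fun z => f z * deriv φ z)
      (DifferentiableOn.mul hf.1 (deriv_mem_Hol hφ))).trans ?_
    push_cast
    rw [mul_assoc]
    gcongr

lemma mem_multD_iff_U {μ : Measure ℂ} [IsFiniteMeasure μ]
    (hμ : μ (closedBall 0 1)ᶜ = 0) (hμ0 : μ ≠ 0) (φ : ℂ → ℂ) :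
    φ ∈ multD μ ↔ φ ∈ Hinf ∧ IsCarleson μ (derivMeasure φ (U μ)) :=
  ⟨fun h => ⟨mem_Hinf_of_mem_multD hμ hμ0 h, isCarleson_U_of_mem_multD hμ hμ0 h⟩,
    fun h => mem_multD_of_isCarleson hμ hμ0 h.1 h.2⟩

lemma mem_multD_iff_V {μ : Measure ℂ} [IsFiniteMeasure μ]
    (hμ : μ (closedBall 0 1)ᶜ = 0) (hμ0 : μ ≠ 0) (φ : ℂ → ℂ) :
    φ ∈ multD μ ↔ φ ∈ Hinf ∧ IsCarleson μ (derivMeasure φ (V μ)) := by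
  rw [mem_multD_iff_U hμ hμ0]
  exact and_congr_right fun h => isCarleson_U_iff_V h.1

/-! ### Poisson integrals -/

/-- The harmonic extension to the disk of the `n`-th character of the circle. -/
noncomputable def harmonicMonomial (z : ℂ) : ℤ → ℂ
  | Int.ofNat n => z ^ n
  | Int.negSucc n => conj z ^ (n + 1)

@[simp] lemma harmonicMonomial_natCast (z : ℂ) (n : ℕ) : harmonicMonomial z n = z ^ n := rfl

@[simp] lemma harmonicMonomial_neg_succ (z : ℂ) (n : ℕ) :
    harmonicMonomial z (-((n : ℤ) + 1)) = conj z ^ (n + 1) := by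
  rw [← Int.negSucc_eq]; rfl

lemma harmonicMonomial_zero_right (z : ℂ) : harmonicMonomial z 0 = 1 := pow_zero z

lemma summable_norm_harmonicMonomial {z : ℂ} (hz : ‖z‖ < 1) :
    Summable fun n => ‖harmonicMonomial z n‖ := by
  refine Summable.of_nat_of_neg_add_one ?_ ?_
  · simpa using summable_geometric_of_lt_one (norm_nonneg z) hz
  · simpa only [harmonicMonomial_neg_succ, norm_pow, Complex.norm_conj] using
      (summable_nat_add_iff 1).2 (summable_geometric_of_lt_one (norm_nonneg z) hz)

lemma pt_mul_conj (x : 𝕋) : pt x * conj (pt x) = 1 := by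
  rw [Complex.mul_conj, Complex.normSq_eq_norm_sq, norm_pt]; simp

lemma norm_pt_sub (x : 𝕋) (z : ℂ) : ‖pt x - z‖ = ‖1 - z * conj (pt x)‖ := by
  have : pt x - z = pt x * (1 - z * conj (pt x)) := by
    rw [mul_sub, mul_one, mul_left_comm, pt_mul_conj, mul_one]
  rw [this, norm_mul, norm_pt, one_mul]

lemma pt_sub_ne_zero {z : ℂ} (hz : ‖z‖ < 1) (x : 𝕋) : pt x - z ≠ 0 := by
  intro h
  rw [← sub_eq_zero.1 h, norm_pt] at hz
  exact lt_irrefl _ hz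

lemma poissonKernel_pt (z : ℂ) (x : 𝕋) :
    poissonKernel 0 z (pt x) = (1 - ‖z‖ ^ 2) / ‖pt x - z‖ ^ 2 := by
  rw [poissonKernel_def]; simp [norm_pt]

lemma poissonKernel_pt_nonneg {z : ℂ} (hz : ‖z‖ < 1) (x : 𝕋) : 0 ≤ poissonKernel 0 z (pt x) := by
  rw [poissonKernel_pt]
  exact div_nonneg (one_sub_norm_sq_pos hz).le (by positivity)

/-- With `u = z conj (pt x)`, the two geometric series add up to `1/(1-u) + conj u/(1 - conj u) = (1
- |u|²)/|1 - u|²`. -/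
lemma hasSum_poissonKernel {z : ℂ} (hz : ‖z‖ < 1) (x : 𝕋) :
    HasSum (fun n => harmonicMonomial z n * fourier (-n) x) (poissonKernel 0 z (pt x) : ℂ) := by
  set u := z * conj (pt x) with hu
  have hun : ‖u‖ < 1 := by rwa [hu, norm_mul, Complex.norm_conj, norm_pt, mul_one]
  have hcn : ‖conj u‖ < 1 := by rwa [Complex.norm_conj]
  have hcu : conj u = conj z * pt x := by simp [hu]
  have h1 : HasSum (fun n : ℕ => harmonicMonomial z n * fourier (-(n : ℤ)) x) (1 - u)⁻¹ := by
    simp_rw [harmonicMonomial_natCast, fourier_neg_natCast, ← mul_pow]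
    exact hasSum_geometric_of_norm_lt_one hun
  have h2 : HasSum (fun n : ℕ => harmonicMonomial z (-((n : ℤ) + 1)) *
      fourier (-(-((n : ℤ) + 1))) x) (conj u * (1 - conj u)⁻¹) := by
    have h3 := (hasSum_geometric_of_norm_lt_one hcn).mul_left (conj u)
    refine h3.congr_fun fun n => ?_
    have h4 : (fourier (-(-((n : ℤ) + 1))) x : ℂ) = pt x ^ (n + 1) := by
      rw [neg_neg, ← fourier_natCast]; rfl
    rw [harmonicMonomial_neg_succ, h4, ← mul_pow, ← hcu, pow_succ']
  have hne : 1 - u ≠ 0 := fun h => by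
    rw [← sub_eq_zero.1 h, norm_one] at hun; exact lt_irrefl _ hun
  have hne' : 1 - conj u ≠ 0 := fun h => by
    rw [← sub_eq_zero.1 h, norm_one] at hcn; exact lt_irrefl _ hcn
  convert HasSum.of_nat_of_neg_add_one (f := fun n => harmonicMonomial z n * fourier (-n) x) h1 h2
    using 1
  rw [poissonKernel_pt, norm_pt_sub, ← hu]
  have hz2 : ‖z‖ = ‖u‖ := by rw [hu, norm_mul, Complex.norm_conj, norm_pt, mul_one]
  rw [hz2]
  push_cast
  have e1 : ((‖u‖ : ℂ)) ^ 2 = u * conj u := by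
    rw [Complex.mul_conj, Complex.normSq_eq_norm_sq]; push_cast; rfl
  have e2 : ((‖1 - u‖ : ℂ)) ^ 2 = (1 - u) * (1 - conj u) := by
    have := Complex.mul_conj (1 - u)
    rw [Complex.normSq_eq_norm_sq, map_sub, map_one] at this
    rw [this]; push_cast; rfl
  rw [e1, e2]
  field_simp
  ring

lemma continuous_poissonKernel_pt {z : ℂ} (hz : ‖z‖ < 1) :
    Continuous fun x : 𝕋 => poissonKernel 0 z (pt x) := by
  simp_rw [poissonKernel_pt]
  refine Continuous.div (by fun_prop) (by have := continuous_pt; fun_prop) fun x => ?_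
  exact pow_ne_zero 2 (norm_ne_zero_iff.2 (pt_sub_ne_zero hz x))

lemma integrable_poissonKernel_mul {z : ℂ} (hz : ‖z‖ < 1) {g : 𝕋 → ℂ} (hg : Integrable g arc) :
    Integrable (fun x => (poissonKernel 0 z (pt x) : ℂ) * g x) arc := by
  have hc : Continuous fun x : 𝕋 => (poissonKernel 0 z (pt x) : ℂ) :=
    Complex.continuous_ofReal.comp (continuous_poissonKernel_pt hz)
  obtain ⟨C, hC⟩ := isCompact_univ.exists_bound_of_continuousOn hc.continuousOn
  exact hg.bdd_mul hc.aestronglyMeasurable (Eventually.of_forall fun x => hC x trivial)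

lemma hasSum_poisson {z : ℂ} (hz : ‖z‖ < 1) {g : 𝕋 → ℂ} (hg : Integrable g arc) :
    HasSum (fun n => harmonicMonomial z n * fourierCoeff g n) (poisson g z) := by
  have hnorm : ∀ (n : ℤ) (x : 𝕋), ‖harmonicMonomial z n * (fourier (-n) x : ℂ) * g x‖ =
      ‖harmonicMonomial z n‖ * ‖g x‖ := fun n x => by
    rw [norm_mul, norm_mul, norm_fourier_apply, mul_one]
  have h := hasSum_integral_of_summable_integral_norm (μ := arc)
    (F := fun n x => harmonicMonomial z n * (fourier (-n) x : ℂ) * g x) ?_ ?_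
  · have h1 : ∀ n : ℤ, ∫ x, harmonicMonomial z n * (fourier (-n) x : ℂ) * g x ∂arc =
        harmonicMonomial z n * fourierCoeff g n := fun n => by
      simp_rw [mul_assoc]
      rw [integral_const_mul]; rfl
    have h2 : ∀ x : 𝕋, ∑' n : ℤ, harmonicMonomial z n * (fourier (-n) x : ℂ) * g x =
        (poissonKernel 0 z (pt x) : ℂ) * g x := fun x =>
      ((hasSum_poissonKernel hz x).mul_right (g x)).tsum_eq
    simp_rw [h1, h2] at h
    exact h
  · intro n
    have : Continuous fun x : 𝕋 => harmonicMonomial z n * (fourier (-n) x : ℂ) := by fun_prop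
    refine hg.bdd_mul (c := ‖harmonicMonomial z n‖) this.aestronglyMeasurable
      (Eventually.of_forall fun x => ?_)
    rw [norm_mul, norm_fourier_apply, mul_one]
  · simp_rw [hnorm, integral_const_mul]
    exact (summable_norm_harmonicMonomial hz).mul_right _

lemma poisson_fourier {z : ℂ} (hz : ‖z‖ < 1) (n : ℤ) :
    poisson (fourier n) z = harmonicMonomial z n := by
  have h := hasSum_poisson hz (g := fourier n)
    ((memLp_of_continuous (map_continuous (fourier n)) 1).integrable le_rfl)
  refine h.unique ?_
  convert hasSum_ite_eq n (harmonicMonomial z n) using 2 with k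
  rw [fourierCoeff_fourier]
  by_cases hk : k = n
  · subst hk; simp
  · simp [hk]

lemma poisson_const {z : ℂ} (hz : ‖z‖ < 1) (c : ℂ) : poisson (fun _ => c) z = c := by
  have h := poisson_fourier hz 0
  simp only [harmonicMonomial_zero_right, poisson, fourier_zero, mul_one] at h
  rw [poisson, integral_mul_const, h, one_mul]

lemma integral_poissonKernel {z : ℂ} (hz : ‖z‖ < 1) :
    ∫ x, poissonKernel 0 z (pt x) ∂arc = 1 := by
  have h := poisson_const hz 1
  simp only [poisson, mul_one] at h
  rw [integral_complex_ofReal] at h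
  exact_mod_cast h

/-! ### Disk automorphisms on the circle -/

lemma norm_mobius_pt {z : ℂ} (hz : ‖z‖ < 1) (x : 𝕋) : ‖mobius z (pt x)‖ = 1 := by
  have h := one_sub_norm_mobius_sq (one_sub_conj_mul_ne_zero hz (norm_pt x).le)
  rw [norm_pt] at h
  have h2 : ‖mobius z (pt x)‖ ^ 2 = 1 ^ 2 := by
    have : 1 - ‖mobius z (pt x)‖ ^ 2 = 0 := by rw [h]; simp
    linarith
  exact (pow_left_inj₀ (norm_nonneg _) zero_le_one two_ne_zero).1 h2

lemma continuousOn_mobius {z : ℂ} (hz : ‖z‖ < 1) : ContinuousOn (mobius z) (closedBall 0 1) := by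
  refine ContinuousOn.div (by fun_prop) (by fun_prop) fun w hw => ?_
  exact one_sub_conj_mul_ne_zero hz (by simpa using hw)

lemma continuous_mobius_pt {z : ℂ} (hz : ‖z‖ < 1) : Continuous fun x => mobius z (pt x) :=
  (continuousOn_mobius hz).comp_continuous continuous_pt fun x => by simp [norm_pt]

/-- The action of `mobius z` on the circle. -/
noncomputable def circleMobius (z : ℂ) (hz : ‖z‖ < 1) (x : 𝕋) : 𝕋 :=
  (AddCircle.homeomorphCircle (T := 1) one_ne_zero).symm
    ⟨mobius z (pt x), mem_sphere_zero_iff_norm.2 (norm_mobius_pt hz x)⟩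

lemma pt_circleMobius {z : ℂ} (hz : ‖z‖ < 1) (x : 𝕋) :
    pt (circleMobius z hz x) = mobius z (pt x) := by
  rw [pt, ← AddCircle.homeomorphCircle_apply one_ne_zero]
  exact congrArg Subtype.val (Homeomorph.apply_symm_apply _ _)

lemma continuous_circleMobius {z : ℂ} (hz : ‖z‖ < 1) : Continuous (circleMobius z hz) :=
  (Homeomorph.continuous _).comp ((continuous_mobius_pt hz).subtype_mk _)

/-- The mean value property on circles of radius `r < 1`, where the value at the centre is `mobius z
0 ^ n = z ^ n`, followed by dominated convergence as `r → 1`. -/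
lemma integral_mobius_pow {z : ℂ} (hz : ‖z‖ < 1) (n : ℕ) :
    ∫ x, mobius z (pt x) ^ n ∂arc = z ^ n := by
  have hHol : (fun w => mobius z w ^ n) ∈ Hol := by
    refine DifferentiableOn.pow (fun w hw => ?_) n
    rw [mem_ball_zero_iff] at hw
    exact (hasDerivAt_mobius
      (one_sub_conj_mul_ne_zero hz hw.le)).differentiableAt.differentiableWithinAt
  have h1 : ∀ r ∈ Set.Ico (0 : ℝ) 1, ∫ x, mobius z (r * pt x) ^ n ∂arc = z ^ n := by
    intro r hr
    have h := fourierCoeff_dilation hHol hr.1 hr.2 0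
    rw [fourierCoeff] at h
    simpa [extZero, coef_zero, mobius] using h
  have h2 : Tendsto (fun r : ℝ => ∫ x, mobius z (r * pt x) ^ n ∂arc) (𝓝[<] 1)
      (𝓝 (∫ x, mobius z (pt x) ^ n ∂arc)) := by
    refine tendsto_integral_filter_of_dominated_convergence (fun _ => 1) ?_ ?_ (by simp) ?_
    · filter_upwards [Ico_mem_nhdsLT (show (0 : ℝ) < 1 by norm_num)] with r hr
      exact (continuous_dilation hHol hr.1 hr.2).aestronglyMeasurable
    · filter_upwards [Ico_mem_nhdsLT (show (0 : ℝ) < 1 by norm_num)] with r hr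
      refine Eventually.of_forall fun x => ?_
      rw [norm_pow]
      exact pow_le_one₀ (norm_nonneg _)
        (norm_mobius_lt_one hz (by simpa using smul_pt_mem_ball hr.1 hr.2 x)).le
    · refine Eventually.of_forall fun x => ?_
      refine Tendsto.pow ?_ n
      have hc : ContinuousAt (mobius z) (pt x) :=
        (hasDerivAt_mobius (one_sub_conj_mul_ne_zero hz (norm_pt x).le)).continuousAt
      refine hc.tendsto.comp ?_
      have : Continuous fun r : ℝ => (r : ℂ) * pt x := by fun_prop
      simpa using (this.tendsto 1).mono_left nhdsWithin_le_nhds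
  refine tendsto_nhds_unique h2 (tendsto_const_nhds.congr' ?_)
  filter_upwards [Ico_mem_nhdsLT (show (0 : ℝ) < 1 by norm_num)] with r hr
  exact (h1 r hr).symm

lemma integral_fourier_circleMobius {z : ℂ} (hz : ‖z‖ < 1) (n : ℤ) :
    ∫ x, fourier n (circleMobius z hz x) ∂arc = harmonicMonomial z n := by
  cases n with
  | ofNat n =>
    simp_rw [Int.ofNat_eq_natCast, fourier_natCast, pt_circleMobius, harmonicMonomial_natCast]
    exact integral_mobius_pow hz n
  | negSucc n =>
    have : ∀ x, (fourier (Int.negSucc n) (circleMobius z hz x) : ℂ) =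
        conj (mobius z (pt x) ^ (n + 1)) := fun x => by
      rw [Int.negSucc_eq, fourier_neg, ← pt_circleMobius hz, ← fourier_natCast]; rfl
    simp_rw [this]
    rw [integral_conj, integral_mobius_pow hz, map_pow]; rfl

open BoundedContinuousFunction in
lemma measure_ext_of_fourier {P Q : Measure 𝕋} [IsFiniteMeasure P] [IsFiniteMeasure Q]
    (h : ∀ n : ℤ, ∫ x, fourier n x ∂P = ∫ x, fourier n x ∂Q) : P = Q := by
  refine ext_of_forall_mem_subalgebra_integral_eq_of_polish (𝕜 := ℂ)
    (A := (fourierSubalgebra (T := 1)).comap (toContinuousMapStarₐ ℂ)) ?_ ?_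
  · intro x y hxy
    obtain ⟨f, ⟨g, hg, rfl⟩, hne⟩ := fourierSubalgebra_separatesPoints (T := 1) hxy
    refine ⟨g, ⟨g, ⟨mkOfCompact g, ?_, rfl⟩, rfl⟩, hne⟩
    exact hg
  · intro g hg
    have hg' : (g.toContinuousMap : C(𝕋, ℂ)) ∈ Submodule.span ℂ (Set.range (@fourier 1)) := by
      rw [← fourierSubalgebra_coe]; exact hg
    have key : ∀ f ∈ Submodule.span ℂ (Set.range (@fourier 1)), ∫ x, f x ∂P = ∫ x, f x ∂Q := by
      intro f hf
      have hint : ∀ (f : C(𝕋, ℂ)) (m : Measure 𝕋) [IsFiniteMeasure m], Integrable f m :=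
        fun f m _ => (mkOfCompact f).integrable m
      induction hf using Submodule.span_induction with
      | mem f hf => obtain ⟨n, rfl⟩ := hf; exact h n
      | zero => simp
      | add f g _ _ hf hg =>
        simp only [ContinuousMap.add_apply]
        rw [integral_add (hint f P) (hint g P), integral_add (hint f Q) (hint g Q), hf, hg]
      | smul c f _ hf =>
        simp only [ContinuousMap.smul_apply]
        rw [integral_smul, integral_smul, hf]
    exact key _ hg'

/-- Harmonic measure on the circle as seen from `z`. -/
noncomputable def harmonicMeasure (z : ℂ) : Measure 𝕋 :=
  arc.withDensity fun x => ENNReal.ofReal (poissonKernel 0 z (pt x))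

lemma lintegral_poissonKernel {z : ℂ} (hz : ‖z‖ < 1) :
    ∫⁻ x, ENNReal.ofReal (poissonKernel 0 z (pt x)) ∂arc = 1 := by
  rw [← ofReal_integral_eq_lintegral_ofReal, integral_poissonKernel hz, ENNReal.ofReal_one]
  · exact (BoundedContinuousFunction.mkOfCompact ⟨_, continuous_poissonKernel_pt hz⟩).integrable arc
  · exact Eventually.of_forall (poissonKernel_pt_nonneg hz)

lemma integral_harmonicMeasure {z : ℂ} (hz : ‖z‖ < 1) (g : 𝕋 → ℂ) :
    ∫ x, g x ∂harmonicMeasure z = poisson g z := by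
  rw [harmonicMeasure, integral_withDensity_eq_integral_toReal_smul
    (continuous_poissonKernel_pt hz).measurable.ennreal_ofReal (by simp)]
  refine integral_congr_ae (Eventually.of_forall fun x => ?_)
  simp only [ENNReal.toReal_ofReal (poissonKernel_pt_nonneg hz x), Complex.real_smul]

/-- Both measures have the same Fourier coefficients, the harmonic monomials at `z`. This replaces a
change of variables on the circle. -/
lemma map_circleMobius {z : ℂ} (hz : ‖z‖ < 1) :
    Measure.map (circleMobius z hz) arc = harmonicMeasure z := by
  have hm := (continuous_circleMobius hz).measurable
  have : IsFiniteMeasure (harmonicMeasure z) := isFiniteMeasure_withDensity (by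
    rw [lintegral_poissonKernel hz]; exact ENNReal.one_ne_top)
  have : IsFiniteMeasure (Measure.map (circleMobius z hz) arc) :=
    Measure.isFiniteMeasure_map _ _
  refine measure_ext_of_fourier fun n => ?_
  rw [integral_map hm.aemeasurable (map_continuous (fourier n)).aestronglyMeasurable,
    integral_fourier_circleMobius, integral_harmonicMeasure hz, poisson_fourier hz]

lemma quasiMeasurePreserving_circleMobius {z : ℂ} (hz : ‖z‖ < 1) :
    Measure.QuasiMeasurePreserving (circleMobius z hz) arc arc :=
  ⟨(continuous_circleMobius hz).measurable, by
    rw [map_circleMobius hz]; exact withDensity_absolutelyContinuous _ _⟩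

lemma lintegral_comp_circleMobius {z : ℂ} (hz : ‖z‖ < 1) {u : 𝕋 → ℝ≥0∞} (hu : AEMeasurable u arc) :
    ∫⁻ x, u (circleMobius z hz x) ∂arc =
      ∫⁻ x, u x * ENNReal.ofReal (poissonKernel 0 z (pt x)) ∂arc := by
  have hac : harmonicMeasure z ≪ arc := withDensity_absolutelyContinuous _ _
  rw [← lintegral_map' (by rw [map_circleMobius hz]; exact hu.mono_ac hac)
    (continuous_circleMobius hz).measurable.aemeasurable, map_circleMobius hz, harmonicMeasure,
    lintegral_withDensity_eq_lintegral_mul₀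
      (continuous_poissonKernel_pt hz).measurable.ennreal_ofReal.aemeasurable hu]
  simp only [Pi.mul_apply, mul_comm]

lemma integral_comp_circleMobius {z : ℂ} (hz : ‖z‖ < 1) {g : 𝕋 → ℂ}
    (hg : AEStronglyMeasurable g arc) :
    ∫ x, g (circleMobius z hz x) ∂arc = poisson g z := by
  have hac : harmonicMeasure z ≪ arc := withDensity_absolutelyContinuous _ _
  rw [← integral_harmonicMeasure hz, ← map_circleMobius hz,
    integral_map (continuous_circleMobius hz).measurable.aemeasurable
    (by rw [map_circleMobius hz]; exact hg.mono_ac hac)]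

/-- Conformal covariance of the Poisson kernel; it makes Poisson extension commute with disk
automorphisms. -/
lemma poissonKernel_mobius_mul {w z : ℂ} (hw : ‖w‖ < 1) (hz : ‖z‖ < 1) (x : 𝕋) :
    poissonKernel 0 z (mobius w (pt x)) * poissonKernel 0 w (pt x) =
      poissonKernel 0 (mobius w z) (pt x) := by
  have h1 := one_sub_conj_mul_ne_zero hw (norm_pt x).le
  have h2 := one_sub_conj_mul_ne_zero hw hz.le
  have e1 : ‖mobius w (pt x) - z‖ = ‖1 - conj w * z‖ * ‖pt x - mobius w z‖ / ‖1 - conj w * pt x‖ := by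
    have : mobius w (pt x) - z =
        -((1 - conj w * z) * (pt x - mobius w z) / (1 - conj w * pt x)) := by
      rw [mobius, mobius, mul_sub, mul_div_cancel₀ _ h2, eq_neg_iff_add_eq_zero, sub_add_eq_add_sub,
        ← add_div, sub_eq_zero, div_eq_iff h1]
      ring
    rw [this, norm_neg, norm_div, norm_mul]
  have e2 : ‖1 - conj w * pt x‖ = ‖pt x - w‖ := by
    rw [norm_pt_sub, ← Complex.norm_conj]
    simp
  have h3 : ‖1 - conj w * z‖ ≠ 0 := norm_ne_zero_iff.2 h2
  have h4 : ‖pt x - w‖ ≠ 0 := norm_ne_zero_iff.2 (pt_sub_ne_zero hw x)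
  have h5 : ‖pt x - mobius w z‖ ≠ 0 :=
    norm_ne_zero_iff.2 (pt_sub_ne_zero (norm_mobius_lt_one hw hz) x)
  rw [poissonKernel_pt, poissonKernel_pt, poissonKernel_def, sub_zero, sub_zero,
    norm_mobius_pt hw, e1, e2, one_sub_norm_mobius_sq h2]
  field_simp

lemma poisson_comp_circleMobius {w z : ℂ} (hw : ‖w‖ < 1) (hz : ‖z‖ < 1) {g : 𝕋 → ℂ}
    (hg : AEStronglyMeasurable g arc) :
    poisson (fun x => g (circleMobius w hw x)) z = poisson g (mobius w z) := by
  have hinv : ∀ x, mobius w (pt (circleMobius w hw x)) = pt x := fun x => by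
    rw [pt_circleMobius, mobius_mobius hw (norm_pt x).le]
  have hP : Continuous fun x : 𝕋 => (poissonKernel 0 z (mobius w (pt x)) : ℂ) := by
    refine Complex.continuous_ofReal.comp ?_
    have := (continuous_poissonKernel_pt hz).comp (continuous_circleMobius hw)
    simpa only [Function.comp_def, pt_circleMobius] using this
  -- The kernel is precomposed with `mobius w` so that, the map being an involution, it becomes the
  -- plain kernel at `z` after substitution.
  have h := integral_comp_circleMobius hw
    (g := fun x => (poissonKernel 0 z (mobius w (pt x)) : ℂ) * g x)
    (hP.aestronglyMeasurable.mul hg)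
  simp only [hinv] at h
  rw [poisson, h, poisson, poisson]
  refine integral_congr_ae (Eventually.of_forall fun x => ?_)
  simp only
  rw [← poissonKernel_mobius_mul hw hz]
  push_cast
  ring

/-! ### Holomorphic and antiholomorphic parts -/

/-- The Taylor coefficients of the conjugate of the antiholomorphic part of `P(g)`. -/
noncomputable def negCoef (g : 𝕋 → ℂ) : ℕ → ℂ
  | 0 => 0
  | n + 1 => conj (fourierCoeff g (-((n : ℤ) + 1)))

/-- The holomorphic part of the harmonic extension of `g`. -/
noncomputable def holoPart (g : 𝕋 → ℂ) : ℂ → ℂ := powerSeries fun n : ℕ => fourierCoeff g n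

/-- The conjugate of the antiholomorphic part of the harmonic extension of `g`, normalized to vanish
at the origin. -/
noncomputable def antiPart (g : 𝕋 → ℂ) : ℂ → ℂ := powerSeries (negCoef g)

lemma norm_fourierCoeff_le (g : 𝕋 → ℂ) (n : ℤ) : ‖fourierCoeff g n‖ ≤ ∫ x, ‖g x‖ ∂arc := by
  refine (norm_integral_le_integral_norm _).trans_eq ?_
  simp_rw [norm_smul, norm_fourier_apply, one_mul]

lemma norm_negCoef_le (g : 𝕋 → ℂ) (n : ℕ) : ‖negCoef g n‖ ≤ ∫ x, ‖g x‖ ∂arc := by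
  cases n with
  | zero =>
    rw [negCoef, norm_zero]
    exact integral_nonneg fun x => norm_nonneg _
  | succ n =>
    rw [negCoef, Complex.norm_conj]
    exact norm_fourierCoeff_le g _

lemma holoPart_mem_Hol (g : 𝕋 → ℂ) : holoPart g ∈ Hol :=
  powerSeries_mem_Hol fun n => norm_fourierCoeff_le g n

lemma antiPart_mem_Hol (g : 𝕋 → ℂ) : antiPart g ∈ Hol := powerSeries_mem_Hol (norm_negCoef_le g)

lemma coef_holoPart (g : 𝕋 → ℂ) (n : ℕ) : coef (holoPart g) n = fourierCoeff g n :=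
  coef_powerSeries (fun n => norm_fourierCoeff_le g n) n

lemma coef_antiPart (g : 𝕋 → ℂ) (n : ℕ) : coef (antiPart g) n = negCoef g n :=
  coef_powerSeries (norm_negCoef_le g) n

lemma poisson_eq {g : 𝕋 → ℂ} (hg : Integrable g arc) {z : ℂ} (hz : z ∈ ball (0 : ℂ) 1) :
    poisson g z = holoPart g z + conj (antiPart g z) := by
  have h1 : HasSum (fun n : ℕ => harmonicMonomial z n * fourierCoeff g n) (holoPart g z) := by
    refine (hasSum_powerSeries (fun n : ℕ => norm_fourierCoeff_le g n) hz).congr_fun fun n => ?_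
    rw [harmonicMonomial_natCast, mul_comm]
  have h2 : HasSum (fun n : ℕ => harmonicMonomial z (-((n : ℤ) + 1)) *
      fourierCoeff g (-((n : ℤ) + 1))) (conj (antiPart g z)) := by
    have h3 := (hasSum_nat_add_iff' 1).2 (hasSum_powerSeries (norm_negCoef_le g) hz)
    simp only [Finset.range_one, Finset.sum_singleton, negCoef, zero_mul, sub_zero] at h3
    have h4 := h3.star
    refine h4.congr_fun fun n => ?_
    rw [harmonicMonomial_neg_succ]
    simp [mul_comm]
  exact (hasSum_poisson (by simpa using hz) hg).unique (HasSum.of_nat_of_neg_add_one h1 h2)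

lemma fourierCoeff_add_conj {u v : 𝕋 → ℂ} (hu : Integrable u arc) (hv : Integrable v arc) (n : ℤ) :
    fourierCoeff (fun x => u x + conj (v x)) n = fourierCoeff u n + conj (fourierCoeff v (-n)) := by
  have hv' : Integrable (fun x => conj (v x)) arc :=
    hv.norm.mono' (Complex.continuous_conj.comp_aestronglyMeasurable hv.1)
      (Eventually.of_forall fun x => (Complex.norm_conj _).le)
  have h := congrFun (fourierCoeff.add hu hv') n
  refine h.trans ?_
  rw [Pi.add_apply]
  congr 1
  rw [fourierCoeff, fourierCoeff, ← integral_conj]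
  refine integral_congr_ae (Eventually.of_forall fun x => ?_)
  simp only [smul_eq_mul, map_mul, neg_neg]
  rw [fourier_neg]

lemma integrable_of_continuous {u : 𝕋 → ℂ} (hu : Continuous u) : Integrable u arc :=
  (memLp_of_continuous hu 1).integrable le_rfl

lemma fourierCoeff_harmonic_dilation {F G : ℂ → ℂ} (hF : F ∈ Hol) (hG : G ∈ Hol) {r : ℝ}
    (h0 : 0 ≤ r) (h1 : r < 1) (n : ℤ) :
    fourierCoeff (fun x : 𝕋 => F (r * pt x) + conj (G (r * pt x))) n =
      extZero (fun n => coef F n * r ^ n) n + conj (extZero (fun n => coef G n * r ^ n) (-n)) := by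
  rw [fourierCoeff_add_conj (integrable_of_continuous (continuous_dilation hF h0 h1))
    (integrable_of_continuous (continuous_dilation hG h0 h1)), fourierCoeff_dilation hF h0 h1,
    fourierCoeff_dilation hG h0 h1]

lemma extZero_succ (c : ℕ → ℂ) (n : ℕ) : extZero c ((n : ℤ) + 1) = c (n + 1) := rfl

/-- Positive frequencies see only the holomorphic part and negative ones only the conjugate part.
Index 0 is excluded because a constant can be shifted between the two. -/
lemma coef_eq_of_harmonic_eq {F₁ F₂ G₁ G₂ : ℂ → ℂ} (hF₁ : F₁ ∈ Hol) (hF₂ : F₂ ∈ Hol)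
    (hG₁ : G₁ ∈ Hol) (hG₂ : G₂ ∈ Hol)
    (h : ∀ z ∈ ball (0 : ℂ) 1, F₁ z + conj (F₂ z) = G₁ z + conj (G₂ z)) (n : ℕ) :
    coef F₁ (n + 1) = coef G₁ (n + 1) ∧ coef F₂ (n + 1) = coef G₂ (n + 1) := by
  have h0 : (0 : ℝ) ≤ 1 / 2 := by norm_num
  have h1 : (1 / 2 : ℝ) < 1 := by norm_num
  have key : ∀ k : ℤ, _ := fun k => (fourierCoeff_harmonic_dilation hF₁ hF₂ h0 h1 k).symm.trans
    ((congrArg (fourierCoeff · k) (funext fun x => h _ (smul_pt_mem_ball h0 h1 x))).trans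
      (fourierCoeff_harmonic_dilation hG₁ hG₂ h0 h1 k))
  have k1 := key ((n : ℤ) + 1)
  have k2 := key (-((n : ℤ) + 1))
  rw [extZero_neg_succ, extZero_neg_succ, extZero_succ, extZero_succ] at k1
  rw [extZero_neg_succ, extZero_neg_succ, neg_neg, extZero_succ, extZero_succ] at k2
  constructor
  · simpa using k1
  · exact (starRingEnd ℂ).injective (by simpa using k2)

lemma memLp_comp_circleMobius {w : ℂ} (hw : ‖w‖ < 1) {g : 𝕋 → ℂ} (hg : MemLp g 2 arc) :
    MemLp (fun x => g (circleMobius w hw x)) 2 arc := by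
  have hm : AEStronglyMeasurable (fun x => g (circleMobius w hw x)) arc :=
    hg.1.comp_quasiMeasurePreserving (quasiMeasurePreserving_circleMobius hw)
  rw [memLp_two_iff_lintegral hm, lintegral_comp_circleMobius hw (u := fun x => ‖g x‖ₑ ^ 2)
    (hg.1.enorm.pow_const 2)]
  obtain ⟨C, hC⟩ := isCompact_univ.exists_bound_of_continuousOn
    (continuous_poissonKernel_pt hw).continuousOn
  have h1 := (memLp_two_iff_lintegral hg.1).1 hg
  calc _ ≤ ∫⁻ x, ‖g x‖ₑ ^ 2 * ENNReal.ofReal C ∂arc := by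
        refine lintegral_mono fun x => ?_
        gcongr
        exact (le_abs_self _).trans (hC x trivial)
    _ < ∞ := by
        rw [lintegral_mul_const' _ _ ENNReal.ofReal_ne_top]
        finiteness

/-- Composition with an automorphism respects the splitting into holomorphic and antiholomorphic
parts, except for constants: `antiPart g ∘ mobius w` need not vanish at 0. -/
lemma coef_comp_mobius {w : ℂ} (hw : ‖w‖ < 1) {g : 𝕋 → ℂ} (hg : MemLp g 2 arc) (n : ℕ) :
    coef (fun z => holoPart g (mobius w z)) (n + 1) =
        fourierCoeff (fun x => g (circleMobius w hw x)) ((n : ℤ) + 1) ∧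
      coef (fun z => antiPart g (mobius w z)) (n + 1) =
        conj (fourierCoeff (fun x => g (circleMobius w hw x)) (-((n : ℤ) + 1))) := by
  have hG := memLp_comp_circleMobius hw hg
  have h := coef_eq_of_harmonic_eq (comp_mobius_mem_Hol (holoPart_mem_Hol g) hw)
    (comp_mobius_mem_Hol (antiPart_mem_Hol g) hw)
    (holoPart_mem_Hol fun x => g (circleMobius w hw x))
    (antiPart_mem_Hol fun x => g (circleMobius w hw x)) (fun z hz => ?_) n
  · rw [coef_holoPart, coef_antiPart] at h
    exact h
  · rw [← poisson_eq (hG.integrable one_le_two) hz,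
      poisson_comp_circleMobius hw (by simpa using hz) hg.1,
      poisson_eq (hg.integrable one_le_two)]
    simpa using norm_mobius_lt_one hw (by simpa using hz)

/-! ### Local Dirichlet integrals in the disk -/

/-- The weighted quadratic deviation of `g` from `a`. -/
noncomputable def deviation (g : 𝕋 → ℂ) (a ζ : ℂ) : ℝ≥0∞ :=
  ∫⁻ x, ‖(g x - a) / (pt x - ζ)‖ₑ ^ 2 ∂arc

/-- The energy density of the harmonic extension of `g`. -/
noncomputable def energyDensity (g : 𝕋 → ℂ) (z : ℂ) : ℝ≥0∞ :=
  ‖deriv (holoPart g) z‖ₑ ^ 2 + ‖deriv (antiPart g) z‖ₑ ^ 2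

/-- The energy of the harmonic extension of `g` with respect to the weight `szegoKernel ζ`. -/
noncomputable def localEnergy (g : 𝕋 → ℂ) (ζ : ℂ) : ℝ≥0∞ :=
  ∫⁻ z, energyDensity g z * szegoKernel ζ z ∂areaMeasure

lemma measurable_energyDensity (g : 𝕋 → ℂ) : Measurable (energyDensity g) :=
  ((measurable_deriv _).enorm.pow_const 2).add ((measurable_deriv _).enorm.pow_const 2)

lemma measurable_szegoKernel_right (w : ℂ) : Measurable (szegoKernel w) :=
  Measurable.of_uncurry_left (f := szegoKernel) measurable_szegoKernel

lemma measurable_localEnergy (g : 𝕋 → ℂ) : Measurable (localEnergy g) :=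
  Measurable.lintegral_prod_right' (f := fun p : ℂ × ℂ => energyDensity g p.2 * szegoKernel p.1 p.2)
    (((measurable_energyDensity g).comp measurable_snd).mul measurable_szegoKernel)

lemma deriv_comp_mobius {f : ℂ → ℂ} (hf : f ∈ Hol) {w z : ℂ} (hw : ‖w‖ < 1) (hz : ‖z‖ < 1) :
    deriv (fun z => f (mobius w z)) z = deriv f (mobius w z) * mobiusDeriv w z :=
  ((differentiableAt_of_mem_Hol hf (by simpa using norm_mobius_lt_one hw hz)).hasDerivAt.comp z
    (hasDerivAt_mobius (one_sub_conj_mul_ne_zero hw hz.le))).deriv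

lemma mul_lintegral_deriv_szego {f : ℂ → ℂ} (hf : f ∈ Hol) {w : ℂ} (hw : ‖w‖ < 1) :
    ENNReal.ofReal (1 - ‖w‖ ^ 2) * ∫⁻ z, ‖deriv f z‖ₑ ^ 2 * szegoKernel w z ∂areaMeasure =
      ∑' n : ℕ, ‖coef (fun z => f (mobius w z)) (n + 1)‖ₑ ^ 2 *
        ENNReal.ofReal ((n + 1) / (n + 2)) := by
  rw [← lintegral_deriv_sq (comp_mobius_mem_Hol hf hw), ← lintegral_comp_mobius_mul_one_sub hw]
  refine lintegral_congr_ae ?_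
  filter_upwards [ae_mem_ball] with z hz
  rw [deriv_comp_mobius hf hw (by simpa using hz)]

lemma mul_localEnergy {w : ℂ} (hw : ‖w‖ < 1) {g : 𝕋 → ℂ} (hg : MemLp g 2 arc) :
    ENNReal.ofReal (1 - ‖w‖ ^ 2) * localEnergy g w =
      ∑' n : ℕ, (‖fourierCoeff (fun x => g (circleMobius w hw x)) ((n : ℤ) + 1)‖ₑ ^ 2 +
        ‖fourierCoeff (fun x => g (circleMobius w hw x)) (-((n : ℤ) + 1))‖ₑ ^ 2) *
        ENNReal.ofReal ((n + 1) / (n + 2)) := by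
  have hc : ∀ a : ℂ, ‖conj a‖ₑ = ‖a‖ₑ := fun a => by
    rw [← ofReal_norm, Complex.norm_conj, ofReal_norm]
  simp_rw [localEnergy, energyDensity, add_mul]
  rw [lintegral_add_left, mul_add, mul_lintegral_deriv_szego (holoPart_mem_Hol g) hw,
    mul_lintegral_deriv_szego (antiPart_mem_Hol g) hw, ← ENNReal.tsum_add]
  · simp_rw [(coef_comp_mobius hw hg _).1, (coef_comp_mobius hw hg _).2, hc]
  · exact ((measurable_deriv _).enorm.pow_const 2).mul (measurable_szegoKernel_right w)

/-- The density `(1 - |w|²)/|pt x - w|²` is the Poisson kernel, so the left side is the squared `L²`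
norm of `g ∘ ψ_w - a`, and Parseval applies. The zeroth coefficient contributes the first term.
Compared with `mul_localEnergy`, the remaining series differs only by the weights `(n+1)/(n+2)`. -/
lemma mul_deviation {w : ℂ} (hw : ‖w‖ < 1) {g : 𝕋 → ℂ} (hg : MemLp g 2 arc) (a : ℂ) :
    ENNReal.ofReal (1 - ‖w‖ ^ 2) * deviation g a w = ‖poisson g w - a‖ₑ ^ 2 +
      ∑' n : ℕ, (‖fourierCoeff (fun x => g (circleMobius w hw x)) ((n : ℤ) + 1)‖ₑ ^ 2 +
        ‖fourierCoeff (fun x => g (circleMobius w hw x)) (-((n : ℤ) + 1))‖ₑ ^ 2) := by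
  have hG := memLp_comp_circleMobius hw hg
  have hGi := hG.integrable one_le_two
  have h1 : ENNReal.ofReal (1 - ‖w‖ ^ 2) * deviation g a w =
      ∫⁻ x, ‖g (circleMobius w hw x) - a‖ₑ ^ 2 ∂arc := by
    rw [lintegral_comp_circleMobius hw (u := fun x => ‖g x - a‖ₑ ^ 2)
      ((hg.1.sub aestronglyMeasurable_const).enorm.pow_const 2), deviation,
      ← lintegral_const_mul' _ _ ENNReal.ofReal_ne_top]
    refine lintegral_congr fun x => ?_
    have hne : 0 < ‖pt x - w‖ := norm_pos_iff.2 (pt_sub_ne_zero hw x)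
    rw [poissonKernel_pt, ENNReal.ofReal_div_of_pos (by positivity), ← ofReal_norm, norm_div,
      ENNReal.ofReal_div_of_pos hne, ENNReal.ofReal_pow hne.le, ← ofReal_norm, div_eq_mul_inv,
      div_eq_mul_inv, mul_pow, ← ENNReal.inv_pow]
    ring
  have hcoef : ∀ n : ℤ, fourierCoeff (fun x => g (circleMobius w hw x) - a) n =
      fourierCoeff (fun x => g (circleMobius w hw x)) n - if n = 0 then a else 0 := by
    intro n
    have h2 := fourierCoeff_add_conj hGi (integrable_const (-conj a)) n
    have h3 : fourierCoeff (fun _ : 𝕋 => -conj a) (-n) = if n = 0 then -conj a else 0 := by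
      have h4 := congrFun (fourierCoeff_fourier (T := 1) 0) (-n)
      have h5 := fourierCoeff.const_mul (T := 1) (fourier 0) (-conj a) (-n)
      simp only [fourier_zero, mul_one] at h5
      rw [h5, h4]
      by_cases hn : n = 0
      · simp [hn]
      · simp [hn]
    rw [h3] at h2
    simp only [map_neg, Complex.conj_conj, ← sub_eq_add_neg] at h2
    rw [h2]
    split_ifs <;> simp [sub_eq_add_neg]
  have hsub : MemLp (fun x => g (circleMobius w hw x) - a) 2 arc := hG.sub (memLp_const a)
  rw [h1, lintegral_sq_eq_tsum_fourierCoeff hsub,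
    tsum_of_nat_of_neg_add_one ENNReal.summable ENNReal.summable,
    tsum_eq_zero_add' ENNReal.summable, add_assoc, ← ENNReal.tsum_add]
  simp_rw [hcoef]
  congr 1
  · have : fourierCoeff (fun x => g (circleMobius w hw x)) 0 = poisson g w := by
      rw [fourierCoeff, ← integral_comp_circleMobius hw hg.1]
      simp
    simp [this]
  · refine tsum_congr fun n => ?_
    have e1 : ((n + 1 : ℕ) : ℤ) ≠ 0 := by positivity
    have e2 : -((n : ℤ) + 1) ≠ 0 := by omega
    rw [if_neg e1, if_neg e2, sub_zero, sub_zero]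
    rfl

lemma deviation_poisson_le {w : ℂ} (hw : ‖w‖ < 1) {g : 𝕋 → ℂ} (hg : MemLp g 2 arc) (a : ℂ) :
    deviation g (poisson g w) w ≤ deviation g a w := by
  rw [← ENNReal.mul_le_mul_iff_right (ofReal_one_sub_norm_sq_ne_zero hw) ENNReal.ofReal_ne_top,
    mul_deviation hw hg, mul_deviation hw hg]
  simp

lemma localEnergy_le_deviation {w : ℂ} (hw : ‖w‖ < 1) {g : 𝕋 → ℂ} (hg : MemLp g 2 arc) (a : ℂ) :
    localEnergy g w ≤ deviation g a w := by
  rw [← ENNReal.mul_le_mul_iff_right (ofReal_one_sub_norm_sq_ne_zero hw) ENNReal.ofReal_ne_top,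
    mul_deviation hw hg, mul_localEnergy hw hg]
  refine le_add_left (ENNReal.tsum_le_tsum fun n => mul_le_of_le_one_right' ?_)
  rw [ENNReal.ofReal_le_one, div_le_one (by positivity)]
  linarith

lemma deviation_poisson_le_localEnergy {w : ℂ} (hw : ‖w‖ < 1) {g : 𝕋 → ℂ} (hg : MemLp g 2 arc) :
    deviation g (poisson g w) w ≤ 2 * localEnergy g w := by
  rw [← ENNReal.mul_le_mul_iff_right (ofReal_one_sub_norm_sq_ne_zero hw) ENNReal.ofReal_ne_top,
    mul_deviation hw hg, mul_left_comm, mul_localEnergy hw hg, ← ENNReal.tsum_mul_left]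
  simp only [sub_self, enorm_zero, ne_eq, OfNat.ofNat_ne_zero, not_false_eq_true, zero_pow, zero_add]
  refine ENNReal.tsum_le_tsum fun n => ?_
  rw [mul_left_comm]
  refine le_mul_of_one_le_right' ?_
  rw [← ENNReal.ofReal_ofNat 2, ← ENNReal.ofReal_mul zero_le_two, ENNReal.one_le_ofReal,
    ← mul_div_assoc, le_div_iff₀ (by positivity)]
  linarith [(n.cast_nonneg : (0 : ℝ) ≤ n)]

/-! ### Local Dirichlet integrals on the circle -/

/-- Moving from `u` to `r u` costs at most `1 - r`, which is itself at most `|1 - r u|`. Squared,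
this is the origin of the factors 4 in the radial comparisons. -/
lemma norm_one_sub_le {u : ℂ} (hu : ‖u‖ ≤ 1) {r : ℝ} (h0 : 0 ≤ r) (h1 : r ≤ 1) :
    ‖1 - u‖ ≤ 2 * ‖1 - r * u‖ := by
  have e : 1 - u = (1 - r * u) + ((r - 1 : ℝ) : ℂ) * u := by push_cast; ring
  have h2 : ‖((r - 1 : ℝ) : ℂ) * u‖ ≤ 1 - r := by
    rw [norm_mul, Complex.norm_real, Real.norm_eq_abs, abs_sub_comm, abs_of_nonneg (by linarith)]
    nlinarith [norm_nonneg u]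
  have h3 : 1 - r ≤ ‖1 - r * u‖ := by
    have := norm_sub_norm_le (1 : ℂ) (r * u)
    rw [norm_one, norm_mul, Complex.norm_real, Real.norm_of_nonneg h0] at this
    nlinarith [norm_nonneg u]
  have h4 : ‖1 - u‖ ≤ ‖1 - r * u‖ + ‖((r - 1 : ℝ) : ℂ) * u‖ := by
    conv_lhs => rw [e]
    exact norm_add_le _ _
  linarith

lemma szegoKernel_smul_le {ζ z : ℂ} (hζ : ‖ζ‖ ≤ 1) (hz : ‖z‖ < 1) {r : ℝ} (h0 : 0 ≤ r)
    (h1 : r ≤ 1) : szegoKernel (r * ζ) z ≤ 4 * szegoKernel ζ z := by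
  have hu : ‖conj ζ * z‖ ≤ 1 := by
    rw [norm_mul, Complex.norm_conj]
    nlinarith [norm_nonneg ζ, norm_nonneg z]
  have hne : 0 < ‖1 - conj ζ * z‖ := norm_pos_iff.2 (one_sub_conj_mul_ne_zero' hζ hz)
  have h2 := norm_one_sub_le hu h0 h1
  have e : 1 - conj ((r : ℂ) * ζ) * z = 1 - r * (conj ζ * z) := by simp [mul_assoc]
  rw [szegoKernel, szegoKernel, ← ENNReal.ofReal_ofNat 4, ← ENNReal.ofReal_mul (by norm_num), e]
  refine ENNReal.ofReal_le_ofReal ?_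
  have h3 := one_sub_norm_sq_pos hz
  have h4 : 0 < ‖1 - r * (conj ζ * z)‖ := by linarith
  rw [← mul_div_assoc, div_le_div_iff₀ (by positivity) (by positivity)]
  have : ‖1 - conj ζ * z‖ ^ 2 ≤ (2 * ‖1 - r * (conj ζ * z)‖) ^ 2 := by gcongr
  nlinarith

lemma norm_pt_sub_le {ζ : ℂ} (hζ : ‖ζ‖ ≤ 1) (x : 𝕋) {r : ℝ} (h0 : 0 ≤ r) (h1 : r ≤ 1) :
    ‖pt x - ζ‖ ≤ 2 * ‖pt x - r * ζ‖ := by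
  rw [norm_pt_sub, norm_pt_sub, mul_assoc]
  exact norm_one_sub_le (by rwa [norm_mul, Complex.norm_conj, norm_pt, mul_one]) h0 h1

lemma injective_pt : Function.Injective pt :=
  Subtype.val_injective.comp (AddCircle.injective_toCircle one_ne_zero)

lemma arc_singleton (x : 𝕋) : arc {x} = 0 := by
  refine le_antisymm (le_of_forall_gt_imp_ge_of_dense fun ε hε => ?_) zero_le
  obtain ⟨δ, hδ, hδε⟩ := ENNReal.lt_iff_exists_nnreal_btwn.1 hε
  have h := AddCircle.volume_closedBall (T := 1) (x := x) (δ / 2 : ℝ)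
  rw [← arc_eq_volume] at h
  calc arc {x} ≤ arc (closedBall x (δ / 2 : ℝ)) :=
        measure_mono (Set.singleton_subset_iff.2 (mem_closedBall_self (by positivity)))
    _ ≤ ENNReal.ofReal δ := by
        rw [h]
        exact ENNReal.ofReal_le_ofReal ((min_le_right _ _).trans (by linarith))
    _ ≤ ε := by rw [ENNReal.ofReal_coe_nnreal]; exact hδε.le

lemma ae_pt_ne (ζ : ℂ) : ∀ᵐ x ∂arc, pt x ≠ ζ := by
  by_cases h : ∃ y, pt y = ζ
  · obtain ⟨y, rfl⟩ := h
    filter_upwards [compl_mem_ae_iff.2 (arc_singleton y)] with x hx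
    exact fun h => hx (injective_pt h)
  · exact Eventually.of_forall fun x hx => h ⟨x, hx⟩

lemma deviation_smul_le {g : 𝕋 → ℂ} {a ζ : ℂ} (hζ : ‖ζ‖ ≤ 1) {r : ℝ} (h0 : 0 ≤ r) (h1 : r ≤ 1) :
    deviation g a (r * ζ) ≤ 4 * deviation g a ζ := by
  rw [deviation, deviation, ← lintegral_const_mul' _ _ ENNReal.ofNat_ne_top]
  refine lintegral_mono_ae ?_
  -- At `pt x = ζ` the quotient on the right takes the default value 0 and the pointwise bound could
  -- fail.
  filter_upwards [ae_pt_ne ζ] with x hx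
  have h2 : 0 < ‖pt x - ζ‖ := norm_pos_iff.2 (sub_ne_zero.2 hx)
  have h3 := norm_pt_sub_le hζ x h0 h1
  have h4 : 0 < ‖pt x - r * ζ‖ := by linarith
  rw [← ofReal_norm, ← ofReal_norm, ← ENNReal.ofReal_pow (norm_nonneg _),
    ← ENNReal.ofReal_pow (norm_nonneg _), ← ENNReal.ofReal_ofNat 4,
    ← ENNReal.ofReal_mul (by norm_num), norm_div, norm_div, div_pow, div_pow]
  refine ENNReal.ofReal_le_ofReal ?_
  rw [← mul_div_assoc, div_le_div_iff₀ (by positivity) (by positivity)]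
  have : ‖pt x - ζ‖ ^ 2 ≤ (2 * ‖pt x - r * ζ‖) ^ 2 := by gcongr
  nlinarith [sq_nonneg ‖g x - a‖]

lemma localEnergy_smul_le (g : 𝕋 → ℂ) {ζ : ℂ} (hζ : ‖ζ‖ ≤ 1) {r : ℝ} (h0 : 0 ≤ r) (h1 : r ≤ 1) :
    localEnergy g (r * ζ) ≤ 4 * localEnergy g ζ := by
  rw [localEnergy, localEnergy, ← lintegral_const_mul' _ _ ENNReal.ofNat_ne_top]
  refine lintegral_mono_ae ?_
  filter_upwards [ae_mem_ball] with z hz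
  rw [mul_left_comm]
  gcongr
  exact szegoKernel_smul_le hζ (by simpa using hz) h0 h1

/-- A sequence of radii increasing to `1`. -/
noncomputable def radius (k : ℕ) : ℝ := k / (k + 1)

lemma radius_nonneg (k : ℕ) : 0 ≤ radius k := by unfold radius; positivity

lemma radius_lt_one (k : ℕ) : radius k < 1 := by
  rw [radius, div_lt_one (by positivity)]; linarith

lemma tendsto_radius : Tendsto radius atTop (𝓝 1) := tendsto_natCast_div_add_atTop (1 : ℝ)

lemma tendsto_radius_mul (ζ : ℂ) : Tendsto (fun k => (radius k : ℂ) * ζ) atTop (𝓝 ζ) := by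
  have : Continuous fun r : ℝ => (r : ℂ) * ζ := by fun_prop
  simpa [Function.comp_def] using (this.tendsto 1).comp tendsto_radius

lemma norm_radius_mul_lt_one {ζ : ℂ} (hζ : ‖ζ‖ ≤ 1) (k : ℕ) : ‖(radius k : ℂ) * ζ‖ < 1 := by
  rw [norm_mul, Complex.norm_real, Real.norm_of_nonneg (radius_nonneg k)]
  nlinarith [radius_nonneg k, radius_lt_one k, norm_nonneg ζ]

lemma energyDensity_ne_top (g : 𝕋 → ℂ) (z : ℂ) : energyDensity g z ≠ ∞ := by
  unfold energyDensity; finiteness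

/-- The interior inequality at the points `radius k * ζ`, with Fatou's lemma on the left and the
radial comparison of deviations on the right. -/
lemma localEnergy_le {g : 𝕋 → ℂ} (hg : MemLp g 2 arc) {ζ : ℂ} (hζ : ‖ζ‖ ≤ 1) (a : ℂ) :
    localEnergy g ζ ≤ 4 * deviation g a ζ := by
  have hlim : ∀ z ∈ ball (0 : ℂ) 1, Tendsto (fun k => energyDensity g z *
      szegoKernel (radius k * ζ) z) atTop (𝓝 (energyDensity g z * szegoKernel ζ z)) := by
    intro z hz
    refine ENNReal.Tendsto.const_mul ?_ (Or.inr (energyDensity_ne_top g z))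
    refine (ENNReal.continuous_ofReal.tendsto _).comp (Tendsto.div tendsto_const_nhds ?_ ?_)
    · have : Continuous fun w : ℂ => ‖1 - conj w * z‖ ^ 2 := by fun_prop
      exact (this.tendsto ζ).comp (tendsto_radius_mul ζ)
    · exact pow_ne_zero 2 (norm_ne_zero_iff.2 (one_sub_conj_mul_ne_zero' hζ (by simpa using hz)))
  calc localEnergy g ζ = ∫⁻ z, liminf (fun k => energyDensity g z *
        szegoKernel (radius k * ζ) z) atTop ∂areaMeasure := by
        refine lintegral_congr_ae ?_
        filter_upwards [ae_mem_ball] with z hz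
        exact (hlim z hz).liminf_eq.symm
    _ ≤ liminf (fun k => localEnergy g (radius k * ζ)) atTop :=
        lintegral_liminf_le fun k =>
          (measurable_energyDensity g).mul (measurable_szegoKernel_right _)
    _ ≤ liminf (fun _ : ℕ => 4 * deviation g a ζ) atTop := by
        refine liminf_le_liminf (Eventually.of_forall fun k => ?_)
        exact (localEnergy_le_deviation (norm_radius_mul_lt_one hζ k) hg a).trans
          (deviation_smul_le hζ (radius_nonneg k) (radius_lt_one k).le)
    _ = _ := by simp

/-- Supplies compactness: constants with bounded deviation are bounded. The 8 is twice the square of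
the bound `|pt x - ζ| ≤ 2`. -/
lemma enorm_sq_le_of_deviation {g : 𝕋 → ℂ} (hg : MemLp g 2 arc) {a ζ : ℂ} (hζ : ‖ζ‖ < 1) :
    ‖a‖ₑ ^ 2 ≤ 2 * (∫⁻ x, ‖g x‖ₑ ^ 2 ∂arc) + 8 * deviation g a ζ := by
  have h1 : ∀ x, ‖g x - a‖ₑ ^ 2 ≤ 4 * ‖(g x - a) / (pt x - ζ)‖ₑ ^ 2 := by
    intro x
    have h2 : ‖pt x - ζ‖ₑ ≤ 2 := by
      rw [← ofReal_norm, ← ENNReal.ofReal_ofNat 2]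
      refine ENNReal.ofReal_le_ofReal ((norm_sub_le _ _).trans ?_)
      rw [norm_pt]; linarith
    calc ‖g x - a‖ₑ ^ 2 = ‖pt x - ζ‖ₑ ^ 2 * ‖(g x - a) / (pt x - ζ)‖ₑ ^ 2 := by
          rw [← mul_pow, ← enorm_mul, mul_div_cancel₀ _ (pt_sub_ne_zero hζ x)]
      _ ≤ 2 ^ 2 * ‖(g x - a) / (pt x - ζ)‖ₑ ^ 2 := by gcongr
      _ = _ := by norm_num
  calc ‖a‖ₑ ^ 2 = ∫⁻ _ : 𝕋, ‖a‖ₑ ^ 2 ∂arc := by simp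
    _ ≤ ∫⁻ x, 2 * ‖g x‖ₑ ^ 2 + 8 * ‖(g x - a) / (pt x - ζ)‖ₑ ^ 2 ∂arc := by
        refine lintegral_mono fun x => ?_
        calc ‖a‖ₑ ^ 2 = ‖g x - (g x - a)‖ₑ ^ 2 := by rw [sub_sub_cancel]
          _ ≤ 2 * ‖g x‖ₑ ^ 2 + 2 * (4 * ‖(g x - a) / (pt x - ζ)‖ₑ ^ 2) :=
              (enorm_sub_sq_le _ _).trans (by gcongr; exact h1 x)
          _ = _ := by rw [← mul_assoc]; norm_num
    _ = _ := by
        rw [lintegral_add_left' ((hg.1.enorm.pow_const 2).const_mul _),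
          lintegral_const_mul' _ _ ENNReal.ofNat_ne_top,
          lintegral_const_mul' _ _ ENNReal.ofNat_ne_top, deviation]

/-- The values `P(g)` along the radius to `ζ` have uniformly bounded deviations, hence stay bounded;
a limit point `b` works by Fatou's lemma. The constant is 2 from the interior comparison times 4
from the radial one. Circle points and interior points are treated alike. -/
lemma exists_deviation_le {g : 𝕋 → ℂ} (hg : MemLp g 2 arc) {ζ : ℂ} (hζ : ‖ζ‖ ≤ 1) :
    ∃ a, deviation g a ζ ≤ 8 * localEnergy g ζ := by
  by_cases htop : localEnergy g ζ = ∞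
  · exact ⟨0, by simp [htop]⟩
  have hζk := norm_radius_mul_lt_one hζ
  set a : ℕ → ℂ := fun k => poisson g (radius k * ζ)
  have h1 : ∀ k, deviation g (a k) (radius k * ζ) ≤ 8 * localEnergy g ζ := fun k => by
    refine (deviation_poisson_le_localEnergy (hζk k) hg).trans ?_
    calc _ ≤ 2 * (4 * localEnergy g ζ) := by
          gcongr
          exact localEnergy_smul_le g hζ (radius_nonneg k) (radius_lt_one k).le
      _ = _ := by rw [← mul_assoc]; norm_num
  obtain ⟨C, hC⟩ : ∃ C : ℝ≥0, 2 * (∫⁻ x, ‖g x‖ₑ ^ 2 ∂arc) + 8 * (8 * localEnergy g ζ) = C := by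
    have := (memLp_two_iff_lintegral hg.1).1 hg
    exact ⟨_, (ENNReal.coe_toNNReal (by finiteness)).symm⟩
  have h2 : ∀ k, ‖a k‖ ^ 2 ≤ C := fun k => by
    have h3 := (enorm_sq_le_of_deviation (a := a k) hg (hζk k)).trans
      (add_le_add le_rfl (mul_le_mul_right (h1 k) 8))
    rw [hC, enorm_eq_nnnorm] at h3
    have h4 : ‖a k‖₊ ^ 2 ≤ C := by exact_mod_cast h3
    exact_mod_cast h4
  obtain ⟨b, -, φ, hφ, hb⟩ := tendsto_subseq_of_bounded (isBounded_closedBall (x := (0 : ℂ))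
    (r := Real.sqrt C)) (x := a) fun k => by
      rw [mem_closedBall_zero_iff]
      exact Real.le_sqrt_of_sq_le (h2 k)
  refine ⟨b, ?_⟩
  have hlim : ∀ x, ‖(g x - b) / (pt x - ζ)‖ₑ ^ 2 ≤ liminf (fun k =>
      ‖(g x - a (φ k)) / (pt x - radius (φ k) * ζ)‖ₑ ^ 2) atTop := by
    intro x
    -- Here the left side is 0, by division by zero.
    by_cases hx : pt x = ζ
    · simp [hx]
    · refine le_of_eq (Tendsto.liminf_eq ?_).symm
      refine ((ENNReal.continuous_pow 2).tendsto _).comp ((continuous_enorm.tendsto _).comp ?_)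
      exact (tendsto_const_nhds.sub hb).div
        (tendsto_const_nhds.sub ((tendsto_radius_mul ζ).comp hφ.tendsto_atTop)) (sub_ne_zero.2 hx)
  calc deviation g b ζ ≤ ∫⁻ x, liminf (fun k =>
        ‖(g x - a (φ k)) / (pt x - radius (φ k) * ζ)‖ₑ ^ 2) atTop ∂arc := lintegral_mono hlim
    _ ≤ liminf (fun k => deviation g (a (φ k)) (radius (φ k) * ζ)) atTop := by
        refine lintegral_liminf_le' fun k => AEMeasurable.pow_const ?_ 2
        refine (AEStronglyMeasurable.enorm ?_)
        exact ((hg.1.aemeasurable.sub aemeasurable_const).div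
          (continuous_pt.measurable.sub measurable_const).aemeasurable).aestronglyMeasurable
    _ ≤ liminf (fun _ : ℕ => 8 * localEnergy g ζ) atTop :=
        liminf_le_liminf (Eventually.of_forall fun k => h1 (φ k))
    _ = _ := by simp

/-! ### Nontangential limits -/

lemma tendsto_poissonKernel {ζ : ℂ} (hζ : ‖ζ‖ = 1) {x : 𝕋} (hx : pt x ≠ ζ) :
    Tendsto (fun z => poissonKernel 0 z (pt x)) (𝓝 ζ) (𝓝 0) := by
  simp_rw [poissonKernel_pt]
  have h : ContinuousAt (fun z => (1 - ‖z‖ ^ 2) / ‖pt x - z‖ ^ 2) ζ := by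
    refine ContinuousAt.div (by fun_prop) (by fun_prop) ?_
    exact pow_ne_zero 2 (norm_ne_zero_iff.2 (sub_ne_zero.2 hx))
  simpa [ContinuousAt, hζ] using h

/-- In a Stolz region `|pt x - ζ| ≤ (1 + κ)|pt x - z|`, which cancels one power in the denominator,
and `1 - |z|² ≤ 2 |pt x - z|` cancels the other. -/
lemma poissonKernel_mul_le {ζ z : ℂ} {κ : ℝ} (hκ : 1 < κ) (hz : ‖z‖ < 1)
    (h : ‖z - ζ‖ < κ * (1 - ‖z‖)) (x : 𝕋) :
    poissonKernel 0 z (pt x) * ‖pt x - ζ‖ ≤ 2 + 2 * κ := by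
  have hp : 0 < ‖pt x - z‖ := norm_pos_iff.2 (pt_sub_ne_zero hz x)
  have h1 : 1 - ‖z‖ ≤ ‖pt x - z‖ := by
    have := norm_sub_norm_le (pt x) z
    rwa [norm_pt] at this
  have h2 : ‖pt x - ζ‖ ≤ ‖pt x - z‖ + ‖z - ζ‖ := by
    simpa using norm_add_le (pt x - z) (z - ζ)
  have h3 : ‖pt x - ζ‖ ≤ (1 + κ) * ‖pt x - z‖ := by nlinarith
  have h4 := norm_nonneg z
  have h5 : 1 - ‖z‖ ^ 2 ≤ 2 * ‖pt x - z‖ := by nlinarith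
  rw [poissonKernel_pt, div_mul_eq_mul_div, div_le_iff₀ (by positivity)]
  have h6 := mul_le_mul h5 h3 (norm_nonneg _) (by positivity)
  nlinarith

/-- Write `P(g)(z) - a` as the Poisson integral of `g - a`. The integrand is dominated in a Stolz
region by a multiple of the integrable quotient `|g - a|/|pt x - ζ|`, and it tends to 0 away from
`ζ`. -/
lemma hasNTLimit_of_deviation_lt_top {g : 𝕋 → ℂ} (hg : MemLp g 2 arc) {a ζ : ℂ} (hζ : ‖ζ‖ = 1)
    (h : deviation g a ζ < ∞) : HasNTLimit (poisson g) ζ a := by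
  intro κ hκ
  have hgi := hg.integrable one_le_two
  have hgm : AEStronglyMeasurable (fun x => (g x - a) / (pt x - ζ)) arc :=
    ((hg.1.aemeasurable.sub aemeasurable_const).div
      (continuous_pt.measurable.sub measurable_const).aemeasurable).aestronglyMeasurable
  have hint : Integrable (fun x => (g x - a) / (pt x - ζ)) arc :=
    ((memLp_two_iff_lintegral hgm).2 h).integrable one_le_two
  have key : Tendsto (fun z => ∫ x, (poissonKernel 0 z (pt x) : ℂ) * (g x - a) ∂arc)
      (𝓝[{z | ‖z‖ < 1 ∧ ‖z - ζ‖ < κ * (1 - ‖z‖)}] ζ) (𝓝 (∫ _ : 𝕋, (0 : ℂ) ∂arc)) := by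
    refine tendsto_integral_filter_of_dominated_convergence
      (fun x => (2 + 2 * κ) * ‖(g x - a) / (pt x - ζ)‖) ?_ ?_ (hint.norm.const_mul _) ?_
    · filter_upwards [self_mem_nhdsWithin] with z hz
      exact (integrable_poissonKernel_mul hz.1 (hgi.sub (integrable_const a))).1
    · filter_upwards [self_mem_nhdsWithin] with z hz
      filter_upwards [ae_pt_ne ζ] with x hx
      have hx' : ‖pt x - ζ‖ ≠ 0 := norm_ne_zero_iff.2 (sub_ne_zero.2 hx)
      calc ‖(poissonKernel 0 z (pt x) : ℂ) * (g x - a)‖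
          = poissonKernel 0 z (pt x) * ‖pt x - ζ‖ * ‖(g x - a) / (pt x - ζ)‖ := by
            rw [norm_mul, Complex.norm_real, Real.norm_of_nonneg (poissonKernel_pt_nonneg hz.1 x),
              norm_div, mul_assoc, mul_div_cancel₀ _ hx']
        _ ≤ _ := by
            gcongr
            exact poissonKernel_mul_le hκ hz.1 hz.2 x
    · filter_upwards [ae_pt_ne ζ] with x hx
      have h1 := ((Complex.continuous_ofReal.tendsto 0).comp
        (tendsto_poissonKernel hζ hx)).mul_const (g x - a)
      simp only [Complex.ofReal_zero, zero_mul] at h1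
      exact h1.mono_left nhdsWithin_le_nhds
  simp only [integral_zero] at key
  refine (tendsto_sub_nhds_zero_iff).1 (key.congr' ?_)
  filter_upwards [self_mem_nhdsWithin] with z hz
  simp_rw [mul_sub]
  rw [integral_sub (integrable_poissonKernel_mul hz.1 hgi)
    (integrable_poissonKernel_mul hz.1 (integrable_const a))]
  exact congrArg (poisson g z - ·) (poisson_const hz.1 a)

/-- Allows any constant as a competitor: inside, the Poisson value is the minimizer; on the circle,
a finite deviation identifies `a` as the nontangential limit. -/
lemma localDirichlet_le_deviation {g : 𝕋 → ℂ} (hg : MemLp g 2 arc) {ζ : ℂ} (hζ : ‖ζ‖ ≤ 1) (a : ℂ) :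
    localDirichlet g ζ ≤ deviation g a ζ := by
  rcases hζ.lt_or_eq with h | h
  · exact (iInf₂_le (poisson g ζ) (Or.inl ⟨h, rfl⟩)).trans (deviation_poisson_le h hg a)
  · rcases (le_top (a := deviation g a ζ)).lt_or_eq with h1 | h1
    · exact iInf₂_le a (Or.inr ⟨h, hasNTLimit_of_deviation_lt_top hg h h1⟩)
    · rw [h1]; exact le_top

lemma localDirichlet_le {g : 𝕋 → ℂ} (hg : MemLp g 2 arc) {ζ : ℂ} (hζ : ‖ζ‖ ≤ 1) :
    localDirichlet g ζ ≤ 8 * localEnergy g ζ := by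
  obtain ⟨a, ha⟩ := exists_deviation_le hg hζ
  exact (localDirichlet_le_deviation hg hζ a).trans ha

lemma localEnergy_le_localDirichlet {g : 𝕋 → ℂ} (hg : MemLp g 2 arc) {ζ : ℂ} (hζ : ‖ζ‖ ≤ 1) :
    localEnergy g ζ ≤ 4 * localDirichlet g ζ := by
  rw [localDirichlet, ENNReal.mul_iInf_of_ne (by norm_num) (by norm_num)]
  refine le_iInf fun a => ?_
  rw [ENNReal.mul_iInf_of_ne (by norm_num) (by norm_num)]
  exact le_iInf fun _ => localEnergy_le hg hζ a

lemma mem_HD_iff_localEnergy {μ : Measure ℂ} {g : 𝕋 → ℂ} :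
    g ∈ HD μ ↔ MemLp g 2 arc ∧ ∫⁻ ζ in closedBall 0 1, localEnergy g ζ ∂μ < ∞ := by
  refine and_congr_right fun hg => ⟨fun h => ?_, fun h => ?_⟩
  · refine lt_of_le_of_lt (setLIntegral_mono' measurableSet_closedBall fun ζ hζ =>
      localEnergy_le_localDirichlet hg (by simpa using hζ)) ?_
    rw [lintegral_const_mul' _ _ ENNReal.ofNat_ne_top]
    exact ENNReal.mul_lt_top ENNReal.ofNat_lt_top h
  · refine lt_of_le_of_lt (setLIntegral_mono' measurableSet_closedBall fun ζ hζ =>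
      localDirichlet_le hg (by simpa using hζ)) ?_
    rw [lintegral_const_mul' _ _ ENNReal.ofNat_ne_top]
    exact ENNReal.mul_lt_top ENNReal.ofNat_lt_top h

lemma lintegral_localEnergy {μ : Measure ℂ} [IsFiniteMeasure μ] (g : 𝕋 → ℂ) :
    ∫⁻ ζ in closedBall 0 1, localEnergy g ζ ∂μ =
      (∫⁻ z, ‖deriv (holoPart g) z‖ₑ ^ 2 * V μ z ∂areaMeasure) +
        ∫⁻ z, ‖deriv (antiPart g) z‖ₑ ^ 2 * V μ z ∂areaMeasure := by
  have h : ∀ ζ, localEnergy g ζ =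
      (∫⁻ z, ‖deriv (holoPart g) z‖ₑ ^ 2 * szegoKernel ζ z ∂areaMeasure) +
        ∫⁻ z, ‖deriv (antiPart g) z‖ₑ ^ 2 * szegoKernel ζ z ∂areaMeasure := fun ζ => by
    simp_rw [localEnergy, energyDensity, add_mul]
    exact lintegral_add_left
      (((measurable_deriv _).enorm.pow_const 2).mul (measurable_szegoKernel_right ζ)) _
  simp_rw [h]
  rw [lintegral_add_left, ← lintegral_mul_lintegral_swap (deriv_mem_Hol (holoPart_mem_Hol g))
    measurable_szegoKernel, ← lintegral_mul_lintegral_swap (deriv_mem_Hol (antiPart_mem_Hol g))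
    measurable_szegoKernel]
  · rfl
  · exact Measurable.lintegral_prod_right'
      (f := fun p : ℂ × ℂ => ‖deriv (holoPart g) p.2‖ₑ ^ 2 * szegoKernel p.1 p.2)
      ((((measurable_deriv _).enorm.pow_const 2).comp measurable_snd).mul measurable_szegoKernel)

lemma mem_D_iff_V {μ : Measure ℂ} [IsFiniteMeasure μ] {f : ℂ → ℂ} (hf : f ∈ Hol) :
    f ∈ D μ ↔ ∫⁻ z, ‖deriv f z‖ₑ ^ 2 * V μ z ∂areaMeasure < ∞ := by
  refine ⟨fun h => lt_of_le_of_lt (lintegral_mono_ae ?_) h.2, fun h => ⟨hf, ?_⟩⟩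
  · filter_upwards [ae_mem_ball] with z hz
    gcongr
    exact V_le_U μ hz
  · exact (lintegral_mul_U_le μ (deriv_mem_Hol hf)).trans_lt
      (ENNReal.mul_lt_top ENNReal.ofNat_lt_top h)

lemma mem_HD_iff {μ : Measure ℂ} [IsFiniteMeasure μ] {g : 𝕋 → ℂ} :
    g ∈ HD μ ↔ MemLp g 2 arc ∧ holoPart g ∈ D μ ∧ antiPart g ∈ D μ := by
  rw [mem_HD_iff_localEnergy, lintegral_localEnergy, ENNReal.add_lt_top,
    mem_D_iff_V (holoPart_mem_Hol g), mem_D_iff_V (antiPart_mem_Hol g)]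

/-! ### Boundary functions -/

/-- Only `L¹` convergence is required, so that the lemma also covers products of two boundary
functions. -/
lemma fourierCoeff_eq_of_tendsto {f : ℂ → ℂ} (hf : f ∈ Hol) {u : 𝕋 → ℂ} (hu : Integrable u arc)
    (h : Tendsto (fun r : ℝ => eLpNorm (fun x => f (r * pt x) - u x) 1 arc) (𝓝[<] 1) (𝓝 0))
    (n : ℤ) : fourierCoeff u n = extZero (coef f) n := by
  have hmem : Set.Ico (0 : ℝ) 1 ∈ 𝓝[<] (1 : ℝ) := Ico_mem_nhdsLT (by norm_num)
  have h1 : Tendsto (fun r : ℝ => extZero (fun n => coef f n * (r : ℂ) ^ n) n) (𝓝[<] 1)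
      (𝓝 (extZero (coef f) n)) := by
    cases n with
    | ofNat n =>
      have : Continuous fun r : ℝ => coef f n * (r : ℂ) ^ n := by fun_prop
      simpa using (this.tendsto 1).mono_left nhdsWithin_le_nhds
    | negSucc n => exact tendsto_const_nhds
  refine tendsto_nhds_unique ?_ h1
  have h2 : Tendsto (fun r : ℝ => (eLpNorm (fun x => f (r * pt x) - u x) 1 arc).toReal) (𝓝[<] 1)
      (𝓝 0) := by
    simpa [Function.comp_def] using (ENNReal.tendsto_toReal ENNReal.zero_ne_top).comp h
  refine tendsto_iff_norm_sub_tendsto_zero.2 (squeeze_zero' (Eventually.of_forall fun _ =>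
    norm_nonneg _) ?_ h2)
  filter_upwards [hmem] with r hr
  have hv := integrable_of_continuous (continuous_dilation hf hr.1 hr.2)
  have h3 : fourierCoeff (fun x : 𝕋 => f (r * pt x)) n - fourierCoeff u n =
      fourierCoeff (fun x : 𝕋 => f (r * pt x) - u x) n := by
    rw [fourierCoeff, fourierCoeff, fourierCoeff, ← integral_sub (hv.fourier_smul _)
      (hu.fourier_smul _)]
    simp_rw [smul_sub]
  rw [← fourierCoeff_dilation hf hr.1 hr.2, h3]
  refine (norm_fourierCoeff_le _ _).trans_eq ?_
  have hsub : Integrable (fun x : 𝕋 => f (r * pt x) - u x) arc := hv.sub hu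
  rw [integral_norm_eq_lintegral_enorm hsub.1, eLpNorm_one_eq_lintegral_enorm]

lemma eLpNorm_two_eq {α : Type*} [MeasurableSpace α] {m : Measure α} (g : α → ℂ) :
    eLpNorm g 2 m = (∫⁻ x, ‖g x‖ₑ ^ 2 ∂m) ^ (1 / 2 : ℝ) := by
  rw [eLpNorm_eq_lintegral_rpow_enorm_toReal two_ne_zero ENNReal.ofNat_ne_top]
  simp only [ENNReal.toReal_ofNat, ENNReal.rpow_ofNat]

lemma memLp_dilation_sub {f : ℂ → ℂ} (hf : f ∈ Hol) {u : 𝕋 → ℂ} (hu : MemLp u 2 arc) {r : ℝ}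
    (h0 : 0 ≤ r) (h1 : r < 1) : MemLp (fun x => f (r * pt x) - u x) 2 arc :=
  (memLp_of_continuous (continuous_dilation hf h0 h1) 2).sub hu

lemma fourierCoeff_of_isBoundary {f : ℂ → ℂ} (hf : f ∈ Hol) {u : 𝕋 → ℂ} (h : IsBoundary f u)
    (n : ℤ) : fourierCoeff u n = extZero (coef f) n := by
  refine fourierCoeff_eq_of_tendsto hf (h.1.integrable one_le_two) ?_ n
  refine tendsto_of_tendsto_of_tendsto_of_le_of_le' tendsto_const_nhds h.2
    (Eventually.of_forall fun _ => zero_le) ?_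
  filter_upwards [Ico_mem_nhdsLT (show (0 : ℝ) < 1 by norm_num)] with r hr
  exact eLpNorm_le_eLpNorm_of_exponent_le one_le_two (memLp_dilation_sub hf h.1 hr.1 hr.2).1

lemma exists_fourierCoeff_eq {c : ℤ → ℂ} (hc : ∑' n, ‖c n‖ₑ ^ 2 < ∞) :
    ∃ u : 𝕋 → ℂ, MemLp u 2 arc ∧ ∀ n, fourierCoeff u n = c n := by
  have hmem : Memℓp c 2 := by
    refine memℓp_gen ?_
    simp only [ENNReal.toReal_ofNat, Real.rpow_ofNat]
    have := ENNReal.summable_toReal hc.ne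
    simpa using this
  refine ⟨(fourierBasis (T := 1)).repr.symm ⟨c, hmem⟩, Lp.memLp _, fun n => ?_⟩
  rw [← fourierBasis_repr, LinearIsometryEquiv.apply_symm_apply]

lemma ae_eq_of_fourierCoeff_eq {u v : 𝕋 → ℂ} (hu : MemLp u 2 arc) (hv : MemLp v 2 arc)
    (h : ∀ n, fourierCoeff u n = fourierCoeff v n) : u =ᵐ[arc] v := by
  have hsub : MemLp (fun x => u x - v x) 2 arc := hu.sub hv
  have h1 : ∀ n, fourierCoeff (fun x => u x - v x) n = 0 := fun n => by
    have := h n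
    rw [fourierCoeff, fourierCoeff] at this
    rw [fourierCoeff]
    simp_rw [smul_sub]
    rw [integral_sub ((hu.integrable one_le_two).fourier_smul _)
      ((hv.integrable one_le_two).fourier_smul _), this, sub_self]
  have h2 := lintegral_sq_eq_tsum_fourierCoeff hsub
  simp_rw [h1] at h2
  simp only [enorm_zero, ne_eq, OfNat.ofNat_ne_zero, not_false_eq_true, zero_pow, tsum_zero] at h2
  rw [lintegral_eq_zero_iff' (hsub.1.enorm.pow_const 2)] at h2
  filter_upwards [h2] with x hx
  simpa [sub_eq_zero] using hx

/-- By Parseval the squared distance is `∑ |a_n|² |r ^ n - 1|²`, which tends to 0 by dominated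
convergence for the counting measure. -/
lemma isBoundary_of_fourierCoeff {f : ℂ → ℂ} (hf : f ∈ Hol) {u : 𝕋 → ℂ} (hu : MemLp u 2 arc)
    (h : ∀ n, fourierCoeff u n = extZero (coef f) n) : IsBoundary f u := by
  refine ⟨hu, ?_⟩
  have hmem : Set.Ico (0 : ℝ) 1 ∈ 𝓝[<] (1 : ℝ) := Ico_mem_nhdsLT (by norm_num)
  have hsum : ∑' n : ℕ, ‖coef f n‖ₑ ^ 2 < ∞ := by
    rw [← tsum_extZero]
    simp_rw [← h]
    rw [← lintegral_sq_eq_tsum_fourierCoeff hu]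
    exact (memLp_two_iff_lintegral hu.1).1 hu
  have key : ∀ r ∈ Set.Ico (0 : ℝ) 1, ∫⁻ x, ‖f (r * pt x) - u x‖ₑ ^ 2 ∂arc =
      ∑' n : ℕ, ‖coef f n * (r : ℂ) ^ n - coef f n‖ₑ ^ 2 := by
    intro r hr
    have hv := integrable_of_continuous (continuous_dilation hf hr.1 hr.2)
    rw [lintegral_sq_eq_tsum_fourierCoeff (memLp_dilation_sub hf hu hr.1 hr.2), ← tsum_extZero]
    refine tsum_congr fun n => ?_
    have h3 : fourierCoeff (fun x : 𝕋 => f (r * pt x) - u x) n =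
        fourierCoeff (fun x : 𝕋 => f (r * pt x)) n - fourierCoeff u n := by
      rw [fourierCoeff, fourierCoeff, fourierCoeff, ← integral_sub (hv.fourier_smul _)
        ((hu.integrable one_le_two).fourier_smul _)]
      simp_rw [smul_sub]
    rw [h3, h, fourierCoeff_dilation hf hr.1 hr.2]
    cases n with
    | ofNat n => rfl
    | negSucc n => simp
  have hlim : Tendsto (fun r : ℝ => ∑' n : ℕ, ‖coef f n * (r : ℂ) ^ n - coef f n‖ₑ ^ 2) (𝓝[<] 1)
      (𝓝 0) := by
    have h4 := tendsto_lintegral_filter_of_dominated_convergence (μ := Measure.count)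
      (l := 𝓝[<] (1 : ℝ)) (F := fun r n => ‖coef f n * (r : ℂ) ^ n - coef f n‖ₑ ^ 2)
      (f := fun _ => 0) (bound := fun n => ‖coef f n‖ₑ ^ 2)
      (Eventually.of_forall fun r => measurable_from_nat) ?_ ?_ ?_
    · simpa only [lintegral_count, tsum_zero] using h4
    · filter_upwards [hmem] with r hr
      refine Eventually.of_forall fun n => ?_
      have e : coef f n * (r : ℂ) ^ n - coef f n = coef f n * ((r ^ n - 1 : ℝ) : ℂ) := by
        push_cast; ring
      gcongr
      rw [e, ← ofReal_norm, ← ofReal_norm, norm_mul, Complex.norm_real, Real.norm_eq_abs]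
      refine ENNReal.ofReal_le_ofReal (mul_le_of_le_one_right (norm_nonneg _) ?_)
      have h5 := pow_nonneg hr.1 n
      have h6 := pow_le_one₀ (n := n) hr.1 hr.2.le
      rw [abs_le]; constructor <;> linarith
    · rw [lintegral_count]; exact hsum.ne
    · refine Eventually.of_forall fun n => ?_
      have : Continuous fun r : ℝ => coef f n * (r : ℂ) ^ n - coef f n := by fun_prop
      have h7 := ((ENNReal.continuous_pow 2).comp (continuous_enorm.comp this)).tendsto 1
      simp only [Function.comp_def, Complex.ofReal_one, one_pow, mul_one, sub_self, enorm_zero,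
        ne_eq, OfNat.ofNat_ne_zero, not_false_eq_true, zero_pow] at h7
      exact h7.mono_left nhdsWithin_le_nhds
  simp_rw [eLpNorm_two_eq]
  have h8 := ((ENNReal.continuous_rpow_const (y := 1 / 2)).tendsto 0).comp hlim
  rw [ENNReal.zero_rpow_of_pos (by norm_num)] at h8
  refine h8.congr' ?_
  filter_upwards [hmem] with r hr
  rw [key r hr]; rfl

lemma exists_isBoundary {f : ℂ → ℂ} (hf : f ∈ Hol) (h : hardyNormSq f < ∞) :
    ∃ u, IsBoundary f u := by
  rw [hardyNormSq_eq hf, ← tsum_extZero] at h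
  obtain ⟨u, hu, hc⟩ := exists_fourierCoeff_eq h
  exact ⟨u, isBoundary_of_fourierCoeff hf hu hc⟩

/-! ### The harmonic Dirichlet-type space as a sum -/

lemma holoPart_eqOn {g : 𝕋 → ℂ} {f : ℂ → ℂ} (hf : f ∈ Hol)
    (h : ∀ n : ℕ, fourierCoeff g n = coef f n) : Set.EqOn f (holoPart g) (ball 0 1) := fun z hz => by
  rw [holoPart, powerSeries]
  simp_rw [h]
  exact (hasSum_coef hf hz).tsum_eq.symm

lemma antiPart_eqOn {g : 𝕋 → ℂ} {f : ℂ → ℂ} (hf : f ∈ Hol)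
    (h : ∀ n : ℕ, negCoef g n = coef f n) : Set.EqOn f (antiPart g) (ball 0 1) := fun z hz => by
  rw [antiPart, powerSeries]
  simp_rw [h]
  exact (hasSum_coef hf hz).tsum_eq.symm

lemma mem_HD_of_fourierCoeff {μ : Measure ℂ} [IsFiniteMeasure μ] {f₁ f₂ : ℂ → ℂ} (h₁ : f₁ ∈ D μ)
    (h₂ : f₂ ∈ D μ) (h0 : f₂ 0 = 0) {g : 𝕋 → ℂ} (hg : MemLp g 2 arc)
    (h : ∀ n, fourierCoeff g n = extZero (coef f₁) n + conj (extZero (coef f₂) (-n))) :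
    g ∈ HD μ := by
  refine mem_HD_iff.2 ⟨hg, mem_D_congr (holoPart_eqOn h₁.1 fun n => ?_) h₁,
    mem_D_congr (antiPart_eqOn h₂.1 fun n => ?_) h₂⟩
  · rw [h]
    cases n with
    | zero =>
      change coef f₁ 0 + conj (coef f₂ 0) = coef f₁ 0
      -- The normalization `f₂ 0 = 0` assigns the constant term to `f₁` alone.
      rw [coef_zero f₂, h0, map_zero, add_zero]
    | succ n =>
      rw [show (-((n + 1 : ℕ) : ℤ)) = -((n : ℤ) + 1) by push_cast; ring, extZero_neg_succ]
      simp [extZero_succ]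
  · cases n with
    | zero => rw [negCoef, coef_zero, h0]
    | succ n =>
      rw [negCoef, h, extZero_neg_succ, neg_neg, extZero_succ, zero_add, Complex.conj_conj]

lemma coef_zero_fun (n : ℕ) : coef (fun _ => 0) n = 0 := by
  rw [coef, iteratedDeriv_const]; simp

lemma extZero_zero_fun (n : ℤ) : extZero (coef fun _ => 0) n = 0 := by
  cases n with
  | ofNat n => exact coef_zero_fun n
  | negSucc n => rfl

lemma mem_HD_of_holomorphic {μ : Measure ℂ} [IsFiniteMeasure μ] {f : ℂ → ℂ} (hf : f ∈ D μ)
    {g : 𝕋 → ℂ} (hg : MemLp g 2 arc) (h : ∀ n, fourierCoeff g n = extZero (coef f) n) :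
    g ∈ HD μ :=
  mem_HD_of_fourierCoeff hf (const_mem_D μ 0) rfl hg fun n => by
    rw [h, extZero_zero_fun, map_zero, add_zero]

lemma memLp_conj {g : 𝕋 → ℂ} (hg : MemLp g 2 arc) : MemLp (fun x => conj (g x)) 2 arc :=
  hg.of_le (Complex.continuous_conj.comp_aestronglyMeasurable hg.1)
    (Eventually.of_forall fun _ => (Complex.norm_conj _).le)

/-- The splitting is by sign of the frequency. The boundary functions of the two parts exist because
`D μ` lies in the Hardy space, and equality on the circle is checked on Fourier coefficients. -/
lemma HD_eq_sumSpace {μ : Measure ℂ} [IsFiniteMeasure μ] (hμ : μ (closedBall 0 1)ᶜ = 0)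
    (hμ0 : μ ≠ 0) : HD μ = sumSpace μ := by
  ext g
  constructor
  · intro hg
    obtain ⟨h2, hh, ha⟩ := mem_HD_iff.1 hg
    obtain ⟨g₁, hg₁⟩ := exists_isBoundary hh.1 (hardyNormSq_lt_top hμ hμ0 hh)
    obtain ⟨g₂, hg₂⟩ := exists_isBoundary ha.1 (hardyNormSq_lt_top hμ hμ0 ha)
    have h0 : antiPart g 0 = 0 := by
      rw [← coef_zero (antiPart g), coef_antiPart, negCoef]
    refine ⟨holoPart g, hh, antiPart g, ha, h0, g₁, g₂, hg₁, hg₂, ?_⟩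
    refine ae_eq_of_fourierCoeff_eq h2 (hg₁.1.add (memLp_conj hg₂.1)) fun n => ?_
    rw [fourierCoeff_add_conj (hg₁.1.integrable one_le_two) (hg₂.1.integrable one_le_two),
      fourierCoeff_of_isBoundary hh.1 hg₁, fourierCoeff_of_isBoundary ha.1 hg₂]
    cases n with
    | ofNat n =>
      rw [Int.ofNat_eq_natCast, extZero_natCast, coef_holoPart]
      cases n with
      | zero => simp [extZero, coef_antiPart, negCoef]
      | succ n =>
        rw [show (-((n + 1 : ℕ) : ℤ)) = -((n : ℤ) + 1) by push_cast; ring, extZero_neg_succ]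
        simp
    | negSucc n =>
      rw [Int.negSucc_eq, neg_neg, extZero_neg_succ, extZero_succ, coef_antiPart, negCoef,
        Complex.conj_conj, zero_add]
  · rintro ⟨f₁, h₁, f₂, h₂, h0, g₁, g₂, hg₁, hg₂, hae⟩
    refine mem_HD_of_fourierCoeff h₁ h₂ h0
      ((memLp_congr_ae hae).2 (hg₁.1.add (memLp_conj hg₂.1))) fun n => ?_
    rw [congrFun (fourierCoeff_congr_ae hae) n,
      fourierCoeff_add_conj (hg₁.1.integrable one_le_two) (hg₂.1.integrable one_le_two),
      fourierCoeff_of_isBoundary h₁.1 hg₁, fourierCoeff_of_isBoundary h₂.1 hg₂]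

lemma mem_HD_congr {μ : Measure ℂ} [IsFiniteMeasure μ] {g h : 𝕋 → ℂ} (hae : g =ᵐ[arc] h)
    (hg : g ∈ HD μ) : h ∈ HD μ := by
  have hc := fourierCoeff_congr_ae hae
  have e1 : holoPart g = holoPart h := by rw [holoPart, holoPart, hc]
  have e2 : negCoef g = negCoef h := by
    funext n
    cases n with
    | zero => rfl
    | succ n => rw [negCoef, negCoef, hc]
  rw [mem_HD_iff] at hg ⊢
  rwa [← memLp_congr_ae hae, ← e1, antiPart, ← e2]

lemma add_mem_HD {μ : Measure ℂ} [IsFiniteMeasure μ] {g h : 𝕋 → ℂ} (hg : g ∈ HD μ)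
    (hh : h ∈ HD μ) : g + h ∈ HD μ := by
  have hm : MemLp (g + h) 2 arc := hg.1.add hh.1
  refine ⟨hm, lt_of_le_of_lt (setLIntegral_mono' measurableSet_closedBall
    -- The majorant is expressed through `localEnergy`, which is measurable in `ζ`; thus no
    -- measurability of the infimum `localDirichlet` is needed.
    (g := fun ζ => 16 * localEnergy g ζ + 16 * localEnergy h ζ) fun ζ hζ => ?_) ?_⟩
  · rw [mem_closedBall_zero_iff] at hζ
    obtain ⟨a, ha⟩ := exists_deviation_le hg.1 hζ
    obtain ⟨b, hb⟩ := exists_deviation_le hh.1 hζ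
    refine (localDirichlet_le_deviation hm hζ (a + b)).trans ?_
    calc deviation (g + h) (a + b) ζ ≤ ∫⁻ x, 2 * ‖(g x - a) / (pt x - ζ)‖ₑ ^ 2 +
          2 * ‖(h x - b) / (pt x - ζ)‖ₑ ^ 2 ∂arc := by
          refine lintegral_mono fun x => ?_
          rw [Pi.add_apply, add_sub_add_comm, add_div]
          exact enorm_add_sq_le _ _
      _ = 2 * deviation g a ζ + 2 * deviation h b ζ := by
          rw [lintegral_add_left', lintegral_const_mul' _ _ ENNReal.ofNat_ne_top,
            lintegral_const_mul' _ _ ENNReal.ofNat_ne_top, deviation, deviation]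
          refine AEMeasurable.const_mul (AEMeasurable.pow_const (AEMeasurable.enorm ?_) 2) _
          exact (hg.1.1.aemeasurable.sub aemeasurable_const).div
            (continuous_pt.measurable.sub measurable_const).aemeasurable
      _ ≤ 2 * (8 * localEnergy g ζ) + 2 * (8 * localEnergy h ζ) := by gcongr
      _ = _ := by rw [← mul_assoc, ← mul_assoc]; norm_num
  · rw [lintegral_add_left ((measurable_localEnergy g).const_mul _),
      lintegral_const_mul' _ _ ENNReal.ofNat_ne_top, lintegral_const_mul' _ _ ENNReal.ofNat_ne_top]
    have h1 := (mem_HD_iff_localEnergy.1 hg).2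
    have h2 := (mem_HD_iff_localEnergy.1 hh).2
    finiteness

/-! ### Multipliers of the harmonic space -/

lemma ae_norm_le_of_isBoundary {φ : ℂ → ℂ} (hφ : φ ∈ Hol) {B : ℝ}
    (hB : ∀ z ∈ ball (0 : ℂ) 1, ‖φ z‖ ≤ B) {g : 𝕋 → ℂ} (hg : IsBoundary φ g) :
    ∀ᵐ x ∂arc, ‖g x‖ ≤ B := by
  have hr : Tendsto radius atTop (𝓝[<] 1) :=
    tendsto_nhdsWithin_iff.2 ⟨tendsto_radius, Eventually.of_forall radius_lt_one⟩
  have h1 : TendstoInMeasure arc (fun k x => φ (radius k * pt x)) atTop g :=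
    tendstoInMeasure_of_tendsto_eLpNorm two_ne_zero
      (fun k => (continuous_dilation hφ (radius_nonneg k) (radius_lt_one k)).aestronglyMeasurable)
      hg.1.1 (hg.2.comp hr)
  obtain ⟨ns, -, hae⟩ := h1.exists_seq_tendsto_ae
  filter_upwards [hae] with x hx
  exact le_of_tendsto hx.norm (Eventually.of_forall fun k =>
    hB _ (smul_pt_mem_ball (radius_nonneg _) (radius_lt_one _) x))

lemma memLp_mul_of_ae_bound {g u : 𝕋 → ℂ} {B : ℝ} (hg : AEStronglyMeasurable g arc)
    (hB : ∀ᵐ x ∂arc, ‖g x‖ ≤ B) (hu : MemLp u 2 arc) : MemLp (g * u) 2 arc := by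
  refine (hu.const_mul (B : ℂ)).of_le (hg.mul hu.1) ?_
  filter_upwards [hB] with x hx
  rw [Pi.mul_apply, norm_mul, norm_mul, Complex.norm_real]
  gcongr
  exact hx.trans (le_abs_self _)

lemma eLpNorm_one_mul_le {u v : 𝕋 → ℂ} (hu : AEStronglyMeasurable u arc)
    (hv : AEStronglyMeasurable v arc) :
    eLpNorm (fun x => u x * v x) 1 arc ≤ eLpNorm u 2 arc * eLpNorm v 2 arc :=
  eLpNorm_smul_le_mul_eLpNorm (𝕜 := ℂ) (E := ℂ) (f := v) (φ := u) (p := 2) (q := 2) (r := 1) hv hu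

/-- With `φ_r`, `f_r` the dilations, `φ_r f_r - g u = φ_r (f_r - u) + (φ_r - g) u`; the bound on `φ`
and the Cauchy–Schwarz inequality give convergence in `L¹`. -/
lemma fourierCoeff_mul_of_isBoundary {φ f : ℂ → ℂ} (hφ : φ ∈ Hol) (hf : f ∈ Hol) {B : ℝ}
    (hB : ∀ z ∈ ball (0 : ℂ) 1, ‖φ z‖ ≤ B) {g u : 𝕋 → ℂ} (hg : IsBoundary φ g)
    (hu : IsBoundary f u) (n : ℤ) : fourierCoeff (g * u) n = extZero (coef (φ * f)) n := by
  have hgu := memLp_mul_of_ae_bound hg.1.1 (ae_norm_le_of_isBoundary hφ hB hg) hu.1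
  refine fourierCoeff_eq_of_tendsto (DifferentiableOn.mul hφ hf) (hgu.integrable one_le_two) ?_ n
  have h1 : Tendsto (fun r : ℝ => ENNReal.ofReal B * eLpNorm (fun x => f (r * pt x) - u x) 2 arc +
      eLpNorm (fun x => φ (r * pt x) - g x) 2 arc * eLpNorm u 2 arc) (𝓝[<] 1) (𝓝 0) := by
    have h2 := ENNReal.Tendsto.const_mul (a := ENNReal.ofReal B) hu.2 (Or.inr ENNReal.ofReal_ne_top)
    have h3 := ENNReal.Tendsto.mul_const (b := eLpNorm u 2 arc) hg.2 (Or.inr hu.1.2.ne)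
    simpa using h2.add h3
  refine tendsto_of_tendsto_of_tendsto_of_le_of_le' tendsto_const_nhds h1
    (Eventually.of_forall fun _ => zero_le) ?_
  filter_upwards [Ico_mem_nhdsLT (show (0 : ℝ) < 1 by norm_num)] with r hr
  have hφr := (continuous_dilation hφ hr.1 hr.2).aestronglyMeasurable (μ := arc)
  have hfr := (memLp_dilation_sub hf hu.1 hr.1 hr.2).1
  have hgr := (memLp_dilation_sub hφ hg.1 hr.1 hr.2).1
  have e : (fun x => (φ * f) (r * pt x) - (g * u) x) =
      (fun x => φ (r * pt x) * (f (r * pt x) - u x)) + fun x => (φ (r * pt x) - g x) * u x := by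
    funext x; simp only [Pi.mul_apply, Pi.add_apply]; ring
  rw [e]
  refine (eLpNorm_add_le (hφr.mul hfr) (hgr.mul hu.1.1) le_rfl).trans
    (add_le_add ((eLpNorm_one_mul_le hφr hfr).trans ?_) (eLpNorm_one_mul_le hgr hu.1.1))
  gcongr
  refine (eLpNorm_le_of_ae_bound (C := B) (Eventually.of_forall fun x =>
    hB _ (smul_pt_mem_ball hr.1 hr.2 x))).trans_eq ?_
  simp

/-- The heart of the inclusion of multipliers. Subtracting `g conj a` from `g conj u` is harmless,
but `g conj a` is not constant. Writing `conj a = θ a` with `|θ| ≤ 1`, one approximates `g a` by `g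
u`, with error `g (u - a)`, and `g u` by the constant `c`. -/
lemma exists_deviation_mul_conj_le {g u : 𝕋 → ℂ} {B : ℝ} (hB : ∀ᵐ x ∂arc, ‖g x‖ ≤ B)
    (hu : AEStronglyMeasurable u arc) (a c ζ : ℂ) :
    ∃ b, deviation (fun x => g x * conj (u x)) b ζ ≤
      6 * ENNReal.ofReal B ^ 2 * deviation u a ζ + 4 * deviation (g * u) c ζ := by
  obtain ⟨θ, hθ, hconj⟩ : ∃ θ : ℂ, ‖θ‖ ≤ 1 ∧ conj a = θ * a := by
    -- For `a = 0` any `θ` would do; otherwise `θ` is the unimodular quotient.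
    by_cases ha : a = 0
    · exact ⟨0, by simp, by simp [ha]⟩
    · refine ⟨conj a / a, ?_, (div_mul_cancel₀ _ ha).symm⟩
      rw [norm_div, Complex.norm_conj, div_self (norm_ne_zero_iff.2 ha)]
  have hθ' : ‖θ‖ₑ ≤ 1 := by
    rw [← ofReal_norm]; exact ENNReal.ofReal_le_one.2 hθ
  refine ⟨θ * c, ?_⟩
  have hm : AEMeasurable (fun x => 6 * ENNReal.ofReal B ^ 2 * ‖(u x - a) / (pt x - ζ)‖ₑ ^ 2) arc := by
    refine AEMeasurable.const_mul (AEMeasurable.pow_const (AEMeasurable.enorm ?_) 2) _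
    exact (hu.aemeasurable.sub aemeasurable_const).div
      (continuous_pt.measurable.sub measurable_const).aemeasurable
  rw [deviation, deviation, deviation, ← lintegral_const_mul' _ _ (by finiteness),
    ← lintegral_const_mul' _ _ ENNReal.ofNat_ne_top, ← lintegral_add_left' hm]
  refine lintegral_mono_ae ?_
  filter_upwards [hB] with x hx
  have hgx := enorm_le_of_norm_le hx
  set d := pt x - ζ
  set X := ‖(u x - a) / d‖ₑ ^ 2 with hX
  have hconjX : ‖conj (u x - a) / d‖ₑ ^ 2 = X := by
    rw [hX, ← ofReal_norm, ← ofReal_norm, norm_div, norm_div, Complex.norm_conj]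
  have e1 : (g x * conj (u x) - θ * c) / d =
      g x * (conj (u x - a) / d) + θ * (((g * u) x - c) / d - g x * ((u x - a) / d)) := by
    rw [map_sub, hconj, Pi.mul_apply]; ring
  rw [e1]
  -- Squaring the sum twice gives the coefficients `2 + 4 = 6` for the deviation of `u` and `2 · 2 =
  -- 4` for that of `g * u`.
  calc _ ≤ 2 * ‖g x * (conj (u x - a) / d)‖ₑ ^ 2 +
        2 * ‖θ * (((g * u) x - c) / d - g x * ((u x - a) / d))‖ₑ ^ 2 := enorm_add_sq_le _ _
    _ ≤ 2 * (ENNReal.ofReal B ^ 2 * X) + 2 * (1 ^ 2 * (2 * ‖((g * u) x - c) / d‖ₑ ^ 2 +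
        2 * (ENNReal.ofReal B ^ 2 * X))) := by
        rw [enorm_mul, mul_pow, hconjX, enorm_mul, mul_pow]
        gcongr
        refine (enorm_sub_sq_le _ _).trans ?_
        rw [enorm_mul, mul_pow, ← hX]
        gcongr
    _ = _ := by ring

lemma mul_conj_mem_HD {μ : Measure ℂ} [IsFiniteMeasure μ] {g u : 𝕋 → ℂ} {B : ℝ}
    (hg : AEStronglyMeasurable g arc) (hB : ∀ᵐ x ∂arc, ‖g x‖ ≤ B) (hu : u ∈ HD μ)
    (hgu : g * u ∈ HD μ) : (g * fun x => conj (u x)) ∈ HD μ := by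
  have hm : MemLp (g * fun x => conj (u x)) 2 arc := memLp_mul_of_ae_bound hg hB (memLp_conj hu.1)
  refine ⟨hm, lt_of_le_of_lt (setLIntegral_mono' measurableSet_closedBall
    (g := fun ζ => 6 * ENNReal.ofReal B ^ 2 * (8 * localEnergy u ζ) +
      4 * (8 * localEnergy (g * u) ζ)) fun ζ hζ => ?_) ?_⟩
  · rw [mem_closedBall_zero_iff] at hζ
    obtain ⟨a, ha⟩ := exists_deviation_le hu.1 hζ
    obtain ⟨c, hc⟩ := exists_deviation_le hgu.1 hζ
    obtain ⟨b, hb⟩ := exists_deviation_mul_conj_le hB hu.1.1 a c ζ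
    refine ((localDirichlet_le_deviation hm hζ b).trans hb).trans ?_
    gcongr
  · rw [lintegral_add_left (((measurable_localEnergy u).const_mul _).const_mul _),
      lintegral_const_mul' _ _ (by finiteness), lintegral_const_mul' _ _ ENNReal.ofNat_ne_top,
      lintegral_const_mul' _ _ ENNReal.ofNat_ne_top, lintegral_const_mul' _ _ ENNReal.ofNat_ne_top]
    have h1 := (mem_HD_iff_localEnergy.1 hu).2
    have h2 := (mem_HD_iff_localEnergy.1 hgu).2
    finiteness

/-- Decompose an element of `HD μ` as `u₁ + conj u₂`. The product with `u₁` is the boundary function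
of `φ f₁ ∈ D μ`; the product with `conj u₂` is controlled by `u₂` and `g u₂`, the latter handled in
the same way as `g u₁`. -/
lemma mem_multHD_of_isBoundary {μ : Measure ℂ} [IsFiniteMeasure μ] (hμ : μ (closedBall 0 1)ᶜ = 0)
    (hμ0 : μ ≠ 0) {φ : ℂ → ℂ} (hφ : φ ∈ multD μ) {g : 𝕋 → ℂ} (hg : IsBoundary φ g) :
    g ∈ multHD μ := by
  obtain ⟨B, hB⟩ := (mem_Hinf_of_mem_multD hμ hμ0 hφ).2
  have hBg := ae_norm_le_of_isBoundary hφ.1.1 hB hg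
  have hmul : ∀ f ∈ D μ, ∀ u, IsBoundary f u → g * u ∈ HD μ := fun f hf u hu =>
    mem_HD_of_holomorphic (hφ.2 f hf) (memLp_mul_of_ae_bound hg.1.1 hBg hu.1)
      (fourierCoeff_mul_of_isBoundary hφ.1.1 hf.1 hB hg hu)
  refine ⟨mem_HD_of_holomorphic hφ.1 hg.1 (fourierCoeff_of_isBoundary hφ.1.1 hg), fun w hw => ?_⟩
  rw [HD_eq_sumSpace hμ hμ0] at hw
  obtain ⟨f₁, h₁, f₂, h₂, -, u₁, u₂, hu₁, hu₂, hae⟩ := hw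
  have hu₂' : u₂ ∈ HD μ :=
    mem_HD_of_holomorphic h₂ hu₂.1 (fourierCoeff_of_isBoundary h₂.1 hu₂)
  refine mem_HD_congr ?_ (add_mem_HD (hmul f₁ h₁ u₁ hu₁)
    (mul_conj_mem_HD hg.1.1 hBg hu₂' (hmul f₂ h₂ u₂ hu₂)))
  filter_upwards [hae] with x hx
  rw [Pi.mul_apply, hx, Pi.add_apply, Pi.mul_apply, Pi.mul_apply, mul_add]

end DirichletType

theorem proposition2p3 (μ : MeasureTheory.Measure ℂ) [MeasureTheory.IsFiniteMeasure μ]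
    (hμ : μ (Metric.closedBall 0 1)ᶜ = 0) (hμ0 : μ ≠ 0) :
    (∀ φ : ℂ → ℂ, φ ∈ DirichletType.multD μ ↔
      φ ∈ DirichletType.Hinf ∧
        DirichletType.IsCarleson μ (DirichletType.derivMeasure φ (DirichletType.U μ))) ∧
    (∀ φ : ℂ → ℂ, φ ∈ DirichletType.multD μ ↔
      φ ∈ DirichletType.Hinf ∧
        DirichletType.IsCarleson μ (DirichletType.derivMeasure φ (DirichletType.V μ))) ∧
    DirichletType.HD μ = DirichletType.sumSpace μ ∧
    (∀ φ ∈ DirichletType.multD μ,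
      (∃ g : DirichletType.𝕋 → ℂ, DirichletType.IsBoundary φ g) ∧
        ∀ g : DirichletType.𝕋 → ℂ, DirichletType.IsBoundary φ g → g ∈ DirichletType.multHD μ) :=
  ⟨DirichletType.mem_multD_iff_U hμ hμ0, DirichletType.mem_multD_iff_V hμ hμ0,
    DirichletType.HD_eq_sumSpace hμ hμ0, fun _ hφ =>
    ⟨DirichletType.exists_isBoundary hφ.1.1 (DirichletType.hardyNormSq_lt_top hμ hμ0 hφ.1),
      fun _ hg => DirichletType.mem_multHD_of_isBoundary hμ hμ0 hφ hg⟩⟩
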